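/- **Setting.** Let $\mu$ be a Borel probability measure on $\mathbb R^{d}$ with one-dimensional marginals $\mu_1,\dots,\mu_d$, and let $Y_1,Y_2,\dots$ be i.i.d. with law $\mu$. A marginal $\mu_i$ is *lattice* if $\operatorname{supp}\mu_i\subset\kappa\mathbb Z$ for some $\kappa>0$. Throughout, $\mu_i((0,\infty))>0$ for every $i$, and every lattice marginal satisfies $\operatorname{supp}\mu_i\subset\mathbb Z$ and $\gcd(\operatorname{supp}\mu_i)=1$. Reflected random walk (RRW) driven by $\mu$ is $X_0^x=x$, $X_n^x=|X_{n-1}^x-Y_n|$ (coordinatewise absolute value), on the space $\mathcal X$ of all $x\in[0,\infty)^d$ with $x_i\in\mathbb N_0$ for every lattice coordinate $i$. For $x\in\mathcal X$ let $\pi(x)$ be the vector of the parities in $\mathbb Z_2$ of its lattice coordinates, and let $\Gamma$ be the group of parity vectors generated by those $\varepsilon$ with $\mathbb P[\pi(Y_1)=\varepsilon]>0$. The cosets of $\Gamma$ split $\mathcal X$ into classes $\mathcal X^{(j)}$, which the walk does not leave. Let $\mathcal L^{(j)}$ be the largest (relatively) closed subset of $\mathcal X^{(j)}$ such that for every open $U$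 meeting $\mathcal L^{(j)}$ and every $x\in\mathcal X^{(j)}$, $\mathbb P[X_n^x\in U\text{ infinitely often}]=1$. RRW is *recurrent* on $\mathcal X^{(j)}$ if $\mathcal L^{(j)}\neq\emptyset$. It is *positive recurrent* there if moreover for every open $U$ and every $x\in U\cap\mathcal L^{(j)}$ the return time $\inf\{n\ge1:X_n^x\in U\}$ has finite expectation, and *null recurrent* there if it is recurrent but not positive recurrent. RRW is called positive (resp. null) recurrent (on its essential classes) if it is so for every $j$. **Statement.** Let $\mu$ be as above on $\mathbb R^{r_1+r_2}$, let $\mu_{\lfloor r_1\rfloor}$ and $\mu_{\lceil r_2\rceil}$ be its marginals on the first $r_1$ and the last $r_2$ coordinates, and suppose $\mu=\mu_{\lfloor r_1\rfloor}\otimes\mu_{\lceil r_2\rceil}$. Suppose that RRW driven by $\mu_{\lfloor r_1\rfloor}$ is positive recurrent. 1. If RRW driven by $\mu_{\lceil r_2\rceil}$ is null recurrent, then RRW driven by $\mu$ is null recurrent. 2. If $r_2=1$ and the law $\nu=\mu_{\lceil 1\rceil}$ on $\mathbb R$, with $Y$ a random variable of law $\nu$, $Y^+=\max\{Y,0\}$,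 $Y^-=\max\{-Y,0\}$, satisfies one of the following conditions, then RRW driven by $\mu$ is null recurrent: - $\operatorname{supp}\nu\subset[0,\infty)$, $\mathbb E(Y)=\infty$, and at least one of: $\mathbb E(\sqrt Y)<\infty$; $\int_0^\infty\nu((x,\infty))^2\,dx<\infty$; $\lim_{y\to\infty}\nu((y,\infty))\int_0^y\nu((x,y])\,dx=0$; - $\mathbb E(Y^-)<\mathbb E(Y^+)=\infty$ and $\mathbb E(\sqrt{Y^+})<\infty$; - $0<\mathbb E(Y^-)=\mathbb E(Y^+)$ and $\mathbb E\bigl((Y^+)^{3/2}\bigr)<\infty$; - $\nu$ is symmetric, and either the ordinary random walk $S_n$ with i.i.d. steps of law $\nu$ is recurrent (it returns to every neighbourhood of $0$ infinitely often with probability $1$) or $\mathbb E|Y|<\infty$. -/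

import Mathlib

open MeasureTheory Filter Topology Set
open scoped ENNReal

namespace ReflectedWalk

noncomputable section

/-! ### One-dimensional laws -/

/-- A law on `ℝ` is lattice if its support lies in `κ ℤ` for some `κ > 0`. -/
def IsLattice (ν : Measure ℝ) : Prop :=
  ∃ κ : ℝ, 0 < κ ∧ ∀ y ∈ ν.support, ∃ k : ℤ, y = κ * k

/-- The normalisation of a lattice law: the support lies in `ℤ` and its greatest common divisor
is `1` (the only natural number that divides every element of the support is `1`). -/
def IsNormalizedLattice (ν : Measure ℝ) : Prop :=
  (∀ y ∈ ν.support, ∃ k : ℤ, y = k) ∧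
    ∀ m : ℕ, (∀ y ∈ ν.support, ∃ k : ℤ, y = (m : ℝ) * k) → m = 1

/-! ### Reflected random walk in dimension `d` -/

variable {d : ℕ}

/-- The `i`-th one-dimensional marginal. -/
def coordMarginal (μ : Measure (Fin d → ℝ)) (i : Fin d) : Measure ℝ :=
  μ.map (fun y => y i)

/-- The joint law of the first `r₁` coordinates. -/
def firstMarginal {r₁ r₂ : ℕ} (μ : Measure (Fin (r₁ + r₂) → ℝ)) : Measure (Fin r₁ → ℝ) :=
  μ.map (fun y i => y (Fin.castAdd r₂ i))

/-- The joint law of the last `r₂` coordinates. -/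
def lastMarginal {r₁ r₂ : ℕ} (μ : Measure (Fin (r₁ + r₂) → ℝ)) : Measure (Fin r₂ → ℝ) :=
  μ.map (fun y i => y (Fin.natAdd r₁ i))

/-- The product law `μ₁ ⊗ μ₂` on `ℝ^(r₁ + r₂)`. -/
def productLaw {r₁ r₂ : ℕ} (μ₁ : Measure (Fin r₁ → ℝ)) (μ₂ : Measure (Fin r₂ → ℝ)) :
    Measure (Fin (r₁ + r₂) → ℝ) :=
  (μ₁.prod μ₂).map (fun p => Fin.append p.1 p.2)

/-- The state space: coordinates are non-negative reals, and natural numbers in the lattice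
coordinates. -/
def stateSpace (μ : Measure (Fin d → ℝ)) : Set (Fin d → ℝ) :=
  {x | ∀ i, 0 ≤ x i ∧ (IsLattice (coordMarginal μ i) → ∃ k : ℕ, x i = k)}

/-- The trajectory `X_0 = x`, `X_{n+1} = |X_n - Y_{n+1}|` (coordinatewise), for a given sequence of
increments; `y n` plays the role of `Y_{n+1}`. -/
def path (x : Fin d → ℝ) (y : ℕ → Fin d → ℝ) : ℕ → Fin d → ℝ
  | 0 => x
  | n + 1 => fun i => |path x y n i - y n i|

/-- The law of an i.i.d. sequence of `μ`-distributed increments. -/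
def incrementLaw {E : Type*} [MeasurableSpace E] (μ : Measure E) : Measure (ℕ → E) :=
  Measure.infinitePi (fun _ : ℕ => μ)

open scoped Classical in
/-- The vector of parities of the lattice coordinates. The other coordinates carry no parity and
are given the value `0`. -/
def parity (μ : Measure (Fin d → ℝ)) (x : Fin d → ℝ) : Fin d → ZMod 2 :=
  fun i => if IsLattice (coordMarginal μ i) then ((⌊x i⌋ : ℤ) : ZMod 2) else 0

/-- The group of all parity vectors that the random walk of parities, started at `0`, can reach. -/
def parityGroup (μ : Measure (Fin d → ℝ)) : AddSubgroup (Fin d → ZMod 2) :=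
  AddSubgroup.closure {ε | 0 < μ {y | parity μ y = ε}}

/-- The class of `x`: all states whose parity vector lies in the same coset of the parity group.
Reflected random walk never leaves its class. -/
def parityClass (μ : Measure (Fin d → ℝ)) (x : Fin d → ℝ) : Set (Fin d → ℝ) :=
  {y | y ∈ stateSpace μ ∧ parity μ y - parity μ x ∈ parityGroup μ}

/-- From every starting point of `C`, the walk visits the set `U` infinitely often almost surely. -/
def VisitedInfinitelyOften (μ : Measure (Fin d → ℝ)) (C U : Set (Fin d → ℝ)) : Prop :=
  ∀ x ∈ C, ∀ᵐ y ∂(incrementLaw μ), ∃ᶠ n in atTop, path x y n ∈ U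

/-- The points of `C` all of whose neighbourhoods are visited infinitely often almost surely, from
every starting point of `C`. This is the largest closed subset `L` of `C` such that every open set
which meets `L` is visited infinitely often almost surely from every starting point of `C`. -/
def attractor (μ : Measure (Fin d → ℝ)) (C : Set (Fin d → ℝ)) : Set (Fin d → ℝ) :=
  {z | z ∈ C ∧ ∀ U : Set (Fin d → ℝ), IsOpen U → z ∈ U → VisitedInfinitelyOften μ C U}

/-- Among the subsets `L` of `C` such that every open set which meets `L` is visited infinitely
often, the attractor is the greatest. -/
theorem isGreatest_attractor (μ : Measure (Fin d → ℝ)) (C : Set (Fin d → ℝ)) :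
    IsGreatest {L : Set (Fin d → ℝ) | L ⊆ C ∧
      ∀ U : Set (Fin d → ℝ), IsOpen U → (U ∩ L).Nonempty → VisitedInfinitelyOften μ C U}
      (attractor μ C) := by
  refine ⟨⟨fun z hz => hz.1, ?_⟩, ?_⟩
  · rintro U hU ⟨z, hzU, hz⟩
    exact hz.2 U hU hzU
  · rintro L ⟨hL, h⟩ z hz
    exact ⟨hL hz, fun U hU hzU => h U hU ⟨z, hzU, hz⟩⟩

/-- The attractor is closed in `C`. -/
theorem mem_attractor_of_mem_closure (μ : Measure (Fin d → ℝ)) (C : Set (Fin d → ℝ))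
    {z : Fin d → ℝ} (hzC : z ∈ C) (hz : z ∈ closure (attractor μ C)) : z ∈ attractor μ C := by
  refine ⟨hzC, fun U hU hzU => ?_⟩
  obtain ⟨w, hwU, hw⟩ := mem_closure_iff.1 hz U hU hzU
  exact hw.2 U hU hwU

/-- Topological recurrence on the class `C`. -/
def IsRecurrentOn (μ : Measure (Fin d → ℝ)) (C : Set (Fin d → ℝ)) : Prop :=
  (attractor μ C).Nonempty

/-- The first time `n ≥ 1` at which the walk started at `x` is in `U` (infinite if there is none). -/
def returnTime (U : Set (Fin d → ℝ)) (x : Fin d → ℝ) (y : ℕ → Fin d → ℝ) : ℝ≥0∞ :=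
  ⨅ (n : ℕ) (_ : 1 ≤ n ∧ path x y n ∈ U), (n : ℝ≥0∞)

/-- The return time to every open set that meets `L` has finite expectation (for the walk started
in any point of that open set that belongs to `L`). -/
def FiniteMeanReturn (μ : Measure (Fin d → ℝ)) (L : Set (Fin d → ℝ)) : Prop :=
  ∀ U : Set (Fin d → ℝ), IsOpen U → ∀ x ∈ U ∩ L, ∫⁻ y, returnTime U x y ∂(incrementLaw μ) < ∞

/-- Reflected random walk driven by `μ` is positive recurrent on its essential classes: each class
of the state space has a non-empty attractor, on which the walk is positive recurrent. -/
def IsPositiveRecurrent (μ : Measure (Fin d → ℝ)) : Prop :=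
  ∀ x ∈ stateSpace μ, IsRecurrentOn μ (parityClass μ x) ∧
    FiniteMeanReturn μ (attractor μ (parityClass μ x))

/-- Reflected random walk driven by `μ` is null recurrent on its essential classes: each class
of the state space has a non-empty attractor, on which the walk is not positive recurrent. -/
def IsNullRecurrent (μ : Measure (Fin d → ℝ)) : Prop :=
  ∀ x ∈ stateSpace μ, IsRecurrentOn μ (parityClass μ x) ∧
    ¬ FiniteMeanReturn μ (attractor μ (parityClass μ x))

/-! ### One-dimensional criteria for null recurrence -/

/-- Expectation of the positive part. -/
def meanPos (ν : Measure ℝ) : ℝ≥0∞ := ∫⁻ y, ENNReal.ofReal (max y 0) ∂ν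

/-- Expectation of the negative part. -/
def meanNeg (ν : Measure ℝ) : ℝ≥0∞ := ∫⁻ y, ENNReal.ofReal (max (-y) 0) ∂ν

/-- Expectation of the power `p` of the positive part. -/
def momentPos (ν : Measure ℝ) (p : ℝ) : ℝ≥0∞ := ∫⁻ y, ENNReal.ofReal (max y 0 ^ p) ∂ν

/-- Non-negative increments with infinite mean, and one of three tail conditions. -/
def NonnegCriterion (ν : Measure ℝ) : Prop :=
  ν.support ⊆ Ici 0 ∧ meanPos ν = ∞ ∧
    (momentPos ν (1 / 2) < ∞ ∨
      ∫⁻ x in Ioi (0 : ℝ), ν (Ioi x) ^ 2 < ∞ ∨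
      Tendsto (fun y : ℝ => ν (Ioi y) * ∫⁻ x in Ioc 0 y, ν (Ioc x y)) atTop (𝓝 0))

/-- Two-sided increments with `E(Y⁻) < E(Y⁺) = ∞` and finite `E(√Y⁺)`. -/
def DriftCriterion (ν : Measure ℝ) : Prop :=
  meanNeg ν < meanPos ν ∧ meanPos ν = ∞ ∧ momentPos ν (1 / 2) < ∞

/-- Two-sided increments with `0 < E(Y⁻) = E(Y⁺)` and finite `E((Y⁺)^(3/2))`. -/
def CentredCriterion (ν : Measure ℝ) : Prop :=
  0 < meanNeg ν ∧ meanNeg ν = meanPos ν ∧ momentPos ν (3 / 2) < ∞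

/-- The ordinary random walk with step law `ν` returns to each neighbourhood of `0` infinitely
often almost surely. -/
def IsRecurrentSumWalk (ν : Measure ℝ) : Prop :=
  ∀ U : Set ℝ, IsOpen U → 0 ∈ U →
    ∀ᵐ y ∂(incrementLaw ν), ∃ᶠ n in atTop, ∑ k ∈ Finset.range n, y k ∈ U

/-- Symmetric increments such that the ordinary random walk is recurrent or the first moment is
finite. -/
def SymmetricCriterion (ν : Measure ℝ) : Prop :=
  ν.map (fun y => -y) = ν ∧ (IsRecurrentSumWalk ν ∨ Integrable (fun y : ℝ => y) ν)

/-- One of the criteria for null recurrence of one-dimensional reflected random walk holds. -/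
def NullRecurrenceCriterion (ν : Measure ℝ) : Prop :=
  NonnegCriterion ν ∨ DriftCriterion ν ∨ CentredCriterion ν ∨ SymmetricCriterion ν

end

end ReflectedWalk

/-! Two reflected trajectories driven by the same increments never move apart (`dist_path_le`), and
states of equal parities can be brought arbitrarily close (`exists_dist_path_lt`). These two facts
replace irreducibility: a visit near one point becomes, with probability bounded below, a later
visit near another, and Lévy's zero-one law turns such bounds into infinitely many visits
(`ae_frequently_imp_frequently`).

Product. A positive recurrent walk started at a point of its attractor is near that point with
probability bounded below at every late time compatible with the parities (`exists_lower_bound`):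
finite mean return times force a visit in some window of bounded length, and contraction adjusts the
remaining delay. It therefore makes infinitely many visits along any given infinite set of times of
the right phase (`ae_frequently_mem_times`). Applied to the random, but independent, set of visit
times of the other block, this makes the two blocks return together infinitely often
(`mem_attractor_of_parts`). The product cannot have finite mean return times, since a return to a
cylinder over the last block is a return of that block.

Dimension one, recurrence. If the walk does not tend to infinity, then it visits every neighbourhood
of the origin infinitely often. If it does, then its Green function is bounded in the starting
point, so an unbounded Green function suffices (`ae_not_tendsto_of_green`). For non-negative
increments, unboundedness comes from the density `ν (x, y]`, which is invariant for the walk with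
increments restricted to at most `y`, up to mass (`exists_lt_of_superharmonic`). Two-sided
increments are reduced to this case through the first positive partial sum, whose moment of order
`1/2` is estimated by the moments of `ν` (`ae_not_tendsto_of_ladder`). In the symmetric case the
walk has the one-dimensional laws of `|x - S n|`.

Dimension one, infinite mean return time. Wald's identity for the increments up to the first return
contradicts a finite mean, both for equal finite means of the two parts and for an infinite mean of
the positive part. -/

set_option linter.unusedSectionVars false

namespace ReflectedWalk

/-! ### Independent sequences -/

section Sequences

variable {E : Type*} [MeasurableSpace E]

instance isProbabilityMeasure_incrementLaw (μ : Measure E) [IsProbabilityMeasure μ] :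
    IsProbabilityMeasure (incrementLaw μ) := by
  unfold incrementLaw; infer_instance

/-- The sequence that consists of the first `n` terms of `ω`, followed by `η`. -/
def splice (n : ℕ) (ω η : ℕ → E) : ℕ → E := fun k => if k < n then ω k else η (k - n)

/-- The sequence that consists of a finite tuple, followed by `η`. -/
def spliceFin (n : ℕ) (p : Fin n → E) (η : ℕ → E) : ℕ → E :=
  fun k => if h : k < n then p ⟨k, h⟩ else η (k - n)

theorem splice_eq_spliceFin (n : ℕ) (ω η : ℕ → E) :
    splice n ω η = spliceFin n (fun k : Fin n => ω k) η := by
  funext k; simp [splice, spliceFin]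

theorem measurable_splice (n : ℕ) :
    Measurable (fun p : (ℕ → E) × (ℕ → E) => splice n p.1 p.2) := by
  refine measurable_pi_lambda _ fun k => ?_
  by_cases h : k < n
  · simp only [splice, h, if_true]; fun_prop
  · simp only [splice, h, if_false]; fun_prop

theorem measurable_spliceFin (n : ℕ) :
    Measurable (fun p : (Fin n → E) × (ℕ → E) => spliceFin n p.1 p.2) := by
  refine measurable_pi_lambda _ fun k => ?_
  by_cases h : k < n
  · simp only [spliceFin, h, dif_pos]; fun_prop
  · simp only [spliceFin, h, dif_neg, not_false_iff]; fun_prop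

theorem measurable_splice_right (n : ℕ) (ω : ℕ → E) : Measurable (splice n ω) :=
  (measurable_splice n).comp measurable_prodMk_left

theorem splice_add (n : ℕ) (ω η : ℕ → E) (k : ℕ) : splice n ω η (n + k) = η k := by
  simp [splice]

theorem splice_of_lt {n : ℕ} (ω η : ℕ → E) {k : ℕ} (h : k < n) : splice n ω η k = ω k := by
  simp [splice, h]

variable (μ : Measure E) [IsProbabilityMeasure μ]

/-- The preimage of a finite box is the product of a box in the first `n` coordinates and a shifted
box in the others, so the product formula gives the same mass. Every use of the Markov property
below rests on this. -/
theorem map_splice (n : ℕ) :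
    ((incrementLaw μ).prod (incrementLaw μ)).map (fun p => splice n p.1 p.2) = incrementLaw μ := by
  refine Measure.eq_infinitePi _ fun s t ht => ?_
  rw [Measure.map_apply (measurable_splice n) (.pi s.countable_toSet fun _ _ => ht _)]
  have : (fun p : (ℕ → E) × (ℕ → E) => splice n p.1 p.2) ⁻¹' ((s : Set ℕ).pi t) =
      (((s.filter (· < n) : Finset ℕ) : Set ℕ).pi t) ×ˢ
        ((((s.filter (¬ · < n)).image (· - n) : Finset ℕ) : Set ℕ).pi fun k => t (n + k)) := by
    ext p
    simp only [mem_preimage, Set.mem_pi, Finset.mem_coe, mem_prod, Finset.mem_filter,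
      Finset.mem_image]
    constructor
    · intro h
      refine ⟨fun i hi => by simpa [splice, hi.2] using h i hi.1, ?_⟩
      rintro _ ⟨i, hi, rfl⟩
      have h1 := h i hi.1
      have h2 : n + (i - n) = i := by have := hi.2; omega
      simpa [splice, hi.2, h2] using h1
    · rintro ⟨h1, h2⟩ i hi
      by_cases hn : i < n
      · simpa [splice, hn] using h1 i ⟨hi, hn⟩
      · have h3 : n + (i - n) = i := by omega
        have h4 := h2 (i - n) ⟨i, ⟨hi, hn⟩, rfl⟩
        rw [h3] at h4
        simpa [splice, hn] using h4
  rw [this, Measure.prod_prod]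
  unfold incrementLaw
  rw [Measure.infinitePi_pi _ (fun i _ => ht i), Measure.infinitePi_pi _ (fun i _ => ht _),
    Finset.prod_image, ← Finset.prod_filter_mul_prod_filter_not s (· < n)]
  · congr 1
    refine Finset.prod_congr rfl fun i hi => ?_
    have h2 : n + (i - n) = i := by have := (Finset.mem_filter.1 hi).2; omega
    rw [h2]
  · intro i hi j hj hij
    have h1 := (Finset.mem_filter.1 hi).2
    have h2 := (Finset.mem_filter.1 hj).2
    simp only at hij
    omega

/-- The Markov property: integrals over sequences can be computed by splicing two independent
sequences. -/
theorem lintegral_splice (n : ℕ) {f : (ℕ → E) → ℝ≥0∞} (hf : Measurable f) :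
    ∫⁻ ω, f ω ∂(incrementLaw μ) =
      ∫⁻ ω, ∫⁻ η, f (splice n ω η) ∂(incrementLaw μ) ∂(incrementLaw μ) := by
  conv_lhs => rw [← map_splice μ n]
  rw [lintegral_map hf (measurable_splice n)]
  exact lintegral_prod _ (hf.comp (measurable_splice n)).aemeasurable

theorem measure_splice (n : ℕ) {B : Set (ℕ → E)} (hB : MeasurableSet B) :
    incrementLaw μ B =
      ∫⁻ ω, incrementLaw μ {η | splice n ω η ∈ B} ∂(incrementLaw μ) := by
  rw [← lintegral_indicator_one hB, lintegral_splice μ n (measurable_one.indicator hB)]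
  refine lintegral_congr fun ω => ?_
  exact lintegral_indicator_one (measurable_splice_right n ω hB)

theorem ae_apply (n : ℕ) {p : E → Prop} (hp : ∀ᵐ t ∂μ, p t) :
    ∀ᵐ ω ∂(incrementLaw μ), p (ω n) :=
  (measurePreserving_eval_infinitePi (fun _ : ℕ => μ) n).quasiMeasurePreserving.ae hp

theorem ae_forall_apply {p : E → Prop} (hp : ∀ᵐ t ∂μ, p t) :
    ∀ᵐ ω ∂(incrementLaw μ), ∀ n, p (ω n) :=
  ae_all_iff.2 fun n => ae_apply μ n hp

theorem lintegral_apply (n : ℕ) {f : E → ℝ≥0∞} (hf : Measurable f) :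
    ∫⁻ ω, f (ω n) ∂(incrementLaw μ) = ∫⁻ t, f t ∂μ :=
  (measurePreserving_eval_infinitePi (fun _ : ℕ => μ) n).lintegral_comp hf

theorem measurable_shift (n : ℕ) : Measurable fun (ω : ℕ → E) k => ω (n + k) := by fun_prop

theorem map_shift (n : ℕ) :
    (incrementLaw μ).map (fun ω k => ω (n + k)) = incrementLaw μ :=
  Measure.map_infinitePi_infinitePi_of_inj (P := fun _ : ℕ => μ) (f := fun k => n + k)
    (add_right_injective n)

/-- A function of the first `n` coordinates is independent of the `n`-th coordinate. -/
theorem lintegral_mul_apply (n : ℕ) {g : (ℕ → E) → ℝ≥0∞} (hg : Measurable g)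
    (hgn : ∀ ω η, g (splice n ω η) = g ω) {f : E → ℝ≥0∞} (hf : Measurable f) :
    ∫⁻ ω, g ω * f (ω n) ∂(incrementLaw μ) = (∫⁻ ω, g ω ∂(incrementLaw μ)) * ∫⁻ t, f t ∂μ := by
  have hm : Measurable fun ω : ℕ → E => g ω * f (ω n) :=
    hg.mul (hf.comp (measurable_pi_apply n))
  rw [lintegral_splice μ n hm]
  simp only [hgn]
  have h (ω η : ℕ → E) : splice n ω η n = η 0 := splice_add n ω η 0
  simp only [h]
  have h2 (ω : ℕ → E) : ∫⁻ η, g ω * f (η 0) ∂(incrementLaw μ) = g ω * ∫⁻ t, f t ∂μ := by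
    have h3 : Measurable fun η : ℕ → E => f (η 0) := hf.comp (measurable_pi_apply 0)
    rw [lintegral_const_mul _ h3, lintegral_apply μ 0 hf]
  simp only [h2]
  rw [lintegral_mul_const _ hg]

/-- The first step of the walk is independent of the rest. -/
theorem lintegral_first (f : E → (ℕ → E) → ℝ≥0∞) (hf : Measurable (Function.uncurry f)) :
    ∫⁻ ω, f (ω 0) (fun k => ω (1 + k)) ∂(incrementLaw μ) =
      ∫⁻ t, ∫⁻ η, f t η ∂(incrementLaw μ) ∂μ := by
  have hm : Measurable fun ω : ℕ → E => f (ω 0) (fun k => ω (1 + k)) :=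
    hf.comp ((measurable_pi_apply 0).prodMk (measurable_shift 1))
  rw [lintegral_splice μ 1 hm]
  have h (ω η : ℕ → E) : (fun k => splice 1 ω η (1 + k)) = η := funext fun k => splice_add 1 ω η k
  have h0 (ω η : ℕ → E) : splice 1 ω η 0 = ω 0 := splice_of_lt ω η one_pos
  simp only [h, h0]
  exact lintegral_apply μ 0 (hf.lintegral_prod_right')

/-- The filtration generated by the coordinates. -/
def coordFiltration (E : Type*) [MeasurableSpace E] :
    Filtration ℕ (MeasurableSpace.pi : MeasurableSpace (ℕ → E)) where
  seq n := MeasurableSpace.comap (fun ω (k : Fin n) => ω k) MeasurableSpace.pi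
  mono' := by
    intro n m hnm
    have : (fun (ω : ℕ → E) (k : Fin n) => ω k) =
        (fun (p : Fin m → E) (k : Fin n) => p (Fin.castLE hnm k)) ∘ fun ω (k : Fin m) => ω k := rfl
    show MeasurableSpace.comap _ _ ≤ MeasurableSpace.comap _ _
    rw [this, ← MeasurableSpace.comap_comp]
    exact MeasurableSpace.comap_mono (Measurable.comap_le (by fun_prop))
  le' n := Measurable.comap_le (by fun_prop)

theorem iSup_coordFiltration :
    ⨆ n, coordFiltration E n = (MeasurableSpace.pi : MeasurableSpace (ℕ → E)) := by
  refine le_antisymm (iSup_le fun n => (coordFiltration E).le n) ?_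
  refine iSup_le fun k => ?_
  refine le_trans ?_ (le_iSup _ (k + 1))
  have : (fun ω : ℕ → E => ω k) =
      (fun p : Fin (k + 1) → E => p ⟨k, k.lt_succ_self⟩) ∘ fun ω (j : Fin (k + 1)) => ω j := rfl
  show MeasurableSpace.comap _ _ ≤ MeasurableSpace.comap _ _
  rw [this, ← MeasurableSpace.comap_comp]
  exact MeasurableSpace.comap_mono (Measurable.comap_le (by fun_prop))

/-- Given the first `n` entries, the rest is a fresh independent sequence, so averaging over the
spliced tail is a version of the conditional probability. This makes martingale convergence
available for explicit quantities. -/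
theorem condExp_indicator_ae_eq (n : ℕ) {B : Set (ℕ → E)} (hB : MeasurableSet B) :
    (fun ω => (incrementLaw μ {η | splice n ω η ∈ B}).toReal) =ᵐ[incrementLaw μ]
      (incrementLaw μ)[B.indicator (fun _ => (1 : ℝ)) | coordFiltration E n] := by
  have hBm := measurable_measure_prodMk_left (ν := incrementLaw μ) (measurable_spliceFin n hB)
  have hGm : Measurable[coordFiltration E n]
      (fun ω : ℕ → E => incrementLaw μ {η | splice n ω η ∈ B}) := by
    have h := hBm.comp (comap_measurable (fun (ω : ℕ → E) (k : Fin n) => ω k))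
    have he : (fun ω : ℕ → E => incrementLaw μ {η | splice n ω η ∈ B}) =
        (fun p => incrementLaw μ (Prod.mk p ⁻¹' ((fun p : (Fin n → E) × (ℕ → E) =>
          spliceFin n p.1 p.2) ⁻¹' B))) ∘ fun ω (k : Fin n) => ω k := by
      funext ω
      simp only [splice_eq_spliceFin]
      rfl
    rw [he]
    exact h
  have hle := (coordFiltration E).le n
  refine ae_eq_condExp_of_forall_setIntegral_eq hle ?_ ?_ ?_ ?_
  · exact (integrable_const 1).indicator hB
  · intro s _ _
    refine Integrable.integrableOn ?_
    refine Integrable.of_bound (C := 1)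
      ((hGm.mono hle le_rfl).ennreal_toReal).aestronglyMeasurable (.of_forall fun ω => ?_)
    rw [Real.norm_of_nonneg ENNReal.toReal_nonneg]
    exact ENNReal.toReal_le_of_le_ofReal zero_le_one (by simpa using prob_le_one)
  · intro s hs _
    have hs' := hle s hs
    rw [integral_toReal ((hGm.mono hle le_rfl).aemeasurable) (.of_forall fun ω => by
      exact measure_lt_top _ _), integral_indicator_const _ hB, smul_eq_mul, mul_one,
      Measure.real, Measure.restrict_apply hB, measure_splice μ n (hB.inter hs'),
      ← lintegral_indicator hs']
    congr 1
    refine lintegral_congr fun ω => ?_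
    obtain ⟨t, -, rfl⟩ := hs
    have h (η : ℕ → E) : (fun k : Fin n => splice n ω η k) = fun k : Fin n => ω k :=
      funext fun k => splice_of_lt ω η k.2
    by_cases h1 : (fun k : Fin n => ω k) ∈ t
    · rw [indicator_of_mem (by exact h1)]
      congr 1
      ext η
      simp [h, h1]
    · rw [indicator_of_notMem (by exact h1)]
      have : {η | splice n ω η ∈ B ∩ (fun (ω : ℕ → E) (k : Fin n) => ω k) ⁻¹' t} = ∅ := by
        ext η
        simp [h, h1]
      rw [this, measure_empty]
  · exact (hGm.ennreal_toReal.stronglyMeasurable).aestronglyMeasurable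

/-- A consequence of Lévy's zero-one law: on the event `B`, the conditional probability of the
complement of `B` is not infinitely often bounded away from zero. -/
theorem ae_not_frequently_splice {B : Set (ℕ → E)} (hB : MeasurableSet B) {c : ℝ≥0∞}
    (hc : 0 < c) : ∀ᵐ ω ∂(incrementLaw μ), ω ∈ B →
      ¬ ∃ᶠ n in atTop, c ≤ incrementLaw μ {η | splice n ω η ∉ B} := by
  have hm : StronglyMeasurable[⨆ n, coordFiltration E n] (B.indicator (fun _ => (1 : ℝ))) := by
    rw [iSup_coordFiltration]
    exact stronglyMeasurable_const.indicator hB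
  -- Lévy's upward theorem: the limit is the indicator itself because the coordinates generate the
  -- σ-algebra.
  have h1 := Integrable.tendsto_ae_condExp (μ := incrementLaw μ)
    (((integrable_const (1 : ℝ)).indicator hB)) hm
  have h2 := ae_all_iff.2 fun n => condExp_indicator_ae_eq μ n hB
  filter_upwards [h1, h2] with ω h1 h2 hωB hfr
  simp only [← h2, indicator_of_mem hωB] at h1
  have h3 : Tendsto (fun n => incrementLaw μ {η | splice n ω η ∈ B}) atTop (𝓝 1) := by
    have := ENNReal.tendsto_ofReal h1
    simpa [ENNReal.ofReal_toReal (measure_ne_top _ _)] using this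
  have h4 : Tendsto (fun n => incrementLaw μ {η | splice n ω η ∉ B}) atTop (𝓝 0) := by
    have := ENNReal.Tendsto.sub (tendsto_const_nhds (x := (1 : ℝ≥0∞))) h3 (by simp)
    rw [tsub_self] at this
    refine this.congr fun n => ?_
    exact (prob_compl_eq_one_sub (measurable_splice_right n ω hB)).symm
  obtain ⟨n, hn1, hn2⟩ := (hfr.and_eventually (h4.eventually_lt_const hc)).exists
  exact absurd hn2 (not_lt.2 hn1)

/-- If `B` does not depend on finitely many coordinates, it has probability zero or one. -/
theorem measure_eq_zero_or_one_of_splice {B : Set (ℕ → E)} (hB : MeasurableSet B)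
    (h : ∀ n ω η, splice n ω η ∈ B ↔ η ∈ B) :
    incrementLaw μ B = 0 ∨ incrementLaw μ B = 1 := by
  by_cases h0 : incrementLaw μ Bᶜ = 0
  · right
    rwa [prob_compl_eq_zero_iff hB] at h0
  · left
    by_contra hne
    refine h0 (measure_eq_zero_iff_ae_notMem.2 ?_)
    -- Membership ignores the prefix, so the conditional probability of `B` is the same positive
    -- constant at every time, which is impossible almost everywhere on the complement.
    filter_upwards [ae_not_frequently_splice μ hB.compl (pos_iff_ne_zero.2 hne)] with ω hω hωB
    refine hω hωB (Frequently.of_forall fun n => ?_)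
    simp [h]

end Sequences

/-! ### Sequences of pairs and images of sequences -/

section ProductSequences

variable {E F : Type*} [MeasurableSpace E] [MeasurableSpace F] (μ : Measure E) (ν : Measure F)
  [IsProbabilityMeasure μ] [IsProbabilityMeasure ν]

/-- Checked on finite boxes, where exchanging pairs of tuples with tuples of pairs preserves product
measures. It allows Fubini between two independent blocks of coordinates. -/
theorem map_zip_incrementLaw :
    ((incrementLaw μ).prod (incrementLaw ν)).map (fun p n => (p.1 n, p.2 n)) =
      incrementLaw (μ.prod ν) := by
  refine Measure.eq_infinitePi _ fun s t ht => ?_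
  have hm : Measurable fun (p : (ℕ → E) × (ℕ → F)) n => (p.1 n, p.2 n) := by fun_prop
  rw [Measure.map_apply hm (.pi s.countable_toSet fun _ _ => ht _)]
  have h1 : (incrementLaw μ).map s.restrict = Measure.pi fun _ : s => μ :=
    Measure.infinitePi_map_restrict _
  have h2 : (incrementLaw ν).map s.restrict = Measure.pi fun _ : s => ν :=
    Measure.infinitePi_map_restrict _
  have h3 := (measurePreserving_arrowProdEquivProdArrow E F s (fun _ => μ) (fun _ => ν)).symm
  have hb : MeasurableSet ((univ : Set s).pi fun i => t i) := .univ_pi fun i => ht i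
  have h4 := h3.measure_preimage hb.nullMeasurableSet
  rw [Measure.pi_pi, ← h1, ← h2, Measure.map_prod_map _ _ (by fun_prop) (by fun_prop),
    Measure.map_apply (by fun_prop) (h3.measurable hb)] at h4
  rw [← Finset.prod_coe_sort s (fun i => (μ.prod ν) (t i)), ← h4]
  congr 1
  ext p
  simp only [mem_preimage, Set.mem_pi, Finset.mem_coe, mem_univ, true_imp_iff, Subtype.forall]
  rfl

theorem map_comp_incrementLaw {f : E → F} (hf : Measurable f) :
    (incrementLaw μ).map (fun ω n => f (ω n)) = incrementLaw (μ.map f) :=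
  Measure.infinitePi_map_pi (fun _ : ℕ => μ) (fun _ => hf)

end ProductSequences

end ReflectedWalk

namespace ReflectedWalk

/-! ### Trajectories -/

/-- One-dimensional trajectory `x_{n+1} = |x_n - ω_n|`. -/
def absPath (x : ℝ) (ω : ℕ → ℝ) : ℕ → ℝ
  | 0 => x
  | n + 1 => |absPath x ω n - ω n|

theorem absPath_nonneg {x : ℝ} (hx : 0 ≤ x) (ω : ℕ → ℝ) (n : ℕ) : 0 ≤ absPath x ω n := by
  cases n with
  | zero => exact hx
  | succ n => exact abs_nonneg _

theorem absPath_congr (x : ℝ) {ω η : ℕ → ℝ} {n : ℕ} (h : ∀ k < n, ω k = η k) :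
    absPath x ω n = absPath x η n := by
  induction n with
  | zero => rfl
  | succ n ih => simp only [absPath, ih fun k hk => h k (by omega), h n (by omega)]

theorem absPath_splice_of_le (x : ℝ) (ω η : ℕ → ℝ) {k n : ℕ} (h : k ≤ n) :
    absPath x (splice n ω η) k = absPath x ω k :=
  absPath_congr x fun j hj => splice_of_lt ω η (by omega)

theorem absPath_add (x : ℝ) (ω : ℕ → ℝ) (n m : ℕ) :
    absPath x ω (n + m) = absPath (absPath x ω n) (fun k => ω (n + k)) m := by
  induction m with
  | zero => rfl
  | succ m ih => rw [← add_assoc]; simp only [absPath, ih]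

theorem absPath_splice_add (x : ℝ) (ω η : ℕ → ℝ) (n m : ℕ) :
    absPath x (splice n ω η) (n + m) = absPath (absPath x ω n) η m := by
  rw [absPath_add, absPath_splice_of_le x ω η le_rfl]
  exact absPath_congr _ fun k _ => splice_add n ω η k

/-- Each step applies the same 1-Lipschitz map to both points. -/
theorem abs_absPath_sub_le (x x' : ℝ) (ω : ℕ → ℝ) (n : ℕ) :
    |absPath x ω n - absPath x' ω n| ≤ |x - x'| := by
  induction n with
  | zero => exact le_rfl
  | succ n ih =>
    refine (abs_abs_sub_abs_le _ _).trans ?_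
    rwa [sub_sub_sub_cancel_right]

theorem abs_absPath_sub_le_sum (x : ℝ) (ω ω' : ℕ → ℝ) (n : ℕ) :
    |absPath x ω n - absPath x ω' n| ≤ ∑ k ∈ Finset.range n, |ω k - ω' k| := by
  induction n with
  | zero => simp [absPath]
  | succ n ih =>
    rw [Finset.sum_range_succ]
    refine (abs_abs_sub_abs_le _ _).trans ?_
    have : absPath x ω n - ω n - (absPath x ω' n - ω' n) =
        (absPath x ω n - absPath x ω' n) - (ω n - ω' n) := by ring
    rw [this]
    exact (abs_sub _ _).trans (add_le_add ih le_rfl)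

theorem measurable_absPath (n : ℕ) :
    Measurable fun p : ℝ × (ℕ → ℝ) => absPath p.1 p.2 n := by
  induction n with
  | zero => exact measurable_fst
  | succ n ih => exact (ih.sub ((measurable_pi_apply n).comp measurable_snd)).abs

variable {d : ℕ}

theorem path_apply (x : Fin d → ℝ) (y : ℕ → Fin d → ℝ) (n : ℕ) (i : Fin d) :
    path x y n i = absPath (x i) (fun k => y k i) n := by
  induction n with
  | zero => rfl
  | succ n ih => simp only [path, absPath, ih]

theorem path_congr (x : Fin d → ℝ) {y z : ℕ → Fin d → ℝ} {n : ℕ} (h : ∀ k < n, y k = z k) :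
    path x y n = path x z n := by
  funext i
  rw [path_apply, path_apply]
  exact absPath_congr _ fun k hk => by rw [h k hk]

theorem path_splice_of_le (x : Fin d → ℝ) (y z : ℕ → Fin d → ℝ) {k n : ℕ} (h : k ≤ n) :
    path x (splice n y z) k = path x y k :=
  path_congr x fun j hj => splice_of_lt y z (by omega)

theorem path_add (x : Fin d → ℝ) (y : ℕ → Fin d → ℝ) (n m : ℕ) :
    path x y (n + m) = path (path x y n) (fun k => y (n + k)) m := by
  funext i
  simp only [path_apply, absPath_add]

theorem path_splice_add (x : Fin d → ℝ) (y z : ℕ → Fin d → ℝ) (n m : ℕ) :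
    path x (splice n y z) (n + m) = path (path x y n) z m := by
  rw [path_add, path_splice_of_le x y z le_rfl]
  exact path_congr _ fun k _ => splice_add n y z k

theorem dist_path_le (x x' : Fin d → ℝ) (y : ℕ → Fin d → ℝ) (n : ℕ) :
    dist (path x y n) (path x' y n) ≤ dist x x' := by
  refine (dist_pi_le_iff dist_nonneg).2 fun i => ?_
  rw [path_apply, path_apply, Real.dist_eq]
  exact (abs_absPath_sub_le _ _ _ _).trans (dist_le_pi_dist x x' i)

theorem dist_path_le_sum (x : Fin d → ℝ) (y y' : ℕ → Fin d → ℝ) (n : ℕ) :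
    dist (path x y n) (path x y' n) ≤ ∑ k ∈ Finset.range n, dist (y k) (y' k) := by
  refine (dist_pi_le_iff (Finset.sum_nonneg fun _ _ => dist_nonneg)).2 fun i => ?_
  rw [path_apply, path_apply, Real.dist_eq]
  exact (abs_absPath_sub_le_sum _ _ _ _).trans
    (Finset.sum_le_sum fun k _ => dist_le_pi_dist (y k) (y' k) i)

theorem measurable_path_uncurry (n : ℕ) :
    Measurable fun p : (Fin d → ℝ) × (ℕ → Fin d → ℝ) => path p.1 p.2 n := by
  refine measurable_pi_lambda _ fun i => ?_
  simp only [path_apply]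
  exact (measurable_absPath n).comp (f := fun p : (Fin d → ℝ) × (ℕ → Fin d → ℝ) =>
    (p.1 i, fun k => p.2 k i)) (by fun_prop)

theorem measurable_path (x : Fin d → ℝ) (n : ℕ) :
    Measurable fun y : ℕ → Fin d → ℝ => path x y n :=
  (measurable_path_uncurry n).comp measurable_prodMk_left

variable (μ : Measure (Fin d → ℝ)) [IsProbabilityMeasure μ]

/-- Finite sequences in the support of the step law are followed closely with positive
probability. -/
theorem exists_control {t : ℕ → Fin d → ℝ} (ht : ∀ k, t k ∈ μ.support) (n : ℕ) {r : ℝ}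
    (hr : 0 < r) :
    ∃ Q : Set (ℕ → Fin d → ℝ), MeasurableSet Q ∧ 0 < incrementLaw μ Q ∧
      ∀ y ∈ Q, ∀ x, dist (path x y n) (path x t n) < r := by
  -- The errors of `n` increments add up to at most `n * δ < r`; the extra `1` keeps this valid for
  -- `n = 0`.
  set δ := r / (n + 1)
  have hδ : 0 < δ := by positivity
  refine ⟨((Finset.range n : Finset ℕ) : Set ℕ).pi fun k => Metric.ball (t k) δ,
    .pi (Finset.range n).countable_toSet fun _ _ => measurableSet_ball, ?_, ?_⟩
  · unfold incrementLaw
    rw [Measure.infinitePi_pi _ fun _ _ => measurableSet_ball]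
    refine pos_iff_ne_zero.2 (Finset.prod_ne_zero_iff.2 fun k _ => ?_)
    exact ((Measure.mem_support_iff_forall _).1 (ht k) _ (Metric.ball_mem_nhds _ hδ)).ne'
  · intro y hy x
    have h1 : ∑ k ∈ Finset.range n, dist (y k) (t k) ≤ n * δ := by
      refine (Finset.sum_le_card_nsmul _ _ δ fun k hk => (hy k (by simpa using hk)).le).trans ?_
      simp
    refine ((dist_path_le_sum x y t n).trans h1).trans_lt ?_
    have : (n + 1 : ℝ) * δ = r := by simp only [δ]; field_simp
    linarith

theorem ae_forall_mem_support :
    ∀ᵐ y ∂(incrementLaw μ), ∀ k, y k ∈ μ.support :=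
  ae_forall_apply μ Measure.support_mem_ae

theorem support_nonempty : μ.support.Nonempty :=
  Measure.nonempty_support (IsProbabilityMeasure.ne_zero μ)

/-! ### The state space and its classes -/

theorem apply_mem_support {t : Fin d → ℝ} (ht : t ∈ μ.support) (i : Fin d) :
    t i ∈ (coordMarginal μ i).support := by
  rw [Measure.mem_support_iff_forall] at ht ⊢
  intro U hU
  have h1 : (fun y : Fin d → ℝ => y i) ⁻¹' U ∈ 𝓝 t := (continuous_apply i).continuousAt hU
  refine (ht _ h1).trans_le ?_
  exact Measure.le_map_apply (f := fun y : Fin d → ℝ => y i) (measurable_pi_apply i).aemeasurable U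

theorem exists_mem_support_apply_near {i : Fin d} {s : ℝ}
    (hs : s ∈ (coordMarginal μ i).support) {r : ℝ} (hr : 0 < r) :
    ∃ t ∈ μ.support, |t i - s| < r := by
  have h1 := (Measure.mem_support_iff_forall _).1 hs _ (Metric.ball_mem_nhds s hr)
  unfold coordMarginal at h1
  rw [Measure.map_apply (by fun_prop) measurableSet_ball] at h1
  obtain ⟨t, ht, ht'⟩ := Measure.nonempty_inter_support_of_pos h1
  exact ⟨t, ht', by simpa [Real.dist_eq] using ht⟩

variable {μ}
variable (hlat : ∀ i, IsLattice (coordMarginal μ i) → IsNormalizedLattice (coordMarginal μ i))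
include hlat

theorem exists_int_of_mem_support {t : Fin d → ℝ} (ht : t ∈ μ.support) {i : Fin d}
    (hi : IsLattice (coordMarginal μ i)) : ∃ k : ℤ, t i = k :=
  (hlat i hi).1 _ (apply_mem_support μ ht i)

theorem step_mem_stateSpace {x t : Fin d → ℝ} (hx : x ∈ stateSpace μ) (ht : t ∈ μ.support) :
    (fun i => |x i - t i|) ∈ stateSpace μ := by
  intro i
  refine ⟨abs_nonneg _, fun hi => ?_⟩
  obtain ⟨k, hk⟩ := (hx i).2 hi
  obtain ⟨m, hm⟩ := exists_int_of_mem_support hlat ht hi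
  refine ⟨(k - m : ℤ).natAbs, ?_⟩
  show |x i - t i| = _
  rw [Nat.cast_natAbs, hk, hm]
  push_cast
  rfl

/-- Signs are invisible modulo two, so the reflected step acts on parities as a translation. -/
theorem parity_step {x t : Fin d → ℝ} (hx : x ∈ stateSpace μ) (ht : t ∈ μ.support) :
    parity μ (fun i => |x i - t i|) = parity μ x + parity μ t := by
  funext i
  simp only [parity, Pi.add_apply]
  split_ifs with hi
  · obtain ⟨k, hk⟩ := (hx i).2 hi
    obtain ⟨m, hm⟩ := exists_int_of_mem_support hlat ht hi
    have h1 : |(k : ℝ) - m| = ((|(k : ℤ) - m| : ℤ) : ℝ) := by push_cast; rfl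
    rw [hk, hm, h1, Int.floor_intCast, Int.floor_natCast, Int.floor_intCast]
    rcases abs_choice ((k : ℤ) - m) with h | h <;> rw [h] <;> push_cast
    · rw [sub_eq_add_neg, ZMod.neg_eq_self_mod_two]
    · rw [ZMod.neg_eq_self_mod_two, sub_eq_add_neg, ZMod.neg_eq_self_mod_two]
  · simp

theorem path_mem_stateSpace {x : Fin d → ℝ} (hx : x ∈ stateSpace μ) {t : ℕ → Fin d → ℝ}
    (ht : ∀ k, t k ∈ μ.support) (n : ℕ) : path x t n ∈ stateSpace μ := by
  induction n with
  | zero => exact hx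
  | succ n ih => exact step_mem_stateSpace hlat ih (ht n)

theorem parity_path {x : Fin d → ℝ} (hx : x ∈ stateSpace μ) {t : ℕ → Fin d → ℝ}
    (ht : ∀ k, t k ∈ μ.support) (n : ℕ) :
    parity μ (path x t n) = parity μ x + ∑ k ∈ Finset.range n, parity μ (t k) := by
  induction n with
  | zero => simp [path]
  | succ n ih =>
    have h := parity_step hlat (path_mem_stateSpace hlat hx ht n) (ht n)
    rw [Finset.sum_range_succ, ← add_assoc, ← ih, ← h]
    rfl

-- Integers at distance less than one coincide. This is why radii below are often cut off at `1`.
omit hlat in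
theorem parity_eq_of_dist_lt_one {x y : Fin d → ℝ} (h : dist x y < 1)
    (hx : ∀ i, IsLattice (coordMarginal μ i) → ∃ k : ℤ, x i = k)
    (hy : ∀ i, IsLattice (coordMarginal μ i) → ∃ k : ℤ, y i = k) :
    parity μ x = parity μ y := by
  funext i
  simp only [parity]
  split_ifs with hi
  · obtain ⟨k, hk⟩ := hx i hi
    obtain ⟨m, hm⟩ := hy i hi
    have h1 := (dist_le_pi_dist x y i).trans_lt h
    rw [hk, hm, Int.dist_cast_real, Int.dist_eq] at h1
    have h2 : |k - m| < 1 := by exact_mod_cast h1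
    rw [hk, hm, Int.floor_intCast, Int.floor_intCast, sub_eq_zero.1 (Int.abs_lt_one_iff.1 h2)]
  · rfl

omit hlat in
theorem exists_int_of_mem_stateSpace {x : Fin d → ℝ} (hx : x ∈ stateSpace μ) (i : Fin d)
    (hi : IsLattice (coordMarginal μ i)) : ∃ k : ℤ, x i = k := by
  obtain ⟨k, hk⟩ := (hx i).2 hi
  exact ⟨k, by simpa using hk⟩

omit hlat in
theorem parity_eq_of_mem_stateSpace {x y : Fin d → ℝ} (hx : x ∈ stateSpace μ)
    (hy : y ∈ stateSpace μ) (h : dist x y < 1) : parity μ x = parity μ y :=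
  parity_eq_of_dist_lt_one h (exists_int_of_mem_stateSpace hx) (exists_int_of_mem_stateSpace hy)

/-- The set of parities of the steps is the set of parities of the points of the support. -/
theorem measure_parity_pos_iff {ε : Fin d → ZMod 2} :
    0 < μ {y | parity μ y = ε} ↔ ∃ t ∈ μ.support, parity μ t = ε := by
  constructor
  · intro h
    obtain ⟨t, ht, ht'⟩ := Measure.nonempty_inter_support_of_pos h
    exact ⟨t, ht', ht⟩
  · rintro ⟨t, ht, rfl⟩
    have h1 := (Measure.mem_support_iff_forall _).1 ht _ (Metric.ball_mem_nhds t one_pos)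
    refine h1.trans_le (measure_mono_ae ?_)
    filter_upwards [Measure.support_mem_ae (μ := μ)] with y hy hyt
    exact parity_eq_of_dist_lt_one hyt (fun i hi => exists_int_of_mem_support hlat hy hi)
      (fun i hi => exists_int_of_mem_support hlat ht hi)

omit hlat in
variable (μ) in
/-- The parities of sums of `n` steps. -/
def parityAfter (n : ℕ) : Set (Fin d → ZMod 2) :=
  {g | ∃ t : ℕ → Fin d → ℝ, (∀ k, t k ∈ μ.support) ∧ g = ∑ k ∈ Finset.range n, parity μ (t k)}

omit hlat

theorem splice_mem_support {t t' : ℕ → Fin d → ℝ} (ht : ∀ k, t k ∈ μ.support)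
    (ht' : ∀ k, t' k ∈ μ.support) (n k : ℕ) : splice n t t' k ∈ μ.support := by
  unfold splice
  split_ifs
  · exact ht k
  · exact ht' _

theorem zero_mem_parityAfter_zero : (0 : Fin d → ZMod 2) ∈ parityAfter μ 0 := by
  obtain ⟨t, ht⟩ := support_nonempty μ
  exact ⟨fun _ => t, fun _ => ht, by simp⟩

theorem add_mem_parityAfter {n m : ℕ} {g h : Fin d → ZMod 2} (hg : g ∈ parityAfter μ n)
    (hh : h ∈ parityAfter μ m) : g + h ∈ parityAfter μ (n + m) := by
  obtain ⟨t, ht, rfl⟩ := hg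
  obtain ⟨t', ht', rfl⟩ := hh
  refine ⟨splice n t t', splice_mem_support ht ht' n, ?_⟩
  rw [Finset.sum_range_add]
  congr 1
  · exact Finset.sum_congr rfl fun k hk => by rw [splice_of_lt _ _ (Finset.mem_range.1 hk)]
  · exact Finset.sum_congr rfl fun k _ => by rw [splice_add]

theorem add_self_parity (g : Fin d → ZMod 2) : g + g = 0 :=
  funext fun i => CharTwo.add_self_eq_zero (g i)

theorem neg_parity (g : Fin d → ZMod 2) : -g = g :=
  funext fun i => ZMod.neg_eq_self_mod_two (g i)

theorem zero_mem_parityAfter_two : (0 : Fin d → ZMod 2) ∈ parityAfter μ 2 := by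
  obtain ⟨t, ht⟩ := support_nonempty μ
  exact ⟨fun _ => t, fun _ => ht,
    by simp [Finset.sum_range_succ, -Finset.sum_const, add_self_parity]⟩

theorem parityAfter_subset_add_two_mul (n k : ℕ) : parityAfter μ n ⊆ parityAfter μ (n + 2 * k) := by
  induction k with
  | zero => exact Subset.rfl
  | succ k ih =>
    intro g hg
    have := add_mem_parityAfter (ih hg) (zero_mem_parityAfter_two (μ := μ))
    rwa [add_zero] at this

/-- Repeating a step twice does not change the parities, so apart from being large enough, only the
time modulo two matters. -/
theorem parityAfter_mono {n m : ℕ} (h : n ≤ m) (h2 : n % 2 = m % 2) :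
    parityAfter μ n ⊆ parityAfter μ m := by
  obtain ⟨k, rfl⟩ : ∃ k, m = n + 2 * k := ⟨(m - n) / 2, by omega⟩
  exact parityAfter_subset_add_two_mul n k

include hlat

/-- Every parity vector is its own inverse, so sums of generators already exhaust the group. -/
theorem mem_parityGroup_iff {g : Fin d → ZMod 2} :
    g ∈ parityGroup μ ↔ ∃ n, g ∈ parityAfter μ n := by
  constructor
  · intro hg
    refine AddSubgroup.closure_induction (p := fun g _ => ∃ n, g ∈ parityAfter μ n) ?_ ?_ ?_ ?_ hg
    · intro ε hε
      obtain ⟨t, ht, rfl⟩ := (measure_parity_pos_iff hlat).1 hε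
      exact ⟨1, fun _ => t, fun _ => ht, by simp⟩
    · exact ⟨0, zero_mem_parityAfter_zero⟩
    · rintro x y _ _ ⟨n, hn⟩ ⟨m, hm⟩
      exact ⟨n + m, add_mem_parityAfter hn hm⟩
    · rintro x _ ⟨n, hn⟩
      exact ⟨n, by rwa [neg_parity]⟩
  · rintro ⟨n, t, ht, rfl⟩
    exact AddSubgroup.sum_mem _ fun k _ => AddSubgroup.subset_closure
      ((measure_parity_pos_iff hlat).2 ⟨t k, ht k, rfl⟩)

theorem parity_path_sub_mem {x : Fin d → ℝ} (hx : x ∈ stateSpace μ) {t : ℕ → Fin d → ℝ}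
    (ht : ∀ k, t k ∈ μ.support) (n : ℕ) :
    parity μ (path x t n) - parity μ x ∈ parityAfter μ n := by
  rw [parity_path hlat hx ht, add_sub_cancel_left]
  exact ⟨t, ht, rfl⟩

theorem path_mem_parityClass {x₀ x : Fin d → ℝ} (hx : x ∈ parityClass μ x₀)
    {t : ℕ → Fin d → ℝ} (ht : ∀ k, t k ∈ μ.support) (n : ℕ) :
    path x t n ∈ parityClass μ x₀ := by
  refine ⟨path_mem_stateSpace hlat hx.1 ht n, ?_⟩
  have h1 := parity_path_sub_mem hlat hx.1 ht n
  have h2 := add_mem ((mem_parityGroup_iff hlat).2 ⟨n, h1⟩) hx.2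
  rwa [sub_add_sub_cancel] at h2

end ReflectedWalk

namespace ReflectedWalk

/-! ### Accessibility of the origin -/

/-- Points that can be reached from `u` by reflected steps from `S`. -/
inductive Reach (S : Set ℝ) (u : ℝ) : ℝ → Prop
  | refl : Reach S u u
  | step {v s : ℝ} : Reach S u v → s ∈ S → Reach S u |v - s|

section Reach

variable {S : Set ℝ} {u : ℝ}

theorem Reach.exists_absPath {v s : ℝ} (hs : s ∈ S) (h : Reach S u v) :
    ∃ (t : ℕ → ℝ) (n : ℕ), (∀ k, t k ∈ S) ∧ absPath u t n = v := by
  induction h with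
  | refl => exact ⟨fun _ => s, 0, fun _ => hs, rfl⟩
  | @step v r _ hr ih =>
    obtain ⟨t, n, ht, rfl⟩ := ih
    refine ⟨splice n t fun _ => r, n + 1, fun k => ?_, ?_⟩
    · unfold splice
      split_ifs
      exacts [ht k, hr]
    · rw [absPath_splice_add]
      rfl

theorem Reach.sub_mul {v s : ℝ} (hs : s ∈ S) (hs0 : 0 ≤ s) (h : Reach S u v) (k : ℕ)
    (hk : k * s ≤ v) : Reach S u (v - k * s) := by
  induction k with
  | zero => simpa using h
  | succ k ih =>
    push_cast at hk ⊢
    have h1 := (ih (by linarith)).step hs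
    rwa [abs_of_nonneg (by linarith), show v - k * s - s = v - (k + 1) * s by ring] at h1

/-- Points that represent, up to sign and modulo `s`, a point that can be reached. -/
def ReachMod (S : Set ℝ) (u s v : ℝ) : Prop := ∃ k : ℤ, Reach S u |v + k * s|

theorem ReachMod.neg {s v : ℝ} (h : ReachMod S u s v) : ReachMod S u s (-v) := by
  obtain ⟨k, hk⟩ := h
  refine ⟨-k, ?_⟩
  rwa [show -v + ((-k : ℤ) : ℝ) * s = -(v + k * s) by push_cast; ring, abs_neg]

/-- If the representative `v + k * s` is non-positive, the step `t` from its absolute value adds `t`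
up to sign. Otherwise steps `s` are taken until the origin has just been crossed; the reflection
flips the sign, and then `t` is applied. -/
theorem ReachMod.add {s v t : ℝ} (hs : s ∈ S) (hs0 : 0 < s) (ht : t ∈ S)
    (h : ReachMod S u s v) : ReachMod S u s (v + t) := by
  obtain ⟨k, hk⟩ := h
  rcases le_total (v + k * s) 0 with h0 | h0
  · refine ⟨k, ?_⟩
    have h1 := hk.step ht
    rwa [abs_of_nonpos h0, show -(v + k * s) - t = -(v + t + k * s) by ring, abs_neg] at h1
  · rw [abs_of_nonneg h0] at hk
    set r := v + k * s
    set j := ⌊r / s⌋₊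
    have hj1 : j * s ≤ r := (le_div_iff₀ hs0).1 (Nat.floor_le (by positivity))
    have hj2 : r < (j + 1) * s := (div_lt_iff₀ hs0).1 (Nat.lt_floor_add_one _)
    have h1 := ((hk.sub_mul hs hs0.le j hj1).step hs).step ht
    rw [abs_of_neg (by linarith : r - j * s - s < 0)] at h1
    refine ⟨k - j - 1, ?_⟩
    rwa [show -(r - j * s - s) - t = -(v + t + ((k - j - 1 : ℤ) : ℝ) * s) by
      simp only [r]; push_cast; ring, abs_neg] at h1

/-- Negatives of group elements come from the symmetry `ReachMod.neg`, although only steps from `S`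
are available. -/
theorem ReachMod.add_closure {s v g : ℝ} (hs : s ∈ S) (hs0 : 0 < s)
    (hg : g ∈ AddSubgroup.closure S) (h : ReachMod S u s v) : ReachMod S u s (v + g) := by
  suffices H : ∀ v, ReachMod S u s v → ReachMod S u s (v + g) from H v h
  refine AddSubgroup.closure_induction
    (p := fun g _ => ∀ v, ReachMod S u s v → ReachMod S u s (v + g)) ?_ ?_ ?_ ?_ hg
  · intro t ht v hv
    exact hv.add hs hs0 ht
  · intro v hv
    simpa using hv
  · intro x y _ _ hx hy v hv
    rw [← add_assoc]
    exact hy _ (hx _ hv)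
  · intro x _ hx v hv
    have := (hx _ hv.neg).neg
    rwa [neg_add, neg_neg] at this

/-- With the sign chosen so that the representative `w + k * s` is non-negative, steps `s` lead down
to `w` if `w ≥ 0`, and otherwise to `w + s`, from which one more step is reflected to `|w|`. -/
theorem ReachMod.reach_abs {s v : ℝ} (hs : s ∈ S) (hv : |v| < s) (h : ReachMod S u s v) :
    Reach S u |v| := by
  have hs0 : 0 < s := (abs_nonneg v).trans_lt hv
  obtain ⟨w, hw, k, hk, hk0⟩ : ∃ w, |w| = |v| ∧ ∃ k : ℤ, Reach S u |w + k * s| ∧ 0 ≤ w + k * s := by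
    obtain ⟨k, hk⟩ := h
    rcases le_total 0 (v + k * s) with h0 | h0
    · exact ⟨v, rfl, k, hk, h0⟩
    · have h1 : -v + ((-k : ℤ) : ℝ) * s = -(v + k * s) := by push_cast; ring
      exact ⟨-v, abs_neg v, -k, by rwa [h1, abs_neg], by rw [h1]; linarith⟩
  rw [← hw] at hv ⊢
  rw [abs_of_nonneg hk0] at hk
  have hws := abs_lt.1 hv
  have hk1 : 0 ≤ k := by
    by_contra hlt
    have h1 : (k : ℝ) ≤ -1 := by exact_mod_cast (by omega : k ≤ -1)
    nlinarith
  obtain ⟨m, rfl⟩ := Int.eq_ofNat_of_zero_le hk1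
  simp only [Int.cast_natCast] at hk hk0
  rcases le_or_gt 0 w with hw0 | hw0
  · have h1 := hk.sub_mul hs hs0.le m (by linarith)
    rwa [add_sub_cancel_right, ← abs_of_nonneg hw0] at h1
  · obtain ⟨j, rfl⟩ : ∃ j, m = j + 1 := by
      refine ⟨m - 1, ?_⟩
      have : m ≠ 0 := by
        rintro rfl
        simp at hk0
        linarith
      omega
    push_cast at hk
    have h1 := (hk.sub_mul hs hs0.le j (by linarith)).step hs
    rwa [show w + (j + 1) * s - j * s - s = w by ring] at h1

/-- Some `g` of the generated group is close to `u`, and adding `-g` leads, modulo `s` and up to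
sign, to the small number `u - g`. -/
theorem exists_reach_near_zero {s : ℝ} (hs : s ∈ S) (hs0 : 0 < s) (hu : 0 ≤ u)
    (hG : u ∈ (AddSubgroup.closure S).topologicalClosure) {r : ℝ} (hr : 0 < r) :
    ∃ v, Reach S u v ∧ 0 ≤ v ∧ v < r := by
  obtain ⟨g, hg, hgu⟩ := Metric.mem_closure_iff.1 hG (min r s) (lt_min hr hs0)
  have h0 : ReachMod S u s u := ⟨0, by simpa [abs_of_nonneg hu] using Reach.refl⟩
  have h1 := h0.add_closure hs hs0 (neg_mem hg)
  rw [← sub_eq_add_neg] at h1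
  rw [Real.dist_eq] at hgu
  exact ⟨_, h1.reach_abs hs (hgu.trans_le (min_le_right _ _)), abs_nonneg _,
    hgu.trans_le (min_le_left _ _)⟩

end Reach

/-! ### Contraction of pairs -/

/-- Evolution of the midpoint and half of the distance of a pair of reflected trajectories. -/
def pairPath (p : ℝ × ℝ) (t : ℕ → ℝ) : ℕ → ℝ × ℝ
  | 0 => p
  | n + 1 => (max |(pairPath p t n).1 - t n| (pairPath p t n).2,
      min |(pairPath p t n).1 - t n| (pairPath p t n).2)

/-- If `a` and `b` lie on the same side of the origin, reflection keeps their half distance; if the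
origin separates them, the modulus of the midpoint and the half distance exchange roles. -/
theorem max_min_abs_add_sub (a b : ℝ) :
    max (|a + b| / 2) (|a - b| / 2) = (|a| + |b|) / 2 ∧
      min (|a + b| / 2) (|a - b| / 2) = |(|a| - |b|)| / 2 := by
  rcases le_total 0 (a * b) with h | h
  · have h1 : |a + b| = |a| + |b| := abs_add_eq_add_abs_iff _ _ |>.2 (mul_nonneg_iff.1 h)
    have h2 : |a - b| = |(|a| - |b|)| := by
      rcases mul_nonneg_iff.1 h with ⟨ha, hb⟩ | ⟨ha, hb⟩
      · rw [abs_of_nonneg ha, abs_of_nonneg hb]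
      · rw [abs_of_nonpos ha, abs_of_nonpos hb, ← abs_neg]; ring_nf
    have h3 : |a - b| ≤ |a + b| := h1 ▸ abs_sub a b
    rw [max_eq_left (by linarith), min_eq_right (by linarith), h1, h2]
    exact ⟨rfl, rfl⟩
  · have h1 : |a - b| = |a| + |b| := by
      rw [sub_eq_add_neg, ← abs_neg b]
      refine (abs_add_eq_add_abs_iff _ _).2 (mul_nonneg_iff.1 ?_)
      linarith [mul_neg a b]
    have h2 : |a + b| = |(|a| - |b|)| := by
      rcases mul_nonpos_iff.1 h with ⟨ha, hb⟩ | ⟨ha, hb⟩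
      · rw [abs_of_nonneg ha, abs_of_nonpos hb]; ring_nf
      · rw [abs_of_nonpos ha, abs_of_nonneg hb, ← abs_neg]; ring_nf
    have h3 : |a + b| ≤ |a - b| := h1 ▸ abs_add_le a b
    rw [max_eq_right (by linarith), min_eq_left (by linarith), h1, h2]
    exact ⟨rfl, rfl⟩

theorem pairPath_eq {x y : ℝ} (t : ℕ → ℝ) (n : ℕ) :
    pairPath ((x + y) / 2, |x - y| / 2) t n =
      ((absPath x t n + absPath y t n) / 2, |absPath x t n - absPath y t n| / 2) := by
  induction n with
  | zero => rfl
  | succ n ih =>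
    simp only [pairPath, ih, absPath]
    have h := max_min_abs_add_sub (absPath x t n - t n) (absPath y t n - t n)
    have h1 : |(absPath x t n + absPath y t n) / 2 - t n| =
        |absPath x t n - t n + (absPath y t n - t n)| / 2 := by
      rw [← abs_two, ← abs_div, abs_two]
      ring_nf
    rw [h1, ← h.1, ← h.2, sub_sub_sub_cancel_right]

theorem pairPath_splice_add (p : ℝ × ℝ) (t t' : ℕ → ℝ) (n m : ℕ) :
    pairPath p (splice n t t') (n + m) = pairPath (pairPath p t n) t' m := by
  have h1 : ∀ k ≤ n, pairPath p (splice n t t') k = pairPath p t k := by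
    intro k hk
    induction k with
    | zero => rfl
    | succ k ih => simp only [pairPath, ih (by omega), splice_of_lt t t' (by omega : k < n)]
  induction m with
  | zero => exact h1 n le_rfl
  | succ m ih => rw [← add_assoc]; simp only [pairPath, ih, splice_add]

theorem continuous_pairPath (t : ℕ → ℝ) (n : ℕ) : Continuous fun p => pairPath p t n := by
  induction n with
  | zero => exact continuous_id
  | succ n ih => simp only [pairPath]; fun_prop

theorem antitone_pairPath_snd (p : ℝ × ℝ) (t : ℕ → ℝ) : Antitone fun n => (pairPath p t n).2 :=
  antitone_nat_of_succ_le fun _ => min_le_right _ _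

theorem pairPath_snd_le (p : ℝ × ℝ) (t : ℕ → ℝ) (n : ℕ) : (pairPath p t n).2 ≤ p.2 :=
  antitone_pairPath_snd p t (Nat.zero_le n)

theorem pairPath_snd_le_fst {p : ℝ × ℝ} (hp : p.2 ≤ p.1) (t : ℕ → ℝ) (n : ℕ) :
    (pairPath p t n).2 ≤ (pairPath p t n).1 := by
  cases n with
  | zero => exact hp
  | succ n => exact min_le_max

theorem pairPath_snd_nonneg {p : ℝ × ℝ} (hp : 0 ≤ p.2) (t : ℕ → ℝ) (n : ℕ) :
    0 ≤ (pairPath p t n).2 := by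
  induction n with
  | zero => exact hp
  | succ n ih => exact le_min (abs_nonneg _) ih

theorem pairPath_mem {S : Set ℝ} {G : AddSubgroup ℝ} (hS : S ⊆ G) {p : ℝ × ℝ} (h1 : p.1 ∈ G)
    (h2 : p.2 ∈ G) {t : ℕ → ℝ} (ht : ∀ k, t k ∈ S) (n : ℕ) :
    (pairPath p t n).1 ∈ G ∧ (pairPath p t n).2 ∈ G := by
  induction n with
  | zero => exact ⟨h1, h2⟩
  | succ n ih =>
    have h3 : |(pairPath p t n).1 - t n| ∈ G := by
      have h4 := sub_mem ih.1 (hS (ht n))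
      rcases abs_choice ((pairPath p t n).1 - t n) with h | h <;> rw [h]
      exacts [h4, neg_mem h4]
    simp only [pairPath]
    rcases le_total |(pairPath p t n).1 - t n| (pairPath p t n).2 with h | h
    · rw [max_eq_right h, min_eq_left h]
      exact ⟨ih.2, h3⟩
    · rw [max_eq_left h, min_eq_right h]
      exact ⟨h3, ih.2⟩

/-- While the first component exceeds `M ≥ s + p.2`, a step `s` just lowers it by `s`; the second
component never grows, so the bound on `M` persists. -/
theorem exists_pairPath_le {S : Set ℝ} {s : ℝ} (hs : s ∈ S) (hs0 : 0 < s) (p : ℝ × ℝ)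
    (hp0 : 0 ≤ p.2) {M : ℝ} (hM : s + p.2 ≤ M) :
    ∃ (t : ℕ → ℝ) (n : ℕ), (∀ k, t k ∈ S) ∧ (pairPath p t n).1 ≤ M := by
  obtain ⟨N, hN⟩ : ∃ N : ℕ, p.1 ≤ M + N * s := by
    obtain ⟨N, hN⟩ := exists_nat_ge ((p.1 - M) / s)
    exact ⟨N, by have := (div_le_iff₀ hs0).1 hN; linarith⟩
  induction N generalizing p with
  | zero => exact ⟨fun _ => s, 0, fun _ => hs, by simpa [pairPath] using hN⟩
  | succ N ih =>
    by_cases hp : p.1 ≤ M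
    · exact ⟨fun _ => s, 0, fun _ => hs, hp⟩
    · push Not at hp
      push_cast at hN
      have hNs : 0 ≤ N * s := by positivity
      have h3 : (pairPath p (fun _ => s) 1).1 ≤ M + N * s := by
        simp only [pairPath]
        rw [abs_of_nonneg (by linarith)]
        exact max_le (by linarith) (by linarith)
      obtain ⟨t, n, ht, hn⟩ := ih (pairPath p (fun _ => s) 1) (pairPath_snd_nonneg hp0 _ _)
        (by linarith [pairPath_snd_le p (fun _ => s) 1]) h3
      refine ⟨splice 1 (fun _ => s) t, 1 + n, fun k => ?_, ?_⟩
      · unfold splice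
        split_ifs
        exacts [hs, ht _]
      · rwa [pairPath_splice_add]

theorem splice_mem {S : Set ℝ} {t t' : ℕ → ℝ} (ht : ∀ k, t k ∈ S) (ht' : ∀ k, t' k ∈ S)
    (n k : ℕ) : splice n t t' k ∈ S := by
  unfold splice
  split_ifs
  exacts [ht k, ht' _]

/-- A compactness argument. The half distance never grows, and reachable pairs can be moved into a
bounded set, so it has a minimiser `z` on the closure of that set. If `z.2 ≥ r`, increments which
bring the point `z.1` below `z.2` must strictly lower the half distance. By continuity they do so
for reachable pairs near `z` too, below the minimum. -/
theorem exists_pairPath_snd_lt {S : Set ℝ} {s : ℝ} (hs : s ∈ S) (hs0 : 0 < s) {p : ℝ × ℝ}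
    (hp0 : 0 ≤ p.2) (hp : p.2 ≤ p.1) (h1 : p.1 ∈ (AddSubgroup.closure S).topologicalClosure)
    (h2 : p.2 ∈ (AddSubgroup.closure S).topologicalClosure) {r : ℝ} (hr : 0 < r) :
    ∃ (t : ℕ → ℝ) (n : ℕ), (∀ k, t k ∈ S) ∧ (pairPath p t n).2 < r := by
  set G := (AddSubgroup.closure S).topologicalClosure with hGdef
  have hSG : S ⊆ G := AddSubgroup.subset_closure.trans
    (AddSubgroup.le_topologicalClosure (AddSubgroup.closure S))
  have hGc : IsClosed (G : Set ℝ) := AddSubgroup.isClosed_topologicalClosure _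
  set M := s + p.2
  set R : Set (ℝ × ℝ) := {z | z.1 ≤ M ∧ ∃ (t : ℕ → ℝ) (n : ℕ), (∀ k, t k ∈ S) ∧
    pairPath p t n = z}
  -- every reachable pair can be moved into `R`
  have hred : ∀ (t : ℕ → ℝ) (n : ℕ), (∀ k, t k ∈ S) →
      ∃ z ∈ R, z.2 ≤ (pairPath p t n).2 := by
    intro t n ht
    obtain ⟨t', n', ht', hn'⟩ := exists_pairPath_le hs hs0 (pairPath p t n)
      (pairPath_snd_nonneg hp0 t n) (M := M)
      (by have := pairPath_snd_le p t n; simp only [M]; linarith)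
    refine ⟨_, ⟨hn', splice n t t', n + n', splice_mem ht ht' n, pairPath_splice_add _ _ _ _ _⟩,
      pairPath_snd_le _ _ _⟩
  have hRK : R ⊆ {z | 0 ≤ z.2 ∧ z.2 ≤ z.1 ∧ z.1 ≤ M ∧ z.1 ∈ G ∧ z.2 ∈ G} := by
    rintro z ⟨hzM, t, n, ht, rfl⟩
    have := pairPath_mem hSG h1 h2 ht n
    exact ⟨pairPath_snd_nonneg hp0 t n, pairPath_snd_le_fst hp t n, hzM, this.1, this.2⟩
  have hKc : IsClosed {z : ℝ × ℝ | 0 ≤ z.2 ∧ z.2 ≤ z.1 ∧ z.1 ≤ M ∧ z.1 ∈ G ∧ z.2 ∈ G} := by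
    refine (isClosed_le continuous_const continuous_snd).inter
      ((isClosed_le continuous_snd continuous_fst).inter
      ((isClosed_le continuous_fst continuous_const).inter
      ((hGc.preimage continuous_fst).inter (hGc.preimage continuous_snd))))
  have hclK := closure_minimal hRK hKc
  have hcomp : IsCompact (closure R) := by
    refine (isCompact_Icc (a := (0 : ℝ × ℝ)) (b := (M, M))).of_isClosed_subset isClosed_closure ?_
    intro z hz
    have := hclK hz
    exact ⟨⟨this.1.trans this.2.1, this.1⟩, ⟨this.2.2.1, this.2.1.trans this.2.2.1⟩⟩
  obtain ⟨z₀, hz₀, -⟩ := hred (fun _ => s) 0 (fun _ => hs)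
  obtain ⟨z, hz, hmin⟩ := hcomp.exists_isMinOn ⟨z₀, subset_closure hz₀⟩ continuous_snd.continuousOn
  -- from `z`, the second component can be made strictly smaller
  rcases lt_or_ge z.2 r with hzr | hzr
  · obtain ⟨w, hw, hwR⟩ := mem_closure_iff.1 hz _ (isOpen_lt continuous_snd continuous_const) hzr
    obtain ⟨-, t, n, ht, rfl⟩ := hwR
    exact ⟨t, n, ht, hw⟩
  · exfalso
    obtain ⟨hz0, hz1, -, hzG, -⟩ := hclK hz
    have hzpos : 0 < z.2 := hr.trans_le hzr
    obtain ⟨v, hv, -, hvz⟩ := exists_reach_near_zero hs hs0 (hz0.trans hz1) hzG hzpos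
    obtain ⟨t, n, ht, rfl⟩ := hv.exists_absPath hs
    have hdrop : (pairPath z t n).2 < z.2 := by
      by_contra hnot
      -- Without a drop the midpoint moves like a single reflected trajectory and ends below the
      -- half distance, against `pairPath_snd_le_fst`.
      have h3 : ∀ k ≤ n, pairPath z t k = (absPath z.1 t k, z.2) := by
        intro k hk
        induction k with
        | zero => rfl
        | succ k ih =>
          have h4 := ih (by omega)
          have h5 : z.2 ≤ (pairPath z t (k + 1)).2 := by
            have h6 : (pairPath z t n).2 ≤ (pairPath z t (k + 1)).2 := antitone_pairPath_snd z t hk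
            linarith
          simp only [pairPath, h4] at h5 ⊢
          have h7 : z.2 ≤ |absPath z.1 t k - t k| := (le_min_iff.1 h5).1
          rw [max_eq_left h7, min_eq_right h7]
          rfl
      have h4 := pairPath_snd_le_fst hz1 t n
      rw [h3 n le_rfl] at h4
      exact absurd hvz (not_lt.2 h4)
    have hopen : IsOpen {w | (pairPath w t n).2 < z.2} :=
      isOpen_lt (continuous_snd.comp (continuous_pairPath t n)) continuous_const
    obtain ⟨w, hw, hwR⟩ := mem_closure_iff.1 hz _ hopen hdrop
    obtain ⟨-, t', n', ht', rfl⟩ := hwR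
    obtain ⟨y, hyR, hy⟩ := hred (splice n' t' t) (n' + n) (splice_mem ht' ht n')
    rw [pairPath_splice_add] at hy
    have := hmin (subset_closure hyR)
    simp only [mem_ofPred_eq] at this hw
    linarith

/-- For a normalised lattice law, the two membership conditions on integers express that `x` and `y`
have the same parity. -/
theorem exists_absPath_sub_lt {S : Set ℝ} {s : ℝ} (hs : s ∈ S) (hs0 : 0 < s) {x y : ℝ}
    (hx : 0 ≤ x) (hy : 0 ≤ y) (h1 : (x + y) / 2 ∈ (AddSubgroup.closure S).topologicalClosure)
    (h2 : (x - y) / 2 ∈ (AddSubgroup.closure S).topologicalClosure) {r : ℝ} (hr : 0 < r) :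
    ∃ (t : ℕ → ℝ) (n : ℕ), (∀ k, t k ∈ S) ∧ |absPath x t n - absPath y t n| < r := by
  have h3 : |x - y| / 2 ∈ (AddSubgroup.closure S).topologicalClosure := by
    rcases abs_choice (x - y) with h | h <;> rw [h]
    · exact h2
    · rw [neg_div]
      exact neg_mem h2
  have h4 : |x - y| ≤ x + y := abs_sub_le_iff.2 ⟨by linarith, by linarith⟩
  obtain ⟨t, n, ht, hn⟩ := exists_pairPath_snd_lt hs hs0 (p := ((x + y) / 2, |x - y| / 2))
    (by positivity) (by simp only; linarith) h1 h3 (half_pos hr)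
  rw [pairPath_eq] at hn
  exact ⟨t, n, ht, by simp only at hn; linarith⟩

/-! ### The closed group generated by the support of a law -/

section Group

variable {ν : Measure ℝ}

/-- A subgroup of `ℝ` is dense or cyclic, and a non-zero generator would make `ν` lattice. -/
theorem mem_topologicalClosure_of_not_isLattice (hν : ¬ IsLattice ν) {s : ℝ} (hs : s ∈ ν.support)
    (hs0 : 0 < s) (u : ℝ) : u ∈ (AddSubgroup.closure ν.support).topologicalClosure := by
  rcases AddSubgroup.dense_or_cyclic (AddSubgroup.closure ν.support) with h | ⟨a, ha⟩
  · exact h u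
  · exfalso
    have h1 : ∀ y ∈ ν.support, ∃ k : ℤ, k • a = y := fun y hy =>
      AddSubgroup.mem_closure_singleton.1 (ha ▸ AddSubgroup.subset_closure hy)
    have ha0 : a ≠ 0 := by
      rintro rfl
      obtain ⟨k, hk⟩ := h1 s hs
      simp at hk
      exact hs0.ne hk
    refine hν ⟨|a|, abs_pos.2 ha0, fun y hy => ?_⟩
    obtain ⟨k, rfl⟩ := h1 y hy
    rcases abs_choice a with h | h <;> rw [h]
    · exact ⟨k, by simp [mul_comm]⟩
    · exact ⟨-k, by simp [mul_comm]⟩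

/-- Bézout: the integers in the group form a cyclic group whose generator divides the whole support,
hence is a unit. -/
theorem intCast_mem_closure_support (hν : IsNormalizedLattice ν) (n : ℤ) :
    (n : ℝ) ∈ AddSubgroup.closure ν.support := by
  obtain ⟨a, ha⟩ := Int.subgroup_cyclic
    ((AddSubgroup.closure ν.support).comap (Int.castAddHom ℝ))
  have h1 : a.natAbs = 1 := by
    refine hν.2 _ fun y hy => ?_
    obtain ⟨k, rfl⟩ := hν.1 y hy
    have h2 : k ∈ (AddSubgroup.closure ν.support).comap (Int.castAddHom ℝ) :=
      AddSubgroup.subset_closure hy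
    rw [ha, AddSubgroup.mem_closure_singleton] at h2
    obtain ⟨m, hm⟩ := h2
    rw [smul_eq_mul] at hm
    obtain ⟨c, hc⟩ : (a.natAbs : ℤ) ∣ k := Int.natAbs_dvd.2 ⟨m, by rw [← hm, mul_comm]⟩
    exact ⟨c, by rw [hc, Int.cast_mul, Int.cast_natCast]⟩
  have h3 : n ∈ (AddSubgroup.closure ν.support).comap (Int.castAddHom ℝ) := by
    rw [ha, AddSubgroup.mem_closure_singleton]
    rcases Int.natAbs_eq a with h | h <;> rw [h1] at h
    · exact ⟨n, by simp [h]⟩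
    · exact ⟨-n, by simp [h]⟩
  exact h3

end Group

/-! ### Contraction in several dimensions -/

section Contraction

variable {d : ℕ} {μ : Measure (Fin d → ℝ)} [IsProbabilityMeasure μ]

theorem exists_support_pos (hpos : ∀ i, 0 < coordMarginal μ i (Ioi 0)) (i : Fin d) :
    ∃ s ∈ (coordMarginal μ i).support, 0 < s := by
  obtain ⟨s, hs, hs'⟩ := Measure.nonempty_inter_support_of_pos (hpos i)
  exact ⟨s, hs', hs⟩

variable (hpos : ∀ i, 0 < coordMarginal μ i (Ioi 0))
  (hlat : ∀ i, IsLattice (coordMarginal μ i) → IsNormalizedLattice (coordMarginal μ i))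
include hpos hlat

theorem exists_abs_path_apply_sub_lt {x y : Fin d → ℝ} (hx : x ∈ stateSpace μ)
    (hy : y ∈ stateSpace μ) (hxy : parity μ x = parity μ y) (i : Fin d) {r : ℝ} (hr : 0 < r) :
    ∃ (t : ℕ → Fin d → ℝ) (n : ℕ), (∀ k, t k ∈ μ.support) ∧
      |path x t n i - path y t n i| < r := by
  obtain ⟨s, hs, hs0⟩ := exists_support_pos hpos i
  obtain ⟨t, n, ht, hn⟩ : ∃ (t : ℕ → ℝ) (n : ℕ), (∀ k, t k ∈ (coordMarginal μ i).support) ∧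
      |absPath (x i) t n - absPath (y i) t n| < r / 2 := by
    by_cases hi : IsLattice (coordMarginal μ i)
    · obtain ⟨k, hk⟩ := (hx i).2 hi
      obtain ⟨m, hm⟩ := (hy i).2 hi
      have h1 := congrFun hxy i
      simp only [parity, if_pos hi, hk, hm, Int.floor_natCast, Int.cast_natCast] at h1
      rw [ZMod.natCast_eq_natCast_iff'] at h1
      have hcl : ∀ a : ℤ, (a : ℝ) ∈
          (AddSubgroup.closure (coordMarginal μ i).support).topologicalClosure := fun a =>
        AddSubgroup.le_topologicalClosure _ (intCast_mem_closure_support (hlat i hi) a)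
      have h2 : (x i + y i) / 2 = (((k + m : ℤ) / 2 : ℤ) : ℝ) := by
        rw [Int.cast_div (by omega) (by norm_num), hk, hm]; push_cast; rfl
      have h3 : (x i - y i) / 2 = (((k - m : ℤ) / 2 : ℤ) : ℝ) := by
        rw [Int.cast_div (by omega) (by norm_num), hk, hm]; push_cast; rfl
      exact exists_absPath_sub_lt hs hs0 (hx i).1 (hy i).1 (h2 ▸ hcl _) (h3 ▸ hcl _) (half_pos hr)
    · have h := mem_topologicalClosure_of_not_isLattice hi hs hs0
      exact exists_absPath_sub_lt hs hs0 (hx i).1 (hy i).1 (h _) (h _) (half_pos hr)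
  -- The `t k` lie only in the support of the marginal. Replacing them by nearby coordinates of
  -- points of `μ.support` costs at most `r / 4` for each of the two trajectories.
  set δ := r / (4 * (n + 1))
  have hδ : 0 < δ := by positivity
  choose w hw hwt using fun k => exists_mem_support_apply_near μ (ht k) hδ
  refine ⟨w, n, hw, ?_⟩
  have h1 (z : ℝ) : |absPath z (fun k => w k i) n - absPath z t n| ≤ r / 4 := by
    refine (abs_absPath_sub_le_sum _ _ _ _).trans ?_
    refine (Finset.sum_le_card_nsmul _ _ δ fun k _ => (hwt k).le).trans ?_
    have : (n + 1 : ℝ) * δ = r / 4 := by simp only [δ]; field_simp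
    simp only [Finset.card_range, nsmul_eq_mul]
    linarith
  rw [path_apply, path_apply]
  have h2 := abs_le.1 (h1 (x i))
  have h3 := abs_le.1 (h1 (y i))
  have h4 := abs_lt.1 hn
  exact abs_lt.2 ⟨by linarith, by linarith⟩

omit hpos hlat in
theorem abs_path_apply_sub_antitone (x y : Fin d → ℝ) (t : ℕ → Fin d → ℝ) (i : Fin d) (n m : ℕ) :
    |path x t (n + m) i - path y t (n + m) i| ≤ |path x t n i - path y t n i| := by
  rw [path_add, path_add, path_apply, path_apply (path y t n)]
  exact abs_absPath_sub_le _ _ _ _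

/-- Finitely many states with the same parities can simultaneously be brought close to each
other. -/
theorem exists_dist_path_lt {F : Set (Fin d → ℝ)} (hF : F.Finite) (hFs : F ⊆ stateSpace μ)
    (hFp : ∀ x ∈ F, ∀ y ∈ F, parity μ x = parity μ y) {r : ℝ} (hr : 0 < r) :
    ∃ (t : ℕ → Fin d → ℝ) (n : ℕ), (∀ k, t k ∈ μ.support) ∧
      ∀ x ∈ F, ∀ y ∈ F, dist (path x t n) (path y t n) < r := by
  -- A triple names two states and a coordinate. The triples are treated one after another; later
  -- increments cannot undo a contraction in a coordinate.
  suffices H : ∀ T : Set ((Fin d → ℝ) × (Fin d → ℝ) × Fin d), T.Finite →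
      T ⊆ F ×ˢ F ×ˢ univ → ∃ (t : ℕ → Fin d → ℝ) (n : ℕ), (∀ k, t k ∈ μ.support) ∧
        ∀ z ∈ T, |path z.1 t n z.2.2 - path z.2.1 t n z.2.2| < r by
    obtain ⟨t, n, ht, hn⟩ := H (F ×ˢ F ×ˢ univ) (hF.prod (hF.prod finite_univ)) Subset.rfl
    refine ⟨t, n, ht, fun x hx y hy => (dist_pi_lt_iff hr).2 fun i => ?_⟩
    exact hn (x, y, i) ⟨hx, hy, mem_univ _⟩
  intro T hT
  induction T, hT using Set.Finite.induction_on with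
  | empty =>
    obtain ⟨t, ht⟩ := support_nonempty μ
    exact fun _ => ⟨fun _ => t, 0, fun _ => ht, by simp⟩
  | @insert z T _ _ ih =>
    intro hTF
    obtain ⟨t, n, ht, hn⟩ := ih ((subset_insert _ _).trans hTF)
    obtain ⟨hz1, hz2, -⟩ := hTF (mem_insert z T)
    have hp : parity μ (path z.1 t n) = parity μ (path z.2.1 t n) := by
      rw [parity_path hlat (hFs hz1) ht, parity_path hlat (hFs hz2) ht, hFp _ hz1 _ hz2]
    obtain ⟨t', n', ht', hn'⟩ := exists_abs_path_apply_sub_lt hpos hlat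
      (path_mem_stateSpace hlat (hFs hz1) ht n) (path_mem_stateSpace hlat (hFs hz2) ht n) hp
      z.2.2 hr
    refine ⟨splice n t t', n + n', splice_mem_support ht ht' n, ?_⟩
    rintro w (rfl | hw)
    · simpa only [path_splice_add] using hn'
    · refine (abs_path_apply_sub_antitone _ _ _ _ _ _).trans_lt ?_
      simpa only [path_splice_of_le _ _ _ (le_refl n)] using hn w hw

end Contraction

end ReflectedWalk

namespace ReflectedWalk

/-! ### Infinitely many visits -/

section Visits

variable {d : ℕ} {μ : Measure (Fin d → ℝ)} [IsProbabilityMeasure μ]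

/-- If a situation that leads to a visit with probability at least `c` occurs infinitely often,
then there are almost surely infinitely many visits. -/
theorem ae_frequently_imp_frequently {x : Fin d → ℝ} {Q R : ℕ → (Fin d → ℝ) → Prop}
    (hR : ∀ n, MeasurableSet {v | R n v}) {c : ℝ≥0∞} (hc : 0 < c)
    (hQR : ∀ n v, Q n v → c ≤ incrementLaw μ {y | ∃ k, R (n + k) (path v y k)}) :
    ∀ᵐ y ∂(incrementLaw μ), (∃ᶠ n in atTop, Q n (path x y n)) →
      ∃ᶠ n in atTop, R n (path x y n) := by
  have hB : ∀ m, MeasurableSet {y : ℕ → Fin d → ℝ | (∀ n, m ≤ n → ¬ R n (path x y n))} := by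
    intro m
    simp only [ofPred_forall]
    exact .iInter fun n => .iInter fun _ => (measurable_path x n (hR n)).compl
  -- On the event of no visit from time `m` on, the conditional probability of such a visit cannot
  -- be at least `c` infinitely often.
  have hlevy : ∀ m, ∀ᵐ y ∂(incrementLaw μ), y ∈ {y : ℕ → Fin d → ℝ | ∀ n, m ≤ n →
      ¬ R n (path x y n)} → ¬ ∃ᶠ n in atTop, Q n (path x y n) := by
    intro m
    filter_upwards [ae_not_frequently_splice μ (hB m) hc] with y hy hyB hfr
    refine hy hyB ((hfr.and_eventually (eventually_ge_atTop m)).mono ?_)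
    rintro n ⟨hn, hmn⟩
    refine (hQR n _ hn).trans (measure_mono ?_)
    rintro z ⟨k, hk⟩ hz
    refine hz (n + k) (by omega) ?_
    rwa [path_splice_add]
  filter_upwards [ae_all_iff.2 hlevy] with y hy hfr
  refine frequently_atTop.2 fun m => ?_
  by_contra! hcon
  exact hy m (fun n hn => hcon n hn) hfr

theorem ae_frequently_of_frequently {x : Fin d → ℝ} {Q R : ℕ → (Fin d → ℝ) → Prop}
    (hR : ∀ n, MeasurableSet {v | R n v}) {c : ℝ≥0∞} (hc : 0 < c)
    (hQ : ∀ᵐ y ∂(incrementLaw μ), ∃ᶠ n in atTop, Q n (path x y n))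
    (hQR : ∀ n v, Q n v → c ≤ incrementLaw μ {y | ∃ k, R (n + k) (path v y k)}) :
    ∀ᵐ y ∂(incrementLaw μ), ∃ᶠ n in atTop, R n (path x y n) := by
  filter_upwards [hQ, ae_frequently_imp_frequently (x := x) hR hc hQR] with y h1 h2
  exact h2 h1

theorem exists_of_ae {p : (ℕ → Fin d → ℝ) → Prop} (h : ∀ᵐ y ∂(incrementLaw μ), p y) :
    ∃ y, (∀ k, y k ∈ μ.support) ∧ p y := by
  obtain ⟨y, hy⟩ := ((ae_forall_mem_support μ).and h).exists
  exact ⟨y, hy⟩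

variable (hpos : ∀ i, 0 < coordMarginal μ i (Ioi 0))
  (hlat : ∀ i, IsLattice (coordMarginal μ i) → IsNormalizedLattice (coordMarginal μ i))

/-- Each of the infinitely many visits near `z` is followed, with probability bounded below, by
increments close to `t`, which lead near `path z t n`. -/
theorem attractor_path {C : Set (Fin d → ℝ)} {z : Fin d → ℝ} (hz : z ∈ attractor μ C)
    (hC : ∀ t : ℕ → Fin d → ℝ, (∀ k, t k ∈ μ.support) → ∀ x ∈ C, ∀ n, path x t n ∈ C)
    {t : ℕ → Fin d → ℝ} (ht : ∀ k, t k ∈ μ.support) (n : ℕ) : path z t n ∈ attractor μ C := by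
  refine ⟨hC t ht z hz.1 n, fun U hU hzU x hx => ?_⟩
  obtain ⟨r, hr, hrU⟩ := Metric.isOpen_iff.1 hU _ hzU
  obtain ⟨Q, -, hQ0, hQ⟩ := exists_control μ ht n (half_pos hr)
  refine ae_frequently_of_frequently (Q := fun _ v => v ∈ Metric.ball z (r / 2))
    (R := fun _ v => v ∈ U) (fun _ => hU.measurableSet) hQ0
    (hz.2 _ Metric.isOpen_ball (Metric.mem_ball_self (half_pos hr)) x hx) ?_
  intro m v hv
  refine measure_mono fun y hy => ⟨n, hrU ?_⟩
  have h1 := dist_path_le v z y n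
  have h2 := hQ y hy z
  have h3 := dist_triangle (path v y n) (path z y n) (path z t n)
  rw [Metric.mem_ball] at hv ⊢
  linarith

include hlat in
theorem attractor_parityClass_path {x₀ z : Fin d → ℝ} (hz : z ∈ attractor μ (parityClass μ x₀))
    {t : ℕ → Fin d → ℝ} (ht : ∀ k, t k ∈ μ.support) (n : ℕ) :
    path z t n ∈ attractor μ (parityClass μ x₀) :=
  attractor_path hz (fun _ ht' _ hx n => path_mem_parityClass hlat hx ht' n) ht n

include hpos hlat

/-- Returns to a neighbourhood of a point of the attractor are possible after `m + a` steps,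
simultaneously for all `a` up to a bound for which this is compatible with the parities. -/
theorem exists_return_times {x₀ z : Fin d → ℝ} (hz : z ∈ attractor μ (parityClass μ x₀))
    {r : ℝ} (hr : 0 < r) (M : ℕ) :
    ∃ m : ℕ, 0 ∈ parityAfter μ m ∧ ∃ c : ℝ≥0∞, 0 < c ∧ ∀ a ≤ M, 0 ∈ parityAfter μ a →
      ∀ v ∈ Metric.ball z (r / 2),
        c ≤ incrementLaw μ {y | path v y (m + a) ∈ Metric.ball z r} := by
  classical
  have hzs := hz.1.1
  have hex : ∀ a, ∃ t : ℕ → Fin d → ℝ, (∀ k, t k ∈ μ.support) ∧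
      (0 ∈ parityAfter μ a → 0 = ∑ k ∈ Finset.range a, parity μ (t k)) := by
    intro a
    by_cases ha : 0 ∈ parityAfter μ a
    · obtain ⟨t, ht, ht'⟩ := ha
      exact ⟨t, ht, fun _ => ht'⟩
    · obtain ⟨s, hs⟩ := support_nonempty μ
      exact ⟨fun _ => s, fun _ => hs, fun h => absurd h ha⟩
  choose s hs hs0 using hex
  -- The positions after all admissible delays `a`. They share the parities of `z`, so one word of
  -- increments can gather them.
  set F : Set (Fin d → ℝ) :=
    (fun a => path z (s a) a) '' {a | a ≤ M ∧ 0 ∈ parityAfter μ a} with hF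
  have hzF : z ∈ F := ⟨0, ⟨Nat.zero_le _, zero_mem_parityAfter_zero⟩, rfl⟩
  have hFfin : F.Finite := ((finite_le_nat M).subset fun a ha => ha.1).image _
  have hFs : F ⊆ stateSpace μ := by
    rintro _ ⟨a, -, rfl⟩
    exact path_mem_stateSpace hlat hzs (hs a) a
  have hFp : ∀ x ∈ F, parity μ x = parity μ z := by
    rintro _ ⟨a, ha, rfl⟩
    rw [parity_path hlat hzs (hs a), ← hs0 a ha.2, add_zero]
  set δ := min (r / 8) 1
  have hδ : 0 < δ := lt_min (by positivity) one_pos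
  have hδr : δ ≤ r / 8 := min_le_left _ _
  obtain ⟨t, n, ht, hn⟩ := exists_dist_path_lt hpos hlat hFfin hFs
    (fun x hx y hy => (hFp x hx).trans (hFp y hy).symm) hδ
  -- After the gathering word `t`, a word `t'` from a recurrent trajectory leads back to `z`. The
  -- common length `n + n'` serves as `m`, for all delays at once.
  obtain ⟨t', ht', hfr⟩ := exists_of_ae (hz.2 _ Metric.isOpen_ball (Metric.mem_ball_self hδ)
    (path z t n) (path_mem_parityClass hlat hz.1 ht n))
  obtain ⟨n', hn'⟩ := hfr.exists
  have htt := splice_mem_support ht ht' n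
  have hend : path z (splice n t t') (n + n') ∈ Metric.ball z δ := by rwa [path_splice_add]
  refine ⟨n + n', ?_, ?_⟩
  · have h1 := parity_eq_of_mem_stateSpace (path_mem_stateSpace hlat hzs htt (n + n')) hzs
      ((Metric.mem_ball.1 hend).trans_le (min_le_right _ _))
    rw [parity_path hlat hzs htt, add_eq_left] at h1
    exact ⟨_, htt, h1.symm⟩
  -- The starting point contributes `r / 2`; imitation of the word, gathering and return contribute
  -- at most `r / 8` each.
  · have hctl := fun a => exists_control μ (splice_mem_support (hs a) htt a) (a + (n + n'))
      (r := r / 8) (by positivity)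
    choose Q _ hQ0 hQ using hctl
    refine ⟨(Finset.range (M + 1)).inf fun a => incrementLaw μ (Q a), ?_, ?_⟩
    · exact (Finset.lt_inf_iff (by simp)).2 fun a _ => hQ0 a
    intro a haM ha v hv
    refine (Finset.inf_le (Finset.mem_range.2 (Nat.lt_succ_of_le haM))).trans (measure_mono ?_)
    intro y hy
    have h1 := hQ a y hy z
    rw [path_splice_add, path_splice_add] at h1
    have haF : path z (s a) a ∈ F := ⟨a, ⟨haM, ha⟩, rfl⟩
    have h2 := dist_path_le (path (path z (s a) a) t n) (path z t n) t' n'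
    have h3 := hn _ haF z hzF
    rw [path_splice_add] at hend
    have h4 := dist_path_le v z y (a + (n + n'))
    have h5 := dist_triangle4 (path v y (a + (n + n'))) (path z y (a + (n + n')))
      (path (path (path z (s a) a) t n) t' n') (path (path z t n) t' n')
    have h6 := dist_triangle (path v y (a + (n + n'))) (path (path z t n) t' n') z
    rw [Metric.mem_ball] at hv hend
    show path v y (n + n' + a) ∈ Metric.ball z r
    rw [Metric.mem_ball, add_comm (n + n') a]
    linarith

/-- Near a point of the attractor, the walk is infinitely often at times of prescribed phase. -/
theorem ae_frequently_phase {x₀ z x : Fin d → ℝ} (hz : z ∈ attractor μ (parityClass μ x₀))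
    (hx : x ∈ parityClass μ x₀) {n : ℕ} (hn : parity μ z - parity μ x ∈ parityAfter μ n)
    {U : Set (Fin d → ℝ)} (hU : IsOpen U) (hzU : z ∈ U) :
    ∀ᵐ y ∂(incrementLaw μ), ∃ᶠ N in atTop, N % 2 = n % 2 ∧ path x y N ∈ U := by
  obtain ⟨r, hr, hrU⟩ := Metric.isOpen_iff.1 hU _ hzU
  -- `a` is odd as soon as the parities can return in an odd number of steps; if they cannot, no
  -- phase ever needs correcting.
  obtain ⟨a, ha, hodd⟩ : ∃ a, 0 ∈ parityAfter μ a ∧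
      ((∃ b, b % 2 = 1 ∧ 0 ∈ parityAfter μ b) → a % 2 = 1) := by
    by_cases h : ∃ b, b % 2 = 1 ∧ 0 ∈ parityAfter μ b
    · obtain ⟨b, hb, hb'⟩ := h
      exact ⟨b, hb', fun _ => hb⟩
    · exact ⟨0, zero_mem_parityAfter_zero, fun h' => absurd h' h⟩
  obtain ⟨m, -, c, hc, hmc⟩ := exists_return_times hpos hlat hz hr a
  set ρ := min (r / 2) 1
  have hρ : 0 < ρ := lt_min (half_pos hr) one_pos
  have hρr : ρ ≤ r / 2 := min_le_left _ _
  refine ae_frequently_of_frequently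
    (Q := fun k v => v ∈ Metric.ball z ρ ∧ 0 ∈ parityAfter μ (k + n))
    (R := fun N v => N % 2 = n % 2 ∧ v ∈ U) (fun N => ?_) (c := min c 1)
    (lt_min hc one_pos) ?_ ?_
  · exact (MeasurableSet.const _).inter hU.measurableSet
  · filter_upwards [hz.2 _ Metric.isOpen_ball (Metric.mem_ball_self hρ) x hx,
      ae_forall_mem_support μ] with y hy hys
    refine hy.mono fun k hk => ⟨hk, ?_⟩
    have h1 := parity_path_sub_mem hlat hx.1 hys k
    rw [parity_eq_of_mem_stateSpace (path_mem_stateSpace hlat hx.1 hys k) hz.1.1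
      ((Metric.mem_ball.1 hk).trans_le (min_le_right _ _))] at h1
    have h2 := add_mem_parityAfter h1 hn
    rwa [add_self_parity] at h2
  · rintro k v ⟨hv, hk⟩
    have hv2 : v ∈ Metric.ball z (r / 2) := Metric.ball_subset_ball hρr hv
    rcases Nat.mod_two_eq_zero_or_one (k + n) with hkn | hkn
    · refine (min_le_right _ _).trans ?_
      have : {y : ℕ → Fin d → ℝ | ∃ k', (k + k') % 2 = n % 2 ∧ path v y k' ∈ U} = univ := by
        refine eq_univ_of_forall fun y => ⟨0, by omega, ?_⟩
        exact hrU (Metric.ball_subset_ball (by linarith) hv2)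
      rw [this, measure_univ]
    -- The phase is wrong, so `k + n` is an odd return time of the parities and `a` is odd. One of
    -- the delays `m + 0` and `m + a` then restores the phase.
    · refine (min_le_left _ _).trans ?_
      have ha1 := hodd ⟨_, hkn, hk⟩
      rcases Nat.mod_two_eq_zero_or_one (k + m + n) with h | h
      · exact (hmc 0 (Nat.zero_le _) zero_mem_parityAfter_zero v hv2).trans
          (measure_mono fun y hy => ⟨m + 0, by omega, hrU hy⟩)
      · exact (hmc a le_rfl ha v hv2).trans
          (measure_mono fun y hy => ⟨m + a, by omega, hrU hy⟩)

end Visits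

end ReflectedWalk

namespace ReflectedWalk

/-! ### Return times -/

section Return

variable {d : ℕ} {μ : Measure (Fin d → ℝ)} [IsProbabilityMeasure μ]

/-- The event that there is no return to `V` up to time `j`. -/
def noReturn (V : Set (Fin d → ℝ)) (x : Fin d → ℝ) (j : ℕ) : Set (ℕ → Fin d → ℝ) :=
  {y | ∀ n, 1 ≤ n → n ≤ j → path x y n ∉ V}

theorem measurableSet_noReturn {V : Set (Fin d → ℝ)} (hV : MeasurableSet V) (x : Fin d → ℝ)
    (j : ℕ) : MeasurableSet (noReturn V x j) := by
  unfold noReturn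
  simp only [ofPred_forall]
  exact .iInter fun n => .iInter fun _ => .iInter fun _ => (measurable_path x n hV).compl

theorem measurable_returnTime {V : Set (Fin d → ℝ)} (hV : MeasurableSet V) (x : Fin d → ℝ) :
    Measurable (returnTime V x) := by
  classical
  unfold returnTime
  refine Measurable.iInf fun n => ?_
  have h : (fun y : ℕ → Fin d → ℝ => ⨅ (_ : 1 ≤ n ∧ path x y n ∈ V), (n : ℝ≥0∞)) =
      fun y => if 1 ≤ n ∧ path x y n ∈ V then (n : ℝ≥0∞) else ∞ := by
    funext y
    split_ifs with h <;> simp [h]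
  rw [h]
  exact Measurable.ite ((MeasurableSet.const _).inter (measurable_path x n hV))
    measurable_const measurable_const

/-- The pathwise form of the tail sum for the mean of a return time: a return at time `n` excludes
the events with index `j ≥ n`. -/
theorem tsum_indicator_noReturn_le (V : Set (Fin d → ℝ)) (x : Fin d → ℝ)
    (y : ℕ → Fin d → ℝ) :
    ∑' j, (noReturn V x j).indicator (fun _ => (1 : ℝ≥0∞)) y ≤ returnTime V x y := by
  refine le_iInf₂ fun n hn => ?_
  have h0 : ∀ j ∉ Finset.range n, (noReturn V x j).indicator (fun _ => (1 : ℝ≥0∞)) y = 0 := by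
    intro j hj
    have hnj : n ≤ j := by simpa using hj
    have h1 : y ∉ noReturn V x j := fun h => h n hn.1 hnj hn.2
    exact indicator_of_notMem h1 _
  rw [tsum_eq_sum h0]
  refine (Finset.sum_le_card_nsmul _ _ 1 fun j _ => indicator_le_self' (by simp) y).trans ?_
  simp

theorem tsum_measure_noReturn_le {V : Set (Fin d → ℝ)} (hV : MeasurableSet V)
    (x : Fin d → ℝ) :
    ∑' j, incrementLaw μ (noReturn V x j) ≤ ∫⁻ y, returnTime V x y ∂(incrementLaw μ) := by
  calc ∑' j, incrementLaw μ (noReturn V x j)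
      = ∫⁻ y, ∑' j, (noReturn V x j).indicator (fun _ => (1 : ℝ≥0∞)) y ∂(incrementLaw μ) := by
        rw [lintegral_tsum fun j =>
          (measurable_const.indicator (measurableSet_noReturn hV x j)).aemeasurable]
        congr 1
        funext j
        exact (lintegral_indicator_one (measurableSet_noReturn hV x j)).symm
    _ ≤ _ := lintegral_mono fun y => tsum_indicator_noReturn_le V x y

theorem returnTime_le_splice {V : Set (Fin d → ℝ)} {x : Fin d → ℝ} {y z : ℕ → Fin d → ℝ}
    (h : path x y 1 ∉ V) : returnTime V (path x y 1) z ≤ returnTime V x (splice 1 y z) := by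
  refine le_iInf₂ fun n hn => ?_
  obtain ⟨m, rfl⟩ : ∃ m, n = 1 + m := ⟨n - 1, by omega⟩
  rw [path_splice_add] at hn
  have hm : 1 ≤ m := by
    by_contra hm
    have : m = 0 := by omega
    subst this
    exact h hn.2
  exact (iInf₂_le m ⟨hm, hn.2⟩).trans (by exact_mod_cast (by omega : m ≤ 1 + m))

/-- Conditioning on the first step: if it misses `V`, the remaining time from the new position is no
longer than the original return time. -/
theorem ae_mem_or_lintegral_returnTime_lt {V : Set (Fin d → ℝ)} (hV : MeasurableSet V)
    {x : Fin d → ℝ} (hx : ∫⁻ y, returnTime V x y ∂(incrementLaw μ) < ∞) :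
    ∀ᵐ y ∂(incrementLaw μ), path x y 1 ∈ V ∨
      ∫⁻ z, returnTime V (path x y 1) z ∂(incrementLaw μ) < ∞ := by
  rw [lintegral_splice μ 1 (measurable_returnTime hV x)] at hx
  have hm : Measurable fun y => ∫⁻ z, returnTime V x (splice 1 y z) ∂(incrementLaw μ) :=
    ((measurable_returnTime hV x).comp (measurable_splice 1)).lintegral_prod_right'
  filter_upwards [ae_lt_top hm hx.ne] with y hy
  by_cases h : path x y 1 ∈ V
  · exact .inl h
  · exact .inr ((lintegral_mono fun z => returnTime_le_splice h).trans_lt hy)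

variable (hlat : ∀ i, IsLattice (coordMarginal μ i) → IsNormalizedLattice (coordMarginal μ i))
include hlat

/-- The hypothesis gives finite means only for starting points inside `V`. Finiteness is carried
along the trajectory: a position outside `V` inherits it, and one inside `V` has it anew because the
attractor is never left. -/
theorem exists_mem_lintegral_returnTime_lt {x₀ : Fin d → ℝ}
    (hfin : FiniteMeanReturn μ (attractor μ (parityClass μ x₀))) {V : Set (Fin d → ℝ)}
    (hV : IsOpen V) {U : Set (Fin d → ℝ)} (hU : MeasurableSet U) (n : ℕ) {x : Fin d → ℝ}
    (hx : x ∈ attractor μ (parityClass μ x₀))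
    (hxV : ∫⁻ y, returnTime V x y ∂(incrementLaw μ) < ∞)
    (hn : 0 < incrementLaw μ {y | path x y n ∈ U}) :
    ∃ u ∈ U, ∫⁻ y, returnTime V u y ∂(incrementLaw μ) < ∞ := by
  induction n generalizing x with
  | zero =>
    obtain ⟨y, hy⟩ := nonempty_of_measure_ne_zero hn.ne'
    exact ⟨x, hy, hxV⟩
  | succ n ih =>
    have hm : MeasurableSet {y : ℕ → Fin d → ℝ | path x y (1 + n) ∈ U} :=
      measurable_path x (1 + n) hU
    rw [add_comm, measure_splice μ 1 hm] at hn
    simp only [mem_ofPred_eq, path_splice_add] at hn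
    have h1 : ∃ᵐ y ∂(incrementLaw μ),
        0 < incrementLaw μ {z | path (path x y 1) z n ∈ U} := by
      intro h
      refine hn.ne' (lintegral_eq_zero_of_ae_eq_zero ?_)
      filter_upwards [h] with y hy
      exact le_antisymm (not_lt.1 hy) zero_le
    obtain ⟨y, hy1, hy2, hy3⟩ := (h1.and_eventually
      ((ae_forall_mem_support μ).and
        (ae_mem_or_lintegral_returnTime_lt hV.measurableSet hxV))).exists
    have hL := attractor_parityClass_path hlat hx hy2 1
    refine ih hL ?_ hy1
    rcases hy3 with h | h
    · exact hfin V hV _ ⟨h, hL⟩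
    · exact h

/-- Uniformly summable tails of the return times to a ball. -/
theorem exists_summable_noReturn {x₀ : Fin d → ℝ}
    (hfin : FiniteMeanReturn μ (attractor μ (parityClass μ x₀))) {z : Fin d → ℝ}
    (hz : z ∈ attractor μ (parityClass μ x₀)) {r : ℝ} (hr : 0 < r) :
    ∃ b : ℕ → ℝ≥0∞, ∑' j, b j ≠ ∞ ∧
      ∀ v ∈ Metric.ball z r ∩ attractor μ (parityClass μ x₀), ∀ j,
        incrementLaw μ (noReturn (Metric.ball z r) v j) ≤ b j := by
  set L := attractor μ (parityClass μ x₀)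
  set V := Metric.ball z (r / 2)
  have hzV : z ∈ V := Metric.mem_ball_self (half_pos hr)
  -- The comparison point has finite mean return time to the smaller ball `V`. A point `v` within `r
  -- / 4` of `u` stays within `r / 2` of its trajectory, so returns of that trajectory to `V` are
  -- returns of `v` to the large ball.
  have hgood : ∀ u : Fin d → ℝ, ∃ u', u ∈ L → u' ∈ Metric.ball u (r / 4) ∧
      ∫⁻ y, returnTime V u' y ∂(incrementLaw μ) < ∞ := by
    intro u
    by_cases hu : u ∈ L
    · obtain ⟨n, hn⟩ : ∃ n, 0 < incrementLaw μ {y | path z y n ∈ Metric.ball u (r / 4)} := by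
        by_contra! h
        have h1 : ∀ᵐ y ∂(incrementLaw μ), ∀ n, ¬ path z y n ∈ Metric.ball u (r / 4) :=
          ae_all_iff.2 fun n =>
            measure_eq_zero_iff_ae_notMem.1 (le_antisymm (h n) zero_le)
        obtain ⟨y, hy1, hy2⟩ := ((hu.2 _ Metric.isOpen_ball
          (Metric.mem_ball_self (by positivity : 0 < r / 4)) z hz.1).and h1).exists
        obtain ⟨n, hn⟩ := hy1.exists
        exact hy2 n hn
      obtain ⟨u', hu'⟩ := exists_mem_lintegral_returnTime_lt hlat hfin Metric.isOpen_ball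
        measurableSet_ball n hz (hfin V Metric.isOpen_ball z ⟨hzV, hz⟩) hn
      exact ⟨u', fun _ => hu'⟩
    · exact ⟨u, fun h => absurd h hu⟩
  choose g hg using hgood
  -- Finitely many comparison points suffice, and the sum of their tails is the uniform bound.
  have htb : TotallyBounded (Metric.ball z r ∩ L) :=
    (isCompact_closedBall z r).totallyBounded.subset
      (inter_subset_left.trans Metric.ball_subset_closedBall)
  obtain ⟨F, hFsub, hFfin, hF⟩ := totallyBounded_iff_subset.1 htb _
    (Metric.dist_mem_uniformity (by positivity : 0 < r / 4))
  refine ⟨fun j => ∑ u ∈ hFfin.toFinset, incrementLaw μ (noReturn V (g u) j), ?_, ?_⟩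
  · rw [Summable.tsum_finsetSum fun _ _ => ENNReal.summable]
    refine ENNReal.sum_ne_top.2 fun u hu => ?_
    have huL := (hFsub (hFfin.mem_toFinset.1 hu)).2
    exact ((tsum_measure_noReturn_le measurableSet_ball _).trans_lt (hg u huL).2).ne
  · intro v hv j
    obtain ⟨u, huF, huv⟩ := mem_iUnion₂.1 (hF hv)
    have hu := (hg u (hFsub huF).2).1
    refine (measure_mono ?_).trans (Finset.single_le_sum (f := fun u =>
      incrementLaw μ (noReturn V (g u) j)) (fun _ _ => zero_le) (hFfin.mem_toFinset.2 huF))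
    intro y hy n hn1 hnj hmem
    refine hy n hn1 hnj ?_
    have h1 := dist_path_le v (g u) y n
    have h2 := dist_triangle_right v (g u) u
    have h3 := dist_triangle (path v y n) (path (g u) y n) z
    have h4 : dist v u < r / 4 := huv
    rw [Metric.mem_ball] at hu hmem ⊢
    linarith

/-- Decomposition at the last visit up to time `n`, which exists since the walk starts at `z`. A
last visit at time `m` has probability at most `b (n - m)`, and summing over `m < n - K` leaves a
tail of a convergent series. -/
theorem exists_window {x₀ : Fin d → ℝ}
    (hfin : FiniteMeanReturn μ (attractor μ (parityClass μ x₀))) {z : Fin d → ℝ}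
    (hz : z ∈ attractor μ (parityClass μ x₀)) {r : ℝ} (hr : 0 < r) :
    ∃ K : ℕ, ∀ n, incrementLaw μ
      {y | ∀ m, n ≤ m + K → m ≤ n → path z y m ∉ Metric.ball z r} ≤ 1 / 2 := by
  obtain ⟨b, hb, hbv⟩ := exists_summable_noReturn hlat hfin hz hr
  obtain ⟨K, hK⟩ := ((ENNReal.tendsto_sum_nat_add b hb).eventually
    (ge_mem_nhds (by simp : (0 : ℝ≥0∞) < 1 / 2))).exists
  refine ⟨K, fun n => ?_⟩
  set V := Metric.ball z r
  set D : ℕ → Set (ℕ → Fin d → ℝ) := fun m =>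
    {y | path z y m ∈ V ∧ ∀ k, 1 ≤ k → k ≤ n - m → path z y (m + k) ∉ V}
  have hDm : ∀ m, MeasurableSet (D m) := by
    intro m
    have : {y : ℕ → Fin d → ℝ | ∀ k, 1 ≤ k → k ≤ n - m → path z y (m + k) ∉ V} =
        ⋂ k, ⋂ (_ : 1 ≤ k), ⋂ (_ : k ≤ n - m), {y | path z y (m + k) ∈ V}ᶜ := by
      ext; simp
    refine (measurable_path z m measurableSet_ball).inter (this ▸ ?_ : MeasurableSet
      {y : ℕ → Fin d → ℝ | ∀ k, 1 ≤ k → k ≤ n - m → path z y (m + k) ∉ V})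
    exact .iInter fun k => .iInter fun _ => .iInter fun _ =>
      (measurable_path z (m + k) measurableSet_ball).compl
  have hD : ∀ m, incrementLaw μ (D m) ≤ b (n - m) := by
    intro m
    rw [measure_splice μ m (hDm m)]
    calc ∫⁻ y, incrementLaw μ {w | splice m y w ∈ D m} ∂(incrementLaw μ)
        ≤ ∫⁻ _, b (n - m) ∂(incrementLaw μ) := by
          refine lintegral_mono_ae ?_
          filter_upwards [ae_forall_mem_support μ] with y hy
          by_cases hyV : path z y m ∈ V
          · refine (measure_mono ?_).trans
              (hbv _ ⟨hyV, attractor_parityClass_path hlat hz hy m⟩ (n - m))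
            rintro w ⟨-, hw⟩ k hk1 hk2
            have := hw k hk1 hk2
            rwa [path_splice_add] at this
          · have : {w | splice m y w ∈ D m} = ∅ := by
              refine eq_empty_of_forall_notMem fun w hw => hyV ?_
              have := hw.1
              rwa [path_splice_of_le _ _ _ le_rfl] at this
            rw [this, measure_empty]
            exact zero_le
      _ = b (n - m) := by simp
  have hsub : {y | ∀ m, n ≤ m + K → m ≤ n → path z y m ∉ V} ⊆
      ⋃ m ∈ Finset.range (n - K), D m := by
    classical
    intro y hy
    have hex : ∃ k, k ≤ n ∧ path z y (n - k) ∈ V :=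
      ⟨n, le_rfl, by rw [Nat.sub_self]; exact Metric.mem_ball_self hr⟩
    obtain ⟨hk1, hk2⟩ := Nat.find_spec hex
    have hmin := fun m => Nat.find_min hex (m := m)
    set k := Nat.find hex
    have hkK : K < k := by
      by_contra hlt
      exact hy (n - k) (by omega) (by omega) hk2
    refine mem_iUnion₂.2 ⟨n - k, Finset.mem_range.2 (by omega), hk2, fun j hj1 hj2 => ?_⟩
    have := hmin (k - j) (by omega)
    rw [not_and, show n - (k - j) = n - k + j by omega] at this
    exact this (by omega)
  calc incrementLaw μ {y | ∀ m, n ≤ m + K → m ≤ n → path z y m ∉ V}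
      ≤ ∑ m ∈ Finset.range (n - K), b (n - m) :=
        (measure_mono hsub).trans ((measure_biUnion_finset_le _ _).trans
          (Finset.sum_le_sum fun m _ => hD m))
    _ = ∑ i ∈ Finset.range (n - K), b (i + 1 + K) := by
        rw [← Finset.sum_range_reflect]
        refine Finset.sum_congr rfl fun i hi => ?_
        have := Finset.mem_range.1 hi
        congr 1
        omega
    _ ≤ ∑ i ∈ Finset.range (n - K + 1), b (i + K) := by
        rw [Finset.sum_range_succ']
        exact le_self_add
    _ ≤ ∑' i, b (i + K) := ENNReal.sum_le_tsum _
    _ ≤ 1 / 2 := hK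

variable (hpos : ∀ i, 0 < coordMarginal μ i (Ioi 0))
include hpos

/-- In the positive recurrent case, the probability of being near a given point of the attractor
is bounded below at all large times that are compatible with the parities. -/
theorem exists_lower_bound {x₀ : Fin d → ℝ}
    (hfin : FiniteMeanReturn μ (attractor μ (parityClass μ x₀))) {z : Fin d → ℝ}
    (hz : z ∈ attractor μ (parityClass μ x₀)) {r : ℝ} (hr : 0 < r) :
    ∃ c : ℝ≥0∞, 0 < c ∧ ∃ N₀, ∀ N ≥ N₀, 0 ∈ parityAfter μ N →
      c ≤ incrementLaw μ {y | path z y N ∈ Metric.ball z r} := by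
  set ρ := min (r / 2) 1
  have hρ : 0 < ρ := lt_min (half_pos hr) one_pos
  have hρr : ρ ≤ r / 2 := min_le_left _ _
  obtain ⟨K, hK⟩ := exists_window hlat hfin hz hρ
  obtain ⟨a, ha, hodd⟩ : ∃ a, 0 ∈ parityAfter μ a ∧
      ((∃ b, b % 2 = 1 ∧ 0 ∈ parityAfter μ b) → a % 2 = 1) := by
    by_cases h : ∃ b, b % 2 = 1 ∧ 0 ∈ parityAfter μ b
    · obtain ⟨b, hb, hb'⟩ := h
      exact ⟨b, hb', fun _ => hb⟩
    · exact ⟨0, zero_mem_parityAfter_zero, fun h' => absurd h' h⟩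
  obtain ⟨m, hm, c, hc, hmc⟩ := exists_return_times hpos hlat hz hr (a + K)
  have hcK : (0 : ℝ≥0∞) < 1 / (2 * (K + 1)) := by
    refine ENNReal.div_pos one_ne_zero ?_
    exact ENNReal.mul_ne_top (by simp) (by simp)
  refine ⟨1 / (2 * (K + 1)) * c, ENNReal.mul_pos hcK.ne' hc.ne', m + a + K, fun N hN hN0 => ?_⟩
  -- For a visit time `l` with `n - K ≤ l ≤ n`, the delay `N - m - l` lies between `a` and `a + K`:
  -- within the range of `hmc`, and no shorter than `a`.
  set n := N - m - a
  -- some time `l` of the window has a large probability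
  obtain ⟨l, hl1, hl2, hl3⟩ : ∃ l, n ≤ l + K ∧ l ≤ n ∧
      1 / (2 * (K + 1)) ≤ incrementLaw μ {y | path z y l ∈ Metric.ball z ρ} := by
    by_contra! hcon
    set W := ⋃ l ∈ Finset.Icc (n - K) n, {y | path z y l ∈ Metric.ball z ρ}
    have hW : MeasurableSet W := .biUnion (Finset.countable_toSet _) fun l _ =>
      measurable_path z l measurableSet_ball
    have h1 : incrementLaw μ Wᶜ ≤ 1 / 2 := by
      refine (measure_mono ?_).trans (hK n)
      intro y hy k hk1 hk2 hk3
      exact hy (mem_iUnion₂.2 ⟨k, Finset.mem_Icc.2 ⟨by omega, hk2⟩, hk3⟩)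
    have h2 : incrementLaw μ W < 1 / 2 := by
      calc incrementLaw μ W ≤ ∑ l ∈ Finset.Icc (n - K) n,
            incrementLaw μ {y | path z y l ∈ Metric.ball z ρ} := measure_biUnion_finset_le _ _
        _ < ∑ l ∈ Finset.Icc (n - K) n, (1 / (2 * (K + 1)) : ℝ≥0∞) :=
            ENNReal.sum_lt_sum_of_nonempty ⟨n, by simp⟩ fun l hl => by
              have := Finset.mem_Icc.1 hl
              exact hcon l (by omega) this.2
        _ ≤ ((K + 1 : ℕ) : ℝ≥0∞) * (1 / (2 * (K + 1))) := by
            rw [Finset.sum_const, nsmul_eq_mul, Nat.card_Icc]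
            gcongr
            omega
        _ = 1 / 2 := by
            push_cast
            rw [one_div, ENNReal.mul_inv (by simp) (by simp), mul_comm, mul_assoc,
              ENNReal.inv_mul_cancel (by simp) (by simp), mul_one, one_div]
    have h3 := prob_add_prob_compl (μ := incrementLaw μ) hW
    have h4 : incrementLaw μ W + incrementLaw μ Wᶜ < 1 / 2 + 1 / 2 :=
      ENNReal.add_lt_add_of_lt_of_le (measure_ne_top _ _) h2 h1
    rw [h3, ENNReal.add_halves] at h4
    exact lt_irrefl _ h4
  -- from there, a return at time `N` is possible
  have hNl : l + (m + (N - m - l)) = N := by omega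
  have hms : MeasurableSet {y : ℕ → Fin d → ℝ | path z y N ∈ Metric.ball z r} :=
    measurable_path z N measurableSet_ball
  rw [measure_splice μ l hms]
  have hml : MeasurableSet {y : ℕ → Fin d → ℝ | path z y l ∈ Metric.ball z ρ} :=
    measurable_path z l measurableSet_ball
  calc 1 / (2 * (K + 1)) * c ≤ c * incrementLaw μ {y | path z y l ∈ Metric.ball z ρ} := by
        rw [mul_comm]
        gcongr
    _ = ∫⁻ y, {y | path z y l ∈ Metric.ball z ρ}.indicator (fun _ => c) y ∂(incrementLaw μ) := by
        rw [lintegral_indicator_const hml]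
    _ ≤ _ := by
        refine lintegral_mono_ae ?_
        filter_upwards [ae_forall_mem_support μ] with y hy
        by_cases hyl : path z y l ∈ Metric.ball z ρ
        · rw [indicator_of_mem (by exact hyl)]
          have hl0 := parity_path_sub_mem hlat hz.1.1 hy l
          rw [parity_eq_of_mem_stateSpace (path_mem_stateSpace hlat hz.1.1 hy l) hz.1.1
            ((Metric.mem_ball.1 hyl).trans_le (min_le_right _ _)), sub_self] at hl0
          -- If this delay is odd, then one of `l`, `m`, `N` is odd. All three are return times of
          -- the parities, so `a` is odd as well.
          have he : 0 ∈ parityAfter μ (N - m - l) := by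
            rcases Nat.mod_two_eq_zero_or_one (N - m - l) with h | h
            · exact parityAfter_mono (Nat.zero_le _) (by omega) zero_mem_parityAfter_zero
            · have hb : ∃ b, b % 2 = 1 ∧ 0 ∈ parityAfter μ b := by
                rcases Nat.mod_two_eq_zero_or_one N with h1 | h1
                · rcases Nat.mod_two_eq_zero_or_one m with h2 | h2
                  · exact ⟨l, by omega, hl0⟩
                  · exact ⟨m, h2, hm⟩
                · exact ⟨N, h1, hN0⟩
              exact parityAfter_mono (by omega) ((hodd hb).trans h.symm) ha
          refine (hmc (N - m - l) (by omega) he _ (Metric.ball_subset_ball hρr hyl)).trans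
            (measure_mono fun w hw => ?_)
          show path z (splice l y w) N ∈ Metric.ball z r
          rw [← hNl, path_splice_add]
          exact hw
        · rw [indicator_of_notMem (by exact hyl)]
          exact zero_le

/-- In the positive recurrent case, visits occur infinitely often along every infinite set of
times of the right phase. -/
theorem ae_frequently_mem_times {x₀ : Fin d → ℝ}
    (hfin : FiniteMeanReturn μ (attractor μ (parityClass μ x₀))) {z : Fin d → ℝ}
    (hz : z ∈ attractor μ (parityClass μ x₀)) {x : Fin d → ℝ} (hx : x ∈ parityClass μ x₀) {n : ℕ}
    (hn : parity μ z - parity μ x ∈ parityAfter μ n) {U : Set (Fin d → ℝ)} (hU : IsOpen U)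
    (hzU : z ∈ U) {T : Set ℕ} (hT : ∃ᶠ N in atTop, N % 2 = n % 2 ∧ N ∈ T) :
    ∀ᵐ y ∂(incrementLaw μ), ∃ᶠ N in atTop, N ∈ T ∧ path x y N ∈ U := by
  obtain ⟨r, hr, hrU⟩ := Metric.isOpen_iff.1 hU _ hzU
  obtain ⟨c, hc, N₀, hN₀⟩ := exists_lower_bound hlat hpos hfin hz (half_pos hr)
  set ρ := min (r / 2) 1
  have hρ : 0 < ρ := lt_min (half_pos hr) one_pos
  have hρr : ρ ≤ r / 2 := min_le_left _ _
  refine ae_frequently_of_frequently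
    (Q := fun k v => v ∈ Metric.ball z ρ ∧ 0 ∈ parityAfter μ (k + n))
    (R := fun N v => N ∈ T ∧ v ∈ U) (fun N => ?_) hc ?_ ?_
  · exact (MeasurableSet.const _).inter hU.measurableSet
  · filter_upwards [hz.2 _ Metric.isOpen_ball (Metric.mem_ball_self hρ) x hx,
      ae_forall_mem_support μ] with y hy hys
    refine hy.mono fun k hk => ⟨hk, ?_⟩
    have h1 := parity_path_sub_mem hlat hx.1 hys k
    rw [parity_eq_of_mem_stateSpace (path_mem_stateSpace hlat hx.1 hys k) hz.1.1
      ((Metric.mem_ball.1 hk).trans_le (min_le_right _ _))] at h1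
    have h2 := add_mem_parityAfter h1 hn
    rwa [add_self_parity] at h2
  · rintro k v ⟨hv, hk⟩
    -- One time of `T` is enough, since the lower bound holds at every late compatible time. The
    -- margin makes the remaining delay at least `N₀`, and at least `k + n` for the parities.
    obtain ⟨N, hNk, hN2, hNT⟩ := frequently_atTop.1 hT (k + (N₀ + k + n))
    obtain ⟨e, rfl⟩ : ∃ e, N = k + e := ⟨N - k, by omega⟩
    have he : 0 ∈ parityAfter μ e := parityAfter_mono (by omega) (by omega) hk
    refine (hN₀ e (by omega) he).trans (measure_mono fun y hy => ⟨e, hNT, hrU ?_⟩)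
    have h1 := dist_path_le v z y e
    have h2 := dist_triangle (path v y e) (path z y e) z
    have h3 : dist (path z y e) z < r / 2 := hy
    rw [Metric.mem_ball] at hv ⊢
    linarith

end Return

end ReflectedWalk

namespace ReflectedWalk

/-! ### Products -/

theorem mem_support_map {E F : Type*} [TopologicalSpace E] [TopologicalSpace F]
    [MeasurableSpace E] [MeasurableSpace F] {m : Measure E} {f : E → F} (hf : Continuous f)
    (hfm : Measurable f) {t : E} (ht : t ∈ m.support) : f t ∈ (m.map f).support := by
  rw [Measure.mem_support_iff_forall] at ht ⊢
  exact fun U hU => (ht _ (hf.continuousAt hU)).trans_le (Measure.le_map_apply hfm.aemeasurable U)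

theorem mem_support_prod {E F : Type*} [TopologicalSpace E] [TopologicalSpace F]
    [MeasurableSpace E] [MeasurableSpace F] {m : Measure E} {m' : Measure F} [SFinite m']
    {s : E} {t : F} (hs : s ∈ m.support) (ht : t ∈ m'.support) :
    (s, t) ∈ (m.prod m').support := by
  rw [Measure.mem_support_iff_forall] at hs ht ⊢
  intro U hU
  obtain ⟨V, hV, W, hW, hVW⟩ := mem_nhds_prod_iff.1 hU
  refine lt_of_lt_of_le ?_ (measure_mono hVW)
  rw [Measure.prod_prod]
  exact ENNReal.mul_pos (hs V hV).ne' (ht W hW).ne'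

section Product

variable {r₁ r₂ : ℕ}

/-- The first coordinates of a vector. -/
def firstPart {α : Type*} (x : Fin (r₁ + r₂) → α) : Fin r₁ → α := fun i => x (Fin.castAdd r₂ i)

/-- The last coordinates of a vector. -/
def lastPart {α : Type*} (x : Fin (r₁ + r₂) → α) : Fin r₂ → α := fun i => x (Fin.natAdd r₁ i)

theorem append_parts {α : Type*} (x : Fin (r₁ + r₂) → α) :
    Fin.append (firstPart x) (lastPart x) = x := Fin.append_castAdd_natAdd

@[simp] theorem firstPart_append {α : Type*} (x : Fin r₁ → α) (y : Fin r₂ → α) :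
    firstPart (Fin.append x y) = x := funext fun i => Fin.append_left x y i

@[simp] theorem lastPart_append {α : Type*} (x : Fin r₁ → α) (y : Fin r₂ → α) :
    lastPart (Fin.append x y) = y := funext fun i => Fin.append_right x y i

theorem continuous_append :
    Continuous fun p : (Fin r₁ → ℝ) × (Fin r₂ → ℝ) => Fin.append p.1 p.2 := by
  refine continuous_pi fun i => ?_
  refine Fin.addCases (fun i => ?_) (fun i => ?_) i
  · simp only [Fin.append_left]; fun_prop
  · simp only [Fin.append_right]; fun_prop

theorem measurable_append :
    Measurable fun p : (Fin r₁ → ℝ) × (Fin r₂ → ℝ) => Fin.append p.1 p.2 := by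
  refine measurable_pi_lambda _ fun i => ?_
  refine Fin.addCases (fun i => ?_) (fun i => ?_) i
  · simp only [Fin.append_left]; fun_prop
  · simp only [Fin.append_right]; fun_prop

theorem measurable_firstPart : Measurable (firstPart : (Fin (r₁ + r₂) → ℝ) → Fin r₁ → ℝ) :=
  measurable_pi_lambda _ fun _ => measurable_pi_apply _

theorem measurable_lastPart : Measurable (lastPart : (Fin (r₁ + r₂) → ℝ) → Fin r₂ → ℝ) :=
  measurable_pi_lambda _ fun _ => measurable_pi_apply _

theorem firstPart_path (x : Fin (r₁ + r₂) → ℝ) (y : ℕ → Fin (r₁ + r₂) → ℝ) (n : ℕ) :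
    firstPart (path x y n) = path (firstPart x) (fun k => firstPart (y k)) n := by
  funext i
  simp only [firstPart, path_apply]

theorem lastPart_path (x : Fin (r₁ + r₂) → ℝ) (y : ℕ → Fin (r₁ + r₂) → ℝ) (n : ℕ) :
    lastPart (path x y n) = path (lastPart x) (fun k => lastPart (y k)) n := by
  funext i
  simp only [lastPart, path_apply]

variable (μ : Measure (Fin (r₁ + r₂) → ℝ)) [IsProbabilityMeasure μ]

instance isProbabilityMeasure_firstMarginal :
    IsProbabilityMeasure (firstMarginal μ : Measure (Fin r₁ → ℝ)) :=
  Measure.isProbabilityMeasure_map measurable_firstPart.aemeasurable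

instance isProbabilityMeasure_lastMarginal :
    IsProbabilityMeasure (lastMarginal μ : Measure (Fin r₂ → ℝ)) :=
  Measure.isProbabilityMeasure_map measurable_lastPart.aemeasurable

theorem coordMarginal_firstMarginal (i : Fin r₁) :
    coordMarginal (firstMarginal μ) i = coordMarginal μ (Fin.castAdd r₂ i) :=
  Measure.map_map (measurable_pi_apply i) measurable_firstPart

theorem coordMarginal_lastMarginal (i : Fin r₂) :
    coordMarginal (lastMarginal μ) i = coordMarginal μ (Fin.natAdd r₁ i) :=
  Measure.map_map (measurable_pi_apply i) measurable_lastPart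

theorem firstPart_parity (x : Fin (r₁ + r₂) → ℝ) :
    firstPart (parity μ x) = parity (firstMarginal μ) (firstPart x) := by
  funext i
  have h := coordMarginal_firstMarginal μ i
  simp only [firstPart, parity]
  split_ifs with h1 h2 h2
  · rfl
  · rw [h] at h2; exact absurd h1 h2
  · rw [h] at h2; exact absurd h2 h1
  · rfl

theorem lastPart_parity (x : Fin (r₁ + r₂) → ℝ) :
    lastPart (parity μ x) = parity (lastMarginal μ) (lastPart x) := by
  funext i
  have h := coordMarginal_lastMarginal μ i
  simp only [lastPart, parity]
  split_ifs with h1 h2 h2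
  · rfl
  · rw [h] at h2; exact absurd h1 h2
  · rw [h] at h2; exact absurd h2 h1
  · rfl

theorem mem_stateSpace_iff_parts (x : Fin (r₁ + r₂) → ℝ) :
    x ∈ stateSpace μ ↔
      firstPart x ∈ stateSpace (firstMarginal μ) ∧ lastPart x ∈ stateSpace (lastMarginal μ) := by
  simp only [stateSpace, mem_ofPred_eq, coordMarginal_firstMarginal, coordMarginal_lastMarginal]
  constructor
  · exact fun h => ⟨fun i => h _, fun i => h _⟩
  · rintro ⟨h1, h2⟩ i
    exact Fin.addCases h1 h2 i

theorem lintegral_lastPart {f : (ℕ → Fin r₂ → ℝ) → ℝ≥0∞} (hf : Measurable f) :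
    ∫⁻ y, f (fun k => lastPart (y k)) ∂(incrementLaw μ) =
      ∫⁻ y, f y ∂(incrementLaw (lastMarginal μ)) := by
  rw [show lastMarginal μ = μ.map lastPart from rfl, ← map_comp_incrementLaw μ measurable_lastPart,
    lintegral_map hf (by have := measurable_lastPart (r₁ := r₁) (r₂ := r₂); fun_prop)]

variable {μ}

theorem firstPart_mem_parityAfter {n : ℕ} {g : Fin (r₁ + r₂) → ZMod 2}
    (hg : g ∈ parityAfter μ n) : firstPart g ∈ parityAfter (firstMarginal μ) n := by
  obtain ⟨t, ht, rfl⟩ := hg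
  refine ⟨fun k => firstPart (t k), fun k => mem_support_map
    (continuous_pi fun i => continuous_apply _) measurable_firstPart (ht k), ?_⟩
  simp only [← firstPart_parity]
  funext i
  simp [firstPart, Finset.sum_apply]

theorem lastPart_mem_parityAfter {n : ℕ} {g : Fin (r₁ + r₂) → ZMod 2}
    (hg : g ∈ parityAfter μ n) : lastPart g ∈ parityAfter (lastMarginal μ) n := by
  obtain ⟨t, ht, rfl⟩ := hg
  refine ⟨fun k => lastPart (t k), fun k => mem_support_map
    (continuous_pi fun i => continuous_apply _) measurable_lastPart (ht k), ?_⟩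
  simp only [← lastPart_parity]
  funext i
  simp [lastPart, Finset.sum_apply]

variable (hprod : μ = productLaw (firstMarginal μ) (lastMarginal μ))
include hprod

/-- Independence puts every pair of steps into the support, but both blocks must use the same number
`n` of steps. -/
theorem mem_parityAfter_of_parts {n : ℕ} {g : Fin (r₁ + r₂) → ZMod 2}
    (h1 : firstPart g ∈ parityAfter (firstMarginal μ) n)
    (h2 : lastPart g ∈ parityAfter (lastMarginal μ) n) : g ∈ parityAfter μ n := by
  obtain ⟨t, ht, hgt⟩ := h1
  obtain ⟨s, hs, hgs⟩ := h2
  have hsupp : ∀ k, Fin.append (t k) (s k) ∈ μ.support := fun k => by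
    have := mem_support_map continuous_append measurable_append (mem_support_prod (ht k) (hs k))
    rw [hprod]
    exact this
  refine ⟨fun k => Fin.append (t k) (s k), hsupp, ?_⟩
  rw [← append_parts g, hgt, hgs, ← append_parts (∑ k ∈ _, parity μ _)]
  congr 1
  · funext i
    simp only [firstPart, Finset.sum_apply]
    refine Finset.sum_congr rfl fun k _ => ?_
    have := congrFun (firstPart_parity μ (Fin.append (t k) (s k))) i
    rw [firstPart_append] at this
    exact this.symm
  · funext i
    simp only [lastPart, Finset.sum_apply]
    refine Finset.sum_congr rfl fun k _ => ?_
    have := congrFun (lastPart_parity μ (Fin.append (t k) (s k))) i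
    rw [lastPart_append] at this
    exact this.symm

/-- The last block is the first factor because the Fubini argument fixes its increments first. -/
theorem map_append_incrementLaw :
    ((incrementLaw (lastMarginal μ)).prod (incrementLaw (firstMarginal μ))).map
      (fun p n => (Fin.append (p.2 n) (p.1 n) : Fin (r₁ + r₂) → ℝ)) = incrementLaw μ := by
  have hf : Measurable fun p : (Fin r₂ → ℝ) × (Fin r₁ → ℝ) => Fin.append p.2 p.1 :=
    measurable_append.comp measurable_swap
  have h1 := map_comp_incrementLaw ((lastMarginal μ).prod (firstMarginal μ)) hf
  rw [← map_zip_incrementLaw, Measure.map_map (by fun_prop) (by fun_prop)] at h1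
  have h2 : ((lastMarginal μ).prod (firstMarginal μ)).map
      (fun p : (Fin r₂ → ℝ) × (Fin r₁ → ℝ) => Fin.append p.2 p.1) = μ := by
    conv_rhs => rw [hprod]
    unfold productLaw
    rw [← Measure.prod_swap, Measure.map_map hf measurable_swap]
    rfl
  rw [h2] at h1
  exact h1

variable (hpos : ∀ i, 0 < coordMarginal μ i (Ioi 0))
  (hlat : ∀ i, IsLattice (coordMarginal μ i) → IsNormalizedLattice (coordMarginal μ i))
include hpos hlat

omit hprod hpos in
theorem parts_mem_parityClass {x₀ x : Fin (r₁ + r₂) → ℝ} (hx : x ∈ parityClass μ x₀) :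
    firstPart x ∈ parityClass (firstMarginal μ) (firstPart x₀) ∧
      lastPart x ∈ parityClass (lastMarginal μ) (lastPart x₀) := by
  have hs := (mem_stateSpace_iff_parts μ x).1 hx.1
  obtain ⟨n, hn⟩ := (mem_parityGroup_iff hlat).1 hx.2
  have h1 := firstPart_mem_parityAfter hn
  have h2 := lastPart_mem_parityAfter hn
  refine ⟨⟨hs.1, ?_⟩, ⟨hs.2, ?_⟩⟩
  · refine (mem_parityGroup_iff fun i => ?_).2 ⟨n, ?_⟩
    · rw [coordMarginal_firstMarginal]; exact hlat _
    · rw [← firstPart_parity, ← firstPart_parity]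
      exact h1
  · refine (mem_parityGroup_iff fun i => ?_).2 ⟨n, ?_⟩
    · rw [coordMarginal_lastMarginal]; exact hlat _
    · rw [← lastPart_parity, ← lastPart_parity]
      exact h2

/-- For almost every trajectory of the last block, its visits near `lastPart z` at times of the
right phase form an infinite set. That set is independent of the first block, so
`ae_frequently_mem_times` applies to it as to a deterministic set of times. -/
theorem mem_attractor_of_parts {x₀ z : Fin (r₁ + r₂) → ℝ}
    (hfin : FiniteMeanReturn (firstMarginal μ)
      (attractor (firstMarginal μ) (parityClass (firstMarginal μ) (firstPart x₀))))
    (hz : z ∈ parityClass μ x₀)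
    (hz1 : firstPart z ∈
      attractor (firstMarginal μ) (parityClass (firstMarginal μ) (firstPart x₀)))
    (hz2 : lastPart z ∈
      attractor (lastMarginal μ) (parityClass (lastMarginal μ) (lastPart x₀))) :
    z ∈ attractor μ (parityClass μ x₀) := by
  have hlat1 : ∀ i, IsLattice (coordMarginal (firstMarginal μ) i) →
      IsNormalizedLattice (coordMarginal (firstMarginal μ) i) := fun i => by
    rw [coordMarginal_firstMarginal]; exact hlat _
  have hlat2 : ∀ i, IsLattice (coordMarginal (lastMarginal μ) i) →
      IsNormalizedLattice (coordMarginal (lastMarginal μ) i) := fun i => by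
    rw [coordMarginal_lastMarginal]; exact hlat _
  have hpos1 : ∀ i, 0 < coordMarginal (firstMarginal μ) i (Ioi 0) := fun i => by
    rw [coordMarginal_firstMarginal]; exact hpos _
  have hpos2 : ∀ i, 0 < coordMarginal (lastMarginal μ) i (Ioi 0) := fun i => by
    rw [coordMarginal_lastMarginal]; exact hpos _
  refine ⟨hz, fun U hU hzU x hx => ?_⟩
  obtain ⟨r, hr, hrU⟩ := Metric.isOpen_iff.1 hU _ hzU
  obtain ⟨n, hn⟩ : ∃ n, parity μ z - parity μ x ∈ parityAfter μ n := by
    refine (mem_parityGroup_iff hlat).1 ?_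
    have := sub_mem hz.2 hx.2
    rwa [sub_sub_sub_cancel_right] at this
  have hn1 := firstPart_mem_parityAfter hn
  have hn2 := lastPart_mem_parityAfter hn
  have hx' := parts_mem_parityClass hlat hx
  have key : ∀ᵐ p ∂((incrementLaw (lastMarginal μ)).prod (incrementLaw (firstMarginal μ))),
      ∃ᶠ N in atTop, path (lastPart x) p.1 N ∈ Metric.ball (lastPart z) r ∧
        path (firstPart x) p.2 N ∈ Metric.ball (firstPart z) r := by
    refine (Measure.ae_prod_iff_ae_ae ?_).2 ?_
    · simp only [frequently_atTop, ofPred_forall, ofPred_exists]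
      refine .iInter fun a => .iUnion fun b => (MeasurableSet.const _).inter (.inter ?_ ?_)
      · exact ((measurable_path _ b).comp measurable_fst) measurableSet_ball
      · exact ((measurable_path _ b).comp measurable_snd) measurableSet_ball
    · have h2 := ae_frequently_phase hpos2 hlat2 hz2 hx'.2
        (by rw [← lastPart_parity, ← lastPart_parity]; exact hn2)
        (Metric.isOpen_ball (x := lastPart z) (ε := r)) (Metric.mem_ball_self hr)
      filter_upwards [h2] with y hy
      exact ae_frequently_mem_times hlat1 hpos1 hfin hz1 hx'.1
        (by rw [← firstPart_parity, ← firstPart_parity]; exact hn1)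
        (Metric.isOpen_ball (x := firstPart z) (ε := r)) (Metric.mem_ball_self hr)
        (T := {N | path (lastPart x) y N ∈ Metric.ball (lastPart z) r}) hy
  rw [← map_append_incrementLaw hprod]
  have hm : Measurable fun (p : (ℕ → Fin r₂ → ℝ) × (ℕ → Fin r₁ → ℝ)) n =>
      (Fin.append (p.2 n) (p.1 n) : Fin (r₁ + r₂) → ℝ) :=
    measurable_pi_lambda _ fun n => measurable_append.comp
      (f := fun p : (ℕ → Fin r₂ → ℝ) × (ℕ → Fin r₁ → ℝ) => (p.2 n, p.1 n)) (by fun_prop)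
  refine (ae_map_iff hm.aemeasurable ?_).2 ?_
  · simp only [frequently_atTop, ofPred_forall, ofPred_exists]
    exact .iInter fun a => .iUnion fun b =>
      (MeasurableSet.const _).inter (measurable_path x b hU.measurableSet)
  · filter_upwards [key] with p hp
    refine hp.mono ?_
    rintro N ⟨h2, h1⟩
    refine hrU ((dist_pi_lt_iff hr).2 fun i => ?_)
    have e1 := firstPart_path x (fun n => Fin.append (p.2 n) (p.1 n)) N
    have e2 := lastPart_path x (fun n => Fin.append (p.2 n) (p.1 n)) N
    simp only [firstPart_append, lastPart_append] at e1 e2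
    rw [← e1] at h1
    rw [← e2] at h2
    refine Fin.addCases (fun i => ?_) (fun i => ?_) i
    · exact (dist_le_pi_dist _ _ i).trans_lt h1
    · exact (dist_le_pi_dist _ _ i).trans_lt h2

/-- The product of a positive recurrent and of a null recurrent reflected random walk is null
recurrent. -/
theorem isNullRecurrent_of_parts (hfirst : IsPositiveRecurrent (firstMarginal μ))
    (hlast : IsNullRecurrent (lastMarginal μ)) : IsNullRecurrent μ := by
  intro x₀ hx₀
  have hlat1 : ∀ i, IsLattice (coordMarginal (firstMarginal μ) i) →
      IsNormalizedLattice (coordMarginal (firstMarginal μ) i) := fun i => by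
    rw [coordMarginal_firstMarginal]; exact hlat _
  have hlat2 : ∀ i, IsLattice (coordMarginal (lastMarginal μ) i) →
      IsNormalizedLattice (coordMarginal (lastMarginal μ) i) := fun i => by
    rw [coordMarginal_lastMarginal]; exact hlat _
  have hs := (mem_stateSpace_iff_parts μ x₀).1 hx₀
  obtain ⟨⟨w, hw⟩, hfin⟩ := hfirst _ hs.1
  obtain ⟨⟨z₂, hz₂⟩, hnull⟩ := hlast _ hs.2
  -- every point of the second attractor extends to a point of the attractor
  have hext : ∀ z₂ ∈ attractor (lastMarginal μ) (parityClass (lastMarginal μ) (lastPart x₀)),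
      ∃ z₁ : Fin r₁ → ℝ, Fin.append z₁ z₂ ∈ attractor μ (parityClass μ x₀) := by
    intro z₂ hz₂
    obtain ⟨n, hn⟩ := (mem_parityGroup_iff hlat2).1 hz₂.1.2
    obtain ⟨k, hk⟩ := (mem_parityGroup_iff hlat1).1 hw.1.2
    -- Both parity differences must be attained in a common number of steps. Moving `w` by `n + k`
    -- steps gives `n + 2 * k` for the first block, which has the same parity as the `n` of the
    -- second.
    obtain ⟨s, hs0⟩ := support_nonempty (firstMarginal μ)
    have hpz := parity_path_sub_mem hlat1 hw.1.1 (t := fun _ => s) (fun _ => hs0) (n + k)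
    have hzL := attractor_parityClass_path hlat1 hw (t := fun _ => s) (fun _ => hs0) (n + k)
    set z₁ := path w (fun _ => s) (n + k)
    refine ⟨z₁, mem_attractor_of_parts hprod hpos hlat hfin ⟨?_, ?_⟩ ?_ ?_⟩
    · rw [mem_stateSpace_iff_parts, firstPart_append, lastPart_append]
      exact ⟨hzL.1.1, hz₂.1.1⟩
    · refine (mem_parityGroup_iff hlat).2 ⟨n + k + k, mem_parityAfter_of_parts hprod ?_ ?_⟩
      · have h1 := add_mem_parityAfter hpz hk
        rw [sub_add_sub_cancel] at h1
        have h2 : firstPart (parity μ (Fin.append z₁ z₂) - parity μ x₀) =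
            firstPart (parity μ (Fin.append z₁ z₂)) - firstPart (parity μ x₀) := rfl
        rwa [h2, firstPart_parity, firstPart_parity, firstPart_append]
      · have h2 : lastPart (parity μ (Fin.append z₁ z₂) - parity μ x₀) =
            lastPart (parity μ (Fin.append z₁ z₂)) - lastPart (parity μ x₀) := rfl
        rw [h2, lastPart_parity, lastPart_parity, lastPart_append]
        exact parityAfter_mono (by omega) (by omega) hn
    · rwa [firstPart_append]
    · rwa [lastPart_append]
  refine ⟨?_, fun hfinμ => hnull fun U hU x hx => ?_⟩
  · obtain ⟨z₁, hz₁⟩ := hext z₂ hz₂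
    exact ⟨_, hz₁⟩
  -- The return time to the cylinder over `U` is the return time of the last block to `U`, so a
  -- finite mean would pass to that block.
  · obtain ⟨z₁, hz₁⟩ := hext x hx.2
    have hcont : Continuous (lastPart : (Fin (r₁ + r₂) → ℝ) → Fin r₂ → ℝ) :=
      continuous_pi fun i => continuous_apply _
    have h := hfinμ (lastPart ⁻¹' U) (hU.preimage hcont) (Fin.append z₁ x)
      ⟨by simpa using hx.1, hz₁⟩
    rw [← lintegral_lastPart μ (measurable_returnTime hU.measurableSet x)]
    convert h using 3 with y
    unfold returnTime
    simp only [mem_preimage, lastPart_path, lastPart_append]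

end Product

end ReflectedWalk

namespace ReflectedWalk

/-! ### One-dimensional recurrence -/

section Green

variable (ν : Measure ℝ) [IsProbabilityMeasure ν]

/-- Expected number of visits of reflected random walk to `(-∞, A]`. -/
noncomputable def green (A x : ℝ) : ℝ≥0∞ := ∑' n, incrementLaw ν {ω | absPath x ω n ≤ A}

theorem measurable_absPath_right (x : ℝ) (n : ℕ) : Measurable fun ω : ℕ → ℝ => absPath x ω n :=
  (measurable_absPath n).comp measurable_prodMk_left

theorem measurable_green (A : ℝ) : Measurable (green ν A) := by
  refine Measurable.tsum fun n => ?_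
  exact measurable_measure_prodMk_left (ν := incrementLaw ν)
    (measurableSet_le (measurable_absPath n) measurable_const)

/-- If the walk tends to infinity, then the expected number of visits to a bounded set is
bounded. -/
theorem exists_green_le (h : ∀ᵐ ω ∂(incrementLaw ν), Tendsto (absPath 0 ω) atTop atTop)
    (A : ℝ) : ∃ N : ℕ, ∀ x, 0 ≤ x → green ν A x ≤ 2 * N := by
  have hmeas : ∀ (x B : ℝ) (N n : ℕ),
      MeasurableSet {ω : ℕ → ℝ | ∀ m, N ≤ m → B < absPath x ω (n + m)} := by
    intro x B N n
    have : {ω : ℕ → ℝ | ∀ m, N ≤ m → B < absPath x ω (n + m)} =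
        ⋂ m, ⋂ (_ : N ≤ m), {ω | B < absPath x ω (n + m)} := by ext; simp
    rw [this]
    exact .iInter fun m => .iInter fun _ =>
      measurableSet_lt measurable_const (measurable_absPath_right x _)
  -- A trajectory from a point of `[0, A]` differs by at most `A` from the one from `0`, so
  -- exceeding `2 * A` from `0` means exceeding `A` from there.
  have hlim : Tendsto (fun N : ℕ => incrementLaw ν {ω | ∀ m, N ≤ m → 2 * A < absPath 0 ω (0 + m)})
      atTop (𝓝 1) := by
    have h1 : incrementLaw ν (⋃ N : ℕ, {ω | ∀ m, N ≤ m → 2 * A < absPath 0 ω (0 + m)}) = 1 := by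
      rw [← prob_compl_eq_zero_iff (.iUnion fun N => hmeas 0 (2 * A) N 0),
        measure_eq_zero_iff_ae_notMem]
      filter_upwards [h] with ω hω hmem
      obtain ⟨N, hN⟩ := eventually_atTop.1 (hω.eventually_gt_atTop (2 * A))
      exact hmem (mem_iUnion.2 ⟨N, fun m hm => by rw [zero_add]; exact hN m hm⟩)
    rw [← h1]
    refine tendsto_measure_iUnion_atTop fun N M hNM ω hω m hm => hω m (hNM.trans hm)
  obtain ⟨N, hN⟩ := (hlim.eventually (lt_mem_nhds (by norm_num : (1 / 2 : ℝ≥0∞) < 1))).exists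
  refine ⟨N, fun x hx => ?_⟩
  set D : ℕ → Set (ℕ → ℝ) := fun n =>
    {ω | absPath x ω n ≤ A ∧ ∀ m, N ≤ m → A < absPath x ω (n + m)}
  have hDm : ∀ n, MeasurableSet (D n) := fun n =>
    (measurableSet_le (measurable_absPath_right x n) measurable_const).inter (hmeas x A N n)
  -- each visit is followed by a last visit within `N` steps with probability at least `1/2`
  have hD : ∀ n, 1 / 2 * incrementLaw ν {ω | absPath x ω n ≤ A} ≤ incrementLaw ν (D n) := by
    intro n
    have hmn : MeasurableSet {ω : ℕ → ℝ | absPath x ω n ≤ A} :=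
      measurableSet_le (measurable_absPath_right x n) measurable_const
    rw [measure_splice ν n (hDm n), ← lintegral_indicator_const hmn]
    refine lintegral_mono fun ω => ?_
    by_cases hω : absPath x ω n ≤ A
    · rw [indicator_of_mem (by exact hω)]
      refine hN.le.trans (measure_mono fun η hη => ⟨?_, fun m hm => ?_⟩)
      · rwa [absPath_splice_of_le _ _ _ le_rfl]
      · rw [absPath_splice_add]
        have h1 := hη m hm
        rw [zero_add] at h1
        have h2 := (abs_le.1 (abs_absPath_sub_le (absPath x ω n) 0 η m)).1
        rw [sub_zero, abs_of_nonneg (absPath_nonneg hx ω n)] at h2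
        linarith
    · rw [indicator_of_notMem (by exact hω)]
      exact zero_le
  -- At most `N` of the events occur together: after the first one, at `n₀`, there is no visit from
  -- time `n₀ + N` on.
  have hsum : ∑' n, incrementLaw ν (D n) ≤ N := by
    calc ∑' n, incrementLaw ν (D n)
        = ∫⁻ ω, ∑' n, (D n).indicator (fun _ => (1 : ℝ≥0∞)) ω ∂(incrementLaw ν) := by
          rw [lintegral_tsum fun n => (measurable_const.indicator (hDm n)).aemeasurable]
          congr 1
          funext n
          exact (lintegral_indicator_one (hDm n)).symm
      _ ≤ ∫⁻ _, N ∂(incrementLaw ν) := by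
          refine lintegral_mono fun ω => ?_
          by_cases hex : ∃ n, ω ∈ D n
          · classical
            have hspec := Nat.find_spec hex
            have hmin := fun m => Nat.find_min hex (m := m)
            set n₀ := Nat.find hex
            have h0 : ∀ n ∉ Finset.Ico n₀ (n₀ + N),
                (D n).indicator (fun _ => (1 : ℝ≥0∞)) ω = 0 := by
              intro n hn
              refine indicator_of_notMem (fun hmem => hn ?_) _
              rw [Finset.mem_Ico]
              by_contra hcon
              rcases lt_or_ge n n₀ with hlt | hge
              · exact hmin n hlt hmem
              · obtain ⟨m, rfl⟩ : ∃ m, n = n₀ + m := ⟨n - n₀, by omega⟩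
                exact absurd hmem.1 (not_le.2 (hspec.2 m (by omega)))
            show ∑' n, (D n).indicator (fun _ => (1 : ℝ≥0∞)) ω ≤ N
            rw [tsum_eq_sum h0]
            refine (Finset.sum_le_card_nsmul _ _ 1
              fun j _ => indicator_le_self' (by simp) ω).trans ?_
            simp
          · push Not at hex
            simp [hex]
      _ = N := by simp
  have h3 : 1 / 2 * green ν A x ≤ N := by
    unfold green
    rw [← ENNReal.tsum_mul_left]
    exact (ENNReal.tsum_le_tsum hD).trans hsum
  calc green ν A x = 2 * (1 / 2 * green ν A x) := by
        rw [← mul_assoc, one_div, ENNReal.mul_inv_cancel (by simp) (by simp), one_mul]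
    _ ≤ 2 * N := by gcongr

/-- If the expected number of visits to a bounded set is unbounded, then the walk does not tend to
infinity. -/
theorem ae_not_tendsto_of_green {A : ℝ}
    (h : ∀ M : ℝ≥0∞, M ≠ ∞ → ∃ x, 0 ≤ x ∧ M < green ν A x) :
    ∀ᵐ ω ∂(incrementLaw ν), ¬ Tendsto (absPath 0 ω) atTop atTop := by
  set B : Set (ℕ → ℝ) := {ω | Tendsto (absPath 0 ω) atTop atTop}
  have hBm : MeasurableSet B :=
    measurableSet_tendsto atTop fun n => measurable_absPath_right 0 n
  -- A prefix shifts the later trajectory by a bounded amount, so divergence is a tail event and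
  -- obeys the zero-one law.
  have hinv : ∀ n ω η, splice n ω η ∈ B ↔ η ∈ B := by
    intro n ω η
    have hle : ∀ m, |absPath 0 (splice n ω η) (m + n) - absPath 0 η m| ≤ absPath 0 ω n := by
      intro m
      rw [add_comm, absPath_splice_add]
      refine (abs_absPath_sub_le _ _ _ _).trans ?_
      rw [sub_zero, abs_of_nonneg (absPath_nonneg le_rfl ω n)]
    show Tendsto _ _ _ ↔ Tendsto _ _ _
    rw [← tendsto_add_atTop_iff_nat n]
    constructor <;> intro ht
    · refine tendsto_atTop_mono (fun m => ?_) (tendsto_atTop_add_const_right _ (-absPath 0 ω n) ht)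
      linarith [(abs_le.1 (hle m)).2]
    · refine tendsto_atTop_mono (fun m => ?_) (tendsto_atTop_add_const_right _ (-absPath 0 ω n) ht)
      linarith [(abs_le.1 (hle m)).1]
  rcases measure_eq_zero_or_one_of_splice ν hBm hinv with h0 | h1
  · exact measure_eq_zero_iff_ae_notMem.1 h0
  · exfalso
    rw [← prob_compl_eq_zero_iff hBm, measure_eq_zero_iff_ae_notMem] at h1
    obtain ⟨N, hN⟩ := exists_green_le ν (h1.mono fun ω hω => not_not.1 hω) A
    obtain ⟨x, hx, hlt⟩ := h (2 * N) (ENNReal.mul_ne_top (by simp) (by simp))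
    exact absurd (hN x hx) (not_le.2 hlt)

end Green

/-! ### From not tending to infinity to recurrence at the origin -/

section OneDim

variable {μ : Measure (Fin 1 → ℝ)} [IsProbabilityMeasure μ]

instance isProbabilityMeasure_coordMarginal {d : ℕ} (μ : Measure (Fin d → ℝ))
    [IsProbabilityMeasure μ] (i : Fin d) : IsProbabilityMeasure (coordMarginal μ i) :=
  Measure.isProbabilityMeasure_map (measurable_pi_apply i).aemeasurable

variable (μ) in
theorem map_coord_incrementLaw :
    (incrementLaw μ).map (fun y k => y k 0) = incrementLaw (coordMarginal μ 0) :=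
  map_comp_incrementLaw μ (measurable_pi_apply 0)

variable (μ) in
theorem ae_coord {p : (ℕ → ℝ) → Prop} (h : ∀ᵐ ω ∂(incrementLaw (coordMarginal μ 0)), p ω) :
    ∀ᵐ y ∂(incrementLaw μ), p fun k => y k 0 := by
  rw [← map_coord_incrementLaw] at h
  exact ae_of_ae_map (Measurable.aemeasurable (by fun_prop)) h

variable (hpos : ∀ i, 0 < coordMarginal μ i (Ioi 0))
  (hlat : ∀ i, IsLattice (coordMarginal μ i) → IsNormalizedLattice (coordMarginal μ i))
include hpos hlat

theorem exists_path_apply_lt {x : Fin 1 → ℝ} (hx : x ∈ stateSpace μ) {r : ℝ} (hr : 0 < r) :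
    ∃ (t : ℕ → Fin 1 → ℝ) (n : ℕ), (∀ k, t k ∈ μ.support) ∧ path x t n 0 < r := by
  obtain ⟨s, hs, hs0⟩ := exists_support_pos hpos 0
  have hx0 : x 0 ∈ (AddSubgroup.closure (coordMarginal μ 0).support).topologicalClosure := by
    by_cases hi : IsLattice (coordMarginal μ 0)
    · obtain ⟨k, hk⟩ := exists_int_of_mem_stateSpace hx 0 hi
      rw [hk]
      exact AddSubgroup.le_topologicalClosure _ (intCast_mem_closure_support (hlat 0 hi) k)
    · exact mem_topologicalClosure_of_not_isLattice hi hs hs0 _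
  obtain ⟨v, hv, -, hvr⟩ := exists_reach_near_zero hs hs0 (hx 0).1 hx0 (half_pos hr)
  obtain ⟨t, n, ht, rfl⟩ := hv.exists_absPath hs
  set δ := r / (2 * (n + 1))
  have hδ : 0 < δ := by positivity
  choose w hw hwt using fun k => exists_mem_support_apply_near μ (ht k) hδ
  refine ⟨w, n, hw, ?_⟩
  have h1 : |absPath (x 0) (fun k => w k 0) n - absPath (x 0) t n| ≤ n * δ := by
    refine (abs_absPath_sub_le_sum _ _ _ _).trans ?_
    refine (Finset.sum_le_card_nsmul _ _ δ fun k _ => (hwt k).le).trans ?_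
    simp
  have h2 : (n + 1 : ℝ) * δ = r / 2 := by simp only [δ]; field_simp
  rw [path_apply]
  linarith [(abs_le.1 h1).2]

/-- A walk that does not tend to infinity visits every neighbourhood of the origin infinitely
often. -/
theorem ae_frequently_near_zero
    (h : ∀ᵐ ω ∂(incrementLaw (coordMarginal μ 0)), ¬ Tendsto (absPath 0 ω) atTop atTop)
    {x : Fin 1 → ℝ} (hx : x ∈ stateSpace μ) {r : ℝ} (hr : 0 < r) :
    ∀ᵐ y ∂(incrementLaw μ), ∃ᶠ n in atTop, path x y n 0 < r := by
  have key : ∀ A : ℕ, ∀ᵐ y ∂(incrementLaw μ),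
      (∃ᶠ n in atTop, path x y n ∈ stateSpace μ ∧ path x y n 0 ≤ A) →
        ∃ᶠ n in atTop, path x y n 0 < r := by
    intro A
    set K : Set (Fin 1 → ℝ) := {v | v ∈ stateSpace μ ∧ v 0 ≤ A}
    have htb : TotallyBounded K := by
      refine (isCompact_closedBall (0 : Fin 1 → ℝ) A).totallyBounded.subset fun v hv => ?_
      rw [mem_closedBall_zero_iff, pi_norm_le_iff_of_nonneg (Nat.cast_nonneg A)]
      intro i
      rw [Subsingleton.elim i 0, Real.norm_of_nonneg (hv.1 0).1]
      exact hv.2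
    obtain ⟨F, hFsub, hFfin, hF⟩ :=
      totallyBounded_iff_subset.1 htb _ (Metric.dist_mem_uniformity (by positivity : 0 < r / 4))
    -- A route from `u` towards the origin also serves all nearby states, so a finite net of `K`
    -- yields one lower bound for all states up to `A`.
    have hctl : ∀ u : Fin 1 → ℝ, ∃ c : ℝ≥0∞, 0 < c ∧ (u ∈ K → ∀ v, dist v u < r / 4 →
        c ≤ incrementLaw μ {y | ∃ k, path v y k 0 < r}) := by
      intro u
      by_cases hu : u ∈ K
      · obtain ⟨t, n, ht, htn⟩ := exists_path_apply_lt hpos hlat hu.1 (half_pos hr)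
        obtain ⟨Q, -, hQ0, hQ⟩ := exists_control μ ht n (r := r / 4) (by positivity)
        refine ⟨_, hQ0, fun _ v hv => measure_mono fun y hy => ⟨n, ?_⟩⟩
        have h1 := (dist_le_pi_dist _ _ 0).trans_lt (hQ y hy u)
        have h2 := (dist_le_pi_dist _ _ 0).trans (dist_path_le v u y n)
        rw [Real.dist_eq] at h1 h2
        linarith [(abs_lt.1 h1).2, (abs_le.1 h2).2]
      · exact ⟨1, one_pos, fun h => absurd h hu⟩
    choose c hc hcv using hctl
    rcases F.eq_empty_or_nonempty with hFe | hFne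
    · refine .of_forall fun y hy => ?_
      obtain ⟨n, hn⟩ := hy.exists
      have := hF (show path x y n ∈ K from hn)
      simp [hFe] at this
    · refine ae_frequently_imp_frequently (Q := fun _ v => v ∈ stateSpace μ ∧ v 0 ≤ A)
        (R := fun _ v => v 0 < r) (fun n => measurableSet_lt (measurable_pi_apply 0)
          measurable_const) (c := hFfin.toFinset.inf c) ?_ ?_
      · rw [Finset.lt_inf_iff ENNReal.zero_lt_top]
        exact fun u _ => hc u
      · rintro n v hv
        obtain ⟨u, huF, huv⟩ := mem_iUnion₂.1 (hF (show v ∈ K from hv))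
        exact (Finset.inf_le (hFfin.mem_toFinset.2 huF)).trans (hcv u (hFsub huF) v huv)
  filter_upwards [ae_all_iff.2 key, ae_coord μ h, ae_forall_mem_support μ] with y hy hnt hys
  have h1 : ∃ A : ℕ, ∃ᶠ n in atTop, path x y n 0 ≤ A := by
    by_contra! hcon
    refine hnt (tendsto_atTop.2 fun b => ?_)
    obtain ⟨A, hA⟩ := exists_nat_ge (b + x 0)
    have h2 := hcon A
    filter_upwards [h2] with n hn
    rw [path_apply] at hn
    have h3 := (abs_le.1 (abs_absPath_sub_le (x 0) 0 (fun k => y k 0) n)).2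
    rw [sub_zero, abs_of_nonneg (hx 0).1] at h3
    linarith
  obtain ⟨A, hA⟩ := h1
  exact hy A (hA.mono fun n hn => ⟨path_mem_stateSpace hlat hx hys n, hn⟩)

-- In dimension one there is a single class: in the lattice case the support, having gcd `1`,
-- contains an odd number, and so the parity group is everything.
omit hpos in
theorem mem_parityClass_one_dim {x₀ x : Fin 1 → ℝ} (hx : x ∈ stateSpace μ) :
    x ∈ parityClass μ x₀ := by
  refine ⟨hx, ?_⟩
  have hsub : ∀ g h : Fin 1 → ZMod 2, g = 0 ∨ h = 0 ∨ g = h := by decide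
  by_cases hi : IsLattice (coordMarginal μ 0)
  · obtain ⟨t, ht, hodd⟩ : ∃ t ∈ μ.support, parity μ t ≠ 0 := by
      by_contra! hcon
      have h2 := (hlat 0 hi).2 2 fun y hy => ?_
      · omega
      · obtain ⟨k, rfl⟩ := (hlat 0 hi).1 y hy
        obtain ⟨t, ht, hty⟩ := exists_mem_support_apply_near μ hy one_pos
        obtain ⟨m, hm⟩ := exists_int_of_mem_support hlat ht hi
        have h3 : m = k := by
          rw [hm] at hty
          have : |m - k| < 1 := by exact_mod_cast hty
          exact sub_eq_zero.1 (Int.abs_lt_one_iff.1 this)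
        have h4 := congrFun (hcon t ht) 0
        simp only [parity, if_pos hi, hm, Int.floor_intCast, Pi.zero_apply] at h4
        rw [ZMod.intCast_zmod_eq_zero_iff_dvd] at h4
        obtain ⟨c, hc⟩ := h4
        refine ⟨c, ?_⟩
        rw [← h3, hc]
        push_cast
        ring
    have hmem : parity μ t ∈ parityGroup μ :=
      AddSubgroup.subset_closure ((measure_parity_pos_iff hlat).2 ⟨t, ht, rfl⟩)
    rcases hsub (parity μ t) (parity μ x - parity μ x₀) with h | h | h
    · exact absurd h hodd
    · rw [h]; exact zero_mem _
    · rwa [← h]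
  · have : parity μ x - parity μ x₀ = 0 := by
      funext i
      rw [Subsingleton.elim i 0]
      simp [parity, hi]
    rw [this]
    exact zero_mem _

theorem zero_mem_attractor
    (h : ∀ᵐ ω ∂(incrementLaw (coordMarginal μ 0)), ¬ Tendsto (absPath 0 ω) atTop atTop)
    (x₀ : Fin 1 → ℝ) : 0 ∈ attractor μ (parityClass μ x₀) := by
  have h0 : (0 : Fin 1 → ℝ) ∈ stateSpace μ := fun i => ⟨le_rfl, fun _ => ⟨0, by simp⟩⟩
  refine ⟨mem_parityClass_one_dim hlat h0, fun U hU hzU x hx => ?_⟩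
  obtain ⟨r, hr, hrU⟩ := Metric.isOpen_iff.1 hU _ hzU
  filter_upwards [ae_frequently_near_zero hpos hlat h hx.1 hr] with y hy
  refine hy.mono fun n hn => hrU ((dist_pi_lt_iff hr).2 fun i => ?_)
  rw [Subsingleton.elim i 0, Real.dist_eq, Pi.zero_apply, sub_zero, path_apply,
    abs_of_nonneg (absPath_nonneg (hx.1 0).1 _ _), ← path_apply]
  exact hn

end OneDim

end ReflectedWalk

namespace ReflectedWalk

/-! ### Infinite mean return times -/

section ReturnTimes

/-- The increments for which the walk from the origin does not enter `(-∞, r)` during the times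
`1, …, j`. -/
def stay (r : ℝ) (j : ℕ) : Set (ℕ → ℝ) := {ω | ∀ n, 1 ≤ n → n ≤ j → r ≤ absPath 0 ω n}

theorem measurableSet_stay (r : ℝ) (j : ℕ) : MeasurableSet (stay r j) := by
  unfold stay
  simp only [ofPred_forall]
  exact .iInter fun n => .iInter fun _ => .iInter fun _ =>
    measurableSet_le measurable_const (measurable_absPath_right 0 n)

theorem splice_mem_stay (r : ℝ) (j : ℕ) (ω η : ℕ → ℝ) :
    splice j ω η ∈ stay r j ↔ ω ∈ stay r j := by
  refine forall_congr' fun n => forall_congr' fun _ => forall_congr' fun hn => ?_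
  rw [absPath_splice_of_le _ _ _ hn]

theorem stay_anti (r : ℝ) : Antitone (stay r) := fun _ _ hij _ hω n h1 hn =>
  hω n h1 (hn.trans hij)

/-- The indicator of `stay`, in the extended non-negative reals. -/
noncomputable def stayInd (r : ℝ) (j : ℕ) : (ℕ → ℝ) → ℝ≥0∞ := (stay r j).indicator 1

theorem measurable_stayInd (r : ℝ) (j : ℕ) : Measurable (stayInd r j) :=
  measurable_one.indicator (measurableSet_stay r j)

theorem stayInd_splice (r : ℝ) (j : ℕ) (ω η : ℕ → ℝ) :
    stayInd r j (splice j ω η) = stayInd r j ω := by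
  by_cases h : ω ∈ stay r j
  · rw [stayInd, indicator_of_mem h, indicator_of_mem ((splice_mem_stay r j ω η).2 h)]
    rfl
  · rw [stayInd, indicator_of_notMem h, indicator_of_notMem (mt (splice_mem_stay r j ω η).1 h)]

/-- With `R` the first return, `stayInd r k` is one exactly for `k < R`. Sums up to the random time
`R` thus become series to which independence applies term by term. -/
theorem exists_first_return {r : ℝ} {ω : ℕ → ℝ} (h : ∃ j, ω ∉ stay r j) :
    ∃ R : ℕ, 1 ≤ R ∧ absPath 0 ω R < r ∧
      ∀ g : ℕ → ℝ≥0∞, ∑' k, stayInd r k ω * g k = ∑ k ∈ Finset.range R, g k := by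
  classical
  have hspec := Nat.find_spec h
  have hmin := fun m => Nat.find_min h (m := m)
  set R := Nat.find h
  have hR : 1 ≤ R := by
    by_contra hR
    exact hspec fun n h1 hn => by omega
  refine ⟨R, hR, ?_, fun g => ?_⟩
  · by_contra hcon
    refine hspec fun n h1 hn => ?_
    rcases hn.lt_or_eq with hlt | rfl
    · exact not_not.1 (hmin n hlt) n h1 le_rfl
    · exact not_lt.1 hcon
  · rw [tsum_eq_sum (s := Finset.range R)]
    · refine Finset.sum_congr rfl fun k hk => ?_
      rw [stayInd, indicator_of_mem (not_not.1 (hmin k (Finset.mem_range.1 hk))), Pi.one_apply,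
        one_mul]
    · intro k hk
      rw [stayInd, indicator_of_notMem, zero_mul]
      exact fun hmem => hspec (stay_anti r (by simpa using hk) hmem)

variable (ν : Measure ℝ) [IsProbabilityMeasure ν]

theorem ae_exists_notMem_stay {r : ℝ} (h : ∑' j, incrementLaw ν (stay r j) ≠ ∞) :
    ∀ᵐ ω ∂(incrementLaw ν), ∃ j, ω ∉ stay r j := by
  have h0 : incrementLaw ν (⋂ j, stay r j) = 0 := by
    by_contra hne
    refine h (top_unique ?_)
    rw [← ENNReal.tsum_const_eq_top_of_ne_zero (α := ℕ) hne]
    exact ENNReal.tsum_le_tsum fun j => measure_mono (iInter_subset _ j)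
  filter_upwards [measure_eq_zero_iff_ae_notMem.1 h0] with ω hω
  simpa using hω

/-- Wald's identity: `stayInd r k` depends only on the increments before `ω k`. -/
theorem lintegral_tsum_stayInd_mul (r : ℝ) {f : ℝ → ℝ≥0∞} (hf : Measurable f) :
    ∫⁻ ω, ∑' k, stayInd r k ω * f (ω k) ∂(incrementLaw ν) =
      (∑' k, incrementLaw ν (stay r k)) * ∫⁻ t, f t ∂ν := by
  have hm : ∀ k, Measurable fun ω : ℕ → ℝ => stayInd r k ω * f (ω k) := fun k =>
    (measurable_stayInd r k).mul (hf.comp (measurable_pi_apply k))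
  rw [lintegral_tsum fun k => (hm k).aemeasurable, ← ENNReal.tsum_mul_right]
  congr 1
  funext k
  rw [lintegral_mul_apply ν k (measurable_stayInd r k) (stayInd_splice r k) hf]
  congr 1
  exact lintegral_indicator_one (measurableSet_stay r k)

/-- Every step satisfies `|x - y| ≥ x - y`, and the first step from the origin gains exactly twice
the positive part of `ω 0`. This gain is what unbalances centred increments. -/
theorem sub_sum_le_absPath (ω : ℕ → ℝ) {n : ℕ} (hn : 1 ≤ n) :
    2 * max (ω 0) 0 - ∑ k ∈ Finset.range n, ω k ≤ absPath 0 ω n := by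
  induction n, hn using Nat.le_induction with
  | base =>
    simp only [Finset.sum_range_one, absPath, zero_sub, abs_neg]
    rcases le_total 0 (ω 0) with h | h
    · rw [max_eq_left h, abs_of_nonneg h]; linarith
    · rw [max_eq_right h, abs_of_nonpos h]; linarith
  | succ n hn ih =>
    rw [Finset.sum_range_succ]
    have := le_abs_self (absPath 0 ω n - ω n)
    simp only [absPath]
    linarith

/-- If the increments are centred, then the mean return time is infinite. -/
theorem tsum_stay_eq_top_of_mean_eq {r : ℝ} (h : meanNeg ν = meanPos ν) (hfin : meanPos ν ≠ ∞)
    (hr : ENNReal.ofReal r < 2 * meanPos ν) : ∑' j, incrementLaw ν (stay r j) = ∞ := by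
  by_contra hne
  have hm : Measurable fun t : ℝ => ENNReal.ofReal (max t 0) := by fun_prop
  have hm' : Measurable fun t : ℝ => ENNReal.ofReal (max (-t) 0) := by fun_prop
  -- The pathwise bound at the first return, rearranged into non-negative terms. After integration
  -- the two Wald sums agree and cancel, leaving `2 * meanPos ν ≤ r`.
  have hle : ∀ᵐ ω ∂(incrementLaw ν),
      ∑' k, stayInd r k ω * ENNReal.ofReal (max (-ω k) 0) + 2 * ENNReal.ofReal (max (ω 0) 0) ≤
        ∑' k, stayInd r k ω * ENNReal.ofReal (max (ω k) 0) + ENNReal.ofReal r := by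
    filter_upwards [ae_exists_notMem_stay ν hne] with ω hω
    obtain ⟨R, hR1, hRr, hR⟩ := exists_first_return hω
    rw [hR, hR, ← ENNReal.ofReal_sum_of_nonneg (fun _ _ => le_max_right _ _),
      ← ENNReal.ofReal_sum_of_nonneg (fun _ _ => le_max_right _ _),
      show (2 : ℝ≥0∞) = ENNReal.ofReal 2 by simp, ← ENNReal.ofReal_mul (by norm_num),
      ← ENNReal.ofReal_add (Finset.sum_nonneg fun _ _ => le_max_right _ _)
        (mul_nonneg (by norm_num) (le_max_right _ _)),
      ← ENNReal.ofReal_add (Finset.sum_nonneg fun _ _ => le_max_right _ _)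
        ((absPath_nonneg le_rfl ω R).trans hRr.le)]
    refine ENNReal.ofReal_le_ofReal ?_
    have h1 := sub_sum_le_absPath ω hR1
    have h2 : ∑ k ∈ Finset.range R, ω k =
        ∑ k ∈ Finset.range R, max (ω k) 0 - ∑ k ∈ Finset.range R, max (-ω k) 0 := by
      rw [← Finset.sum_sub_distrib]
      refine Finset.sum_congr rfl fun k _ => ?_
      rcases le_total 0 (ω k) with h | h
      · rw [max_eq_left h, max_eq_right (by linarith)]; ring
      · rw [max_eq_right h, max_eq_left (by linarith)]; ring
    linarith
  have h3 := lintegral_mono_ae hle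
  rw [lintegral_add_right _ (by fun_prop), lintegral_add_right _ measurable_const,
    lintegral_tsum_stayInd_mul ν r hm, lintegral_tsum_stayInd_mul ν r hm',
    lintegral_const_mul _ (by fun_prop), lintegral_apply ν 0 hm, lintegral_const, measure_univ,
    mul_one] at h3
  change _ * meanNeg ν + 2 * meanPos ν ≤ _ * meanPos ν + _ at h3
  rw [h, ENNReal.add_le_add_iff_left (ENNReal.mul_ne_top hne hfin)] at h3
  exact absurd h3 (not_le.2 hr)

/-- A later step lowers the walk by at most its positive part, so a large first jump must be made up
for by later positive parts before a return. -/
theorem le_add_sum_absPath (ω : ℕ → ℝ) {n : ℕ} (hn : 1 ≤ n) :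
    ω 0 ≤ absPath 0 ω n + ∑ k ∈ Finset.range n, (if k = 0 then 0 else max (ω k) 0) := by
  induction n, hn using Nat.le_induction with
  | base => simpa [absPath] using le_abs_self (ω 0)
  | succ n hn ih =>
    rw [Finset.sum_range_succ, if_neg (by omega)]
    have := le_abs_self (absPath 0 ω n - ω n)
    have := le_max_left (ω n) 0
    simp only [absPath]
    linarith

theorem min_sum_le {ι : Type*} (s : Finset ι) (f : ι → ℝ≥0∞) (K : ℝ≥0∞) :
    min (∑ i ∈ s, f i) K ≤ ∑ i ∈ s, min (f i) K := by
  classical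
  induction s using Finset.induction_on with
  | empty => simp
  | insert a s ha ih =>
    rw [Finset.sum_insert ha, Finset.sum_insert ha]
    refine le_trans ?_ (add_le_add_right ih _)
    rcases le_total (f a) K with h1 | h1
    · rcases le_total (∑ i ∈ s, f i) K with h2 | h2
      · rw [min_eq_left h1, min_eq_left h2]; exact min_le_left _ _
      · rw [min_eq_left h1, min_eq_right h2]
        exact (min_le_right _ _).trans le_add_self
    · rw [min_eq_right h1]
      exact (min_le_right _ _).trans le_self_add

/-- If the positive part of the increments has infinite mean, then the mean return time is
infinite. -/
theorem tsum_stay_eq_top_of_meanPos (h : meanPos ν = ∞) :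
    ∑' j, incrementLaw ν (stay 1 j) = ∞ := by
  by_contra hne
  -- Truncation keeps the means finite, so that they can be subtracted; the bound in `hK` is
  -- independent of the truncation level.
  set f : ℕ → ℝ → ℝ≥0∞ := fun K t => min (ENNReal.ofReal (max t 0)) K
  have hf : ∀ K, Measurable (f K) := fun K => by fun_prop
  set s : ℕ → Set (ℕ → ℝ) := fun A => {ω | (A : ℝ) + 1 < ω 0}
  have hs : ∀ A, MeasurableSet (s A) := fun A =>
    measurableSet_lt measurable_const (measurable_pi_apply 0)
  have hsA : Tendsto (incrementLaw ν ∘ s) atTop (𝓝 0) := by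
    have h1 : ⋂ A, s A = ∅ := by
      refine eq_empty_iff_forall_notMem.2 fun ω hω => ?_
      obtain ⟨A, hA⟩ := exists_nat_gt (ω 0)
      have h2 : (A : ℝ) + 1 < ω 0 := mem_iInter.1 hω A
      linarith
    rw [← measure_empty (μ := incrementLaw ν), ← h1]
    refine tendsto_measure_iInter_atTop (fun A => (hs A).nullMeasurableSet)
      (fun A B hAB ω hω => ?_) ⟨0, measure_ne_top _ _⟩
    have h3 : (A : ℝ) ≤ B := by exact_mod_cast hAB
    have h4 : (B : ℝ) + 1 < ω 0 := hω
    show (A : ℝ) + 1 < ω 0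
    linarith
  set g : (ℕ → ℝ) → ℝ≥0∞ := fun ω => ∑' k, stayInd 1 k ω
  have hgm : Measurable g := Measurable.tsum fun k => measurable_stayInd 1 k
  have hg : ∫⁻ ω, g ω ∂(incrementLaw ν) ≠ ∞ := by
    have := lintegral_tsum_stayInd_mul ν 1 (measurable_const (a := (1 : ℝ≥0∞)))
    simp only [mul_one, lintegral_const, measure_univ] at this
    rwa [this]
  -- An integrable return time contributes less than `1 / 2` over first jumps above `A + 1`. By
  -- Wald, the truncated mean `M` then satisfies `M ≤ (A + 2) + M / 2`.
  obtain ⟨A, hA⟩ := ((tendsto_setLIntegral_zero hg hsA).eventually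
    (gt_mem_nhds (by simp : (0 : ℝ≥0∞) < 1 / 2))).exists
  -- the bound for truncated means
  have hK : ∀ K : ℕ, ∫⁻ t, f K t ∂ν ≤ 2 * (A + 2) := by
    intro K
    have hfin : ∫⁻ t, f K t ∂ν ≠ ∞ := by
      refine ne_top_of_le_ne_top (ENNReal.natCast_ne_top K) ?_
      refine (lintegral_mono fun t => min_le_right _ _).trans ?_
      simp
    have hle : ∀ᵐ ω ∂(incrementLaw ν), f K (ω 0) ≤
        (A + 2) + ∑' k, ((s A).indicator 1 ω * (if k = 0 then 0 else stayInd 1 k ω)) *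
          f K (ω k) := by
      filter_upwards [ae_exists_notMem_stay ν hne] with ω hω
      by_cases hωs : ω ∈ s A
      · obtain ⟨R, hR1, hRr, hR⟩ := exists_first_return hω
        have h1 : ∑' k, ((s A).indicator (1 : (ℕ → ℝ) → ℝ≥0∞) ω *
            (if k = 0 then 0 else stayInd 1 k ω)) * f K (ω k) =
            ∑ k ∈ Finset.range R, if k = 0 then 0 else f K (ω k) := by
          rw [← hR]
          congr 1
          funext k
          rw [indicator_of_mem hωs, Pi.one_apply, one_mul]
          split_ifs <;> simp
        rw [h1]
        have h2 : ENNReal.ofReal (max (ω 0) 0) ≤ 1 + ∑ k ∈ Finset.range R,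
            if k = 0 then 0 else ENNReal.ofReal (max (ω k) 0) := by
          have h3 : ∀ k, (if k = 0 then 0 else ENNReal.ofReal (max (ω k) 0)) =
              ENNReal.ofReal (if k = 0 then 0 else max (ω k) 0) := by
            intro k; split_ifs <;> simp
          have h4 : ∀ k ∈ Finset.range R, 0 ≤ (if k = 0 then 0 else max (ω k) 0) := by
            intro k _
            split_ifs
            · exact le_rfl
            · exact le_max_right _ _
          simp only [h3]
          rw [← ENNReal.ofReal_sum_of_nonneg h4, ← ENNReal.ofReal_one,
            ← ENNReal.ofReal_add zero_le_one (Finset.sum_nonneg h4)]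
          refine ENNReal.ofReal_le_ofReal (max_le ?_ ?_)
          · linarith [le_add_sum_absPath ω hR1]
          · linarith [Finset.sum_nonneg h4]
        calc f K (ω 0) ≤ min (1 + ∑ k ∈ Finset.range R,
              if k = 0 then 0 else ENNReal.ofReal (max (ω k) 0)) K := min_le_min_right _ h2
          _ ≤ 1 + min (∑ k ∈ Finset.range R,
              if k = 0 then 0 else ENNReal.ofReal (max (ω k) 0)) K := by
            rcases le_total (∑ k ∈ Finset.range R,
              if k = 0 then 0 else ENNReal.ofReal (max (ω k) 0)) (K : ℝ≥0∞) with h | h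
            · rw [min_eq_left h]; exact min_le_left _ _
            · rw [min_eq_right h]; exact (min_le_right _ _).trans le_add_self
          _ ≤ (A + 2) + ∑ k ∈ Finset.range R, if k = 0 then 0 else f K (ω k) := by
            refine add_le_add ?_ ((min_sum_le _ _ _).trans_eq ?_)
            · exact le_trans (by norm_num) (le_add_self (a := (2 : ℝ≥0∞)))
            · refine Finset.sum_congr rfl fun k _ => ?_
              split_ifs <;> simp [f]
      · refine le_add_right ((min_le_left _ _).trans ?_)
        have h1 : ω 0 ≤ (A : ℝ) + 1 := not_lt.1 hωs
        have h2 : max (ω 0) 0 ≤ ((A + 2 : ℕ) : ℝ) :=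
          max_le (by push_cast; linarith) (by positivity)
        calc ENNReal.ofReal (max (ω 0) 0) ≤ ENNReal.ofReal ((A + 2 : ℕ) : ℝ) :=
              ENNReal.ofReal_le_ofReal h2
          _ = A + 2 := by rw [ENNReal.ofReal_natCast]; push_cast; rfl
    have h1 := lintegral_mono_ae hle
    have hmk : ∀ k, Measurable fun ω : ℕ → ℝ =>
        (s A).indicator (1 : (ℕ → ℝ) → ℝ≥0∞) ω * (if k = 0 then 0 else stayInd 1 k ω) := by
      intro k
      refine (measurable_one.indicator (hs A)).mul ?_
      split_ifs
      · exact measurable_const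
      · exact measurable_stayInd 1 k
    -- The event `s A` is determined by `ω 0`; with the term `k = 0` removed, the weight always
    -- precedes `ω k`.
    have h2 : ∀ k, ∫⁻ ω, ((s A).indicator 1 ω * (if k = 0 then 0 else stayInd 1 k ω)) *
        f K (ω k) ∂(incrementLaw ν) =
        (∫⁻ ω, (s A).indicator 1 ω * (if k = 0 then 0 else stayInd 1 k ω) ∂(incrementLaw ν)) *
          ∫⁻ t, f K t ∂ν := by
      intro k
      refine lintegral_mul_apply ν k (hmk k) (fun ω η => ?_) (hf K)
      rcases Nat.eq_zero_or_pos k with rfl | hk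
      · simp
      · have h3 : splice k ω η ∈ s A ↔ ω ∈ s A := by
          show _ < splice k ω η 0 ↔ _ < ω 0
          rw [splice_of_lt _ _ hk]
        simp only [stayInd_splice, indicator_apply, h3, Pi.one_apply]
    have h4 : ∑' k, ∫⁻ ω, (s A).indicator 1 ω * (if k = 0 then 0 else stayInd 1 k ω)
        ∂(incrementLaw ν) ≤ 1 / 2 := by
      rw [← lintegral_tsum fun k => (hmk k).aemeasurable]
      refine le_trans ?_ hA.le
      rw [← lintegral_indicator (hs A)]
      refine lintegral_mono fun ω => ?_
      rw [ENNReal.tsum_mul_left]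
      by_cases hω : ω ∈ s A
      · rw [indicator_of_mem hω, indicator_of_mem hω, Pi.one_apply, one_mul]
        refine ENNReal.tsum_le_tsum fun k => ?_
        split_ifs
        · exact zero_le
        · exact le_rfl
      · simp [hω]
    have hmk' : ∀ k, Measurable fun ω : ℕ → ℝ =>
        ((s A).indicator (1 : (ℕ → ℝ) → ℝ≥0∞) ω * (if k = 0 then 0 else stayInd 1 k ω)) *
          f K (ω k) := fun k => (hmk k).mul ((hf K).comp (measurable_pi_apply k))
    rw [lintegral_apply ν 0 (hf K), lintegral_add_left measurable_const, lintegral_const,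
      measure_univ, mul_one, lintegral_tsum fun k => (hmk' k).aemeasurable] at h1
    simp only [h2] at h1
    rw [ENNReal.tsum_mul_right] at h1
    have h5 : ∫⁻ t, f K t ∂ν ≤ (A + 2) + (1 / 2) * ∫⁻ t, f K t ∂ν :=
      h1.trans (by gcongr)
    set M := ∫⁻ t, f K t ∂ν
    have h6 : (1 / 2) * M + (1 / 2) * M ≤ (A + 2) + (1 / 2) * M := by
      rwa [← add_mul, ENNReal.add_halves, one_mul]
    have h7 : (1 / 2) * M ≤ A + 2 :=
      (ENNReal.add_le_add_iff_right (ENNReal.mul_ne_top (by simp) hfin)).1 h6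
    calc M = 2 * (1 / 2 * M) := by
          rw [← mul_assoc, one_div, ENNReal.mul_inv_cancel (by simp) (by simp), one_mul]
      _ ≤ 2 * (A + 2) := by gcongr
  have hsup : ∫⁻ t, ⨆ K, f K t ∂ν = ⨆ K, ∫⁻ t, f K t ∂ν :=
    lintegral_iSup hf fun K L hKL t => min_le_min_left _ (by exact_mod_cast hKL)
  have hsup' : ∫⁻ t, ⨆ K, f K t ∂ν = ∞ := by
    rw [← h]
    refine lintegral_congr fun t => le_antisymm (iSup_le fun K => min_le_left _ _) ?_
    obtain ⟨K, hK⟩ := exists_nat_ge (max t 0)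
    refine le_iSup_of_le K (le_min le_rfl ?_)
    rw [← ENNReal.ofReal_natCast]
    exact ENNReal.ofReal_le_ofReal hK
  rw [hsup'] at hsup
  have := hsup.le.trans (iSup_le hK)
  refine absurd this (not_le.2 (ENNReal.mul_lt_top (by simp) ?_))
  exact ENNReal.add_lt_top.2 ⟨ENNReal.natCast_lt_top A, by simp⟩

end ReturnTimes

/-- If the expected time that the walk from the origin spends away from it is infinite, then the
walk is not positive recurrent. -/
theorem not_finiteMeanReturn {μ : Measure (Fin 1 → ℝ)} [IsProbabilityMeasure μ]
    {L : Set (Fin 1 → ℝ)} (h0 : 0 ∈ L) {r : ℝ} (hr : 0 < r)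
    (h : ∑' j, incrementLaw (coordMarginal μ 0) (stay r j) = ∞) : ¬ FiniteMeanReturn μ L := by
  intro hfin
  have hU : IsOpen {z : Fin 1 → ℝ | z 0 < r} := isOpen_lt (continuous_apply 0) continuous_const
  have h1 := hfin _ hU 0 ⟨hr, h0⟩
  have h2 := tsum_measure_noReturn_le (μ := μ) hU.measurableSet 0
  have h3 : ∀ j, incrementLaw μ (noReturn {z : Fin 1 → ℝ | z 0 < r} 0 j) =
      incrementLaw (coordMarginal μ 0) (stay r j) := by
    intro j
    rw [← map_coord_incrementLaw,
      Measure.map_apply (by fun_prop) (measurableSet_stay r j)]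
    congr 1
    ext y
    refine forall_congr' fun n => forall_congr' fun _ => forall_congr' fun _ => ?_
    show ¬ (path 0 y n 0 < r) ↔ _
    rw [not_lt, path_apply]
    rfl
  simp only [h3, h] at h2
  exact absurd (h2.trans_lt h1) (lt_irrefl _)

end ReflectedWalk

namespace ReflectedWalk

/-! ### Non-negative increments -/

section Nonneg

theorem setLIntegral_Ioo_add (g : ℝ → ℝ≥0∞) {a b c : ℝ} (hab : a ≤ b) (hbc : b ≤ c) :
    (∫⁻ x in Ioo a b, g x) + (∫⁻ x in Ioo b c, g x) = ∫⁻ x in Ioo a c, g x := by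
  rw [setLIntegral_congr Ioo_ae_eq_Ioc, setLIntegral_congr (Ioo_ae_eq_Ioc (a := b)),
    setLIntegral_congr (Ioo_ae_eq_Ioc (a := a) (b := c)), ← Ioc_union_Ioc_eq_Ioc hab hbc,
    lintegral_union measurableSet_Ioc (Ioc_disjoint_Ioc_of_le le_rfl)]

theorem setLIntegral_Ioo_sub_left (g : ℝ → ℝ≥0∞) (a b c : ℝ) :
    ∫⁻ x in Ioo a b, g (c - x) = ∫⁻ x in Ioo (c - b) (c - a), g x := by
  rw [← lintegral_indicator measurableSet_Ioo, ← lintegral_indicator measurableSet_Ioo,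
    ← lintegral_sub_left_eq_self ((Ioo (c - b) (c - a)).indicator g) c]
  refine lintegral_congr fun x => ?_
  simp only [indicator_apply, mem_Ioo, sub_lt_sub_iff_left, and_comm]

theorem setLIntegral_Ioo_sub_right (g : ℝ → ℝ≥0∞) (a b c : ℝ) :
    ∫⁻ x in Ioo a b, g (x - c) = ∫⁻ x in Ioo (a - c) (b - c), g x := by
  rw [← lintegral_indicator measurableSet_Ioo, ← lintegral_indicator measurableSet_Ioo,
    ← lintegral_sub_right_eq_self ((Ioo (a - c) (b - c)).indicator g) c]
  refine lintegral_congr fun x => ?_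
  simp only [indicator_apply, mem_Ioo, sub_lt_sub_iff_right]

/-- For `t ≤ s`, folding `(0, s)` at `t` covers `(0, t)` and `(0, s - t)`, while reflecting `(0, t)`
at `s` covers `(s - t, s)`. Together these are `(0, t)` and `(0, s)`. -/
theorem setLIntegral_abs_sub_add (g : ℝ → ℝ≥0∞) {s t : ℝ} (hs : 0 ≤ s) (ht : 0 ≤ t) :
    (∫⁻ x in Ioo 0 s, g |x - t|) + (∫⁻ x in Ioo 0 t, g |x - s|) =
      (∫⁻ x in Ioo 0 s, g x) + (∫⁻ x in Ioo 0 t, g x) := by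
  wlog hts : t ≤ s generalizing s t
  · rw [add_comm, this ht hs (le_of_not_ge hts), add_comm]
  have h1 : ∫⁻ x in Ioo 0 t, g |x - t| = ∫⁻ x in Ioo 0 t, g x := by
    have := setLIntegral_Ioo_sub_left g 0 t t
    rw [sub_self, sub_zero] at this
    rw [← this]
    refine setLIntegral_congr_fun measurableSet_Ioo fun x hx => ?_
    rw [abs_of_nonpos (by linarith [hx.2]), neg_sub]
  have h2 : ∫⁻ x in Ioo t s, g |x - t| = ∫⁻ x in Ioo 0 (s - t), g x := by
    have := setLIntegral_Ioo_sub_right g t s t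
    rw [sub_self] at this
    rw [← this]
    refine setLIntegral_congr_fun measurableSet_Ioo fun x hx => ?_
    rw [abs_of_nonneg (by linarith [hx.1])]
  have h3 : ∫⁻ x in Ioo 0 t, g |x - s| = ∫⁻ x in Ioo (s - t) s, g x := by
    have := setLIntegral_Ioo_sub_left g 0 t s
    rw [sub_zero] at this
    rw [← this]
    refine setLIntegral_congr_fun measurableSet_Ioo fun x hx => ?_
    rw [abs_of_nonpos (by linarith [hx.2]), neg_sub]
  rw [← setLIntegral_Ioo_add (fun x => g |x - t|) ht hts, h1, h2, h3,
    ← setLIntegral_Ioo_add g (by linarith : (0 : ℝ) ≤ s - t) (by linarith : s - t ≤ s)]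
  ring

variable (ν : Measure ℝ) [IsProbabilityMeasure ν]

theorem setLIntegral_measure_Ioc_mul (y : ℝ) {h : ℝ → ℝ≥0∞} (hh : Measurable h) :
    ∫⁻ x in Ioc 0 y, ν (Ioc x y) * h x =
      ∫⁻ s in Iic y, (∫⁻ x in Ioo 0 s, h x) ∂ν := by
  have h1 : ∀ x, ν (Ioc x y) * h x = ∫⁻ s in Iic y, (Ioi x).indicator (fun _ => h x) s ∂ν := by
    intro x
    rw [lintegral_indicator_const measurableSet_Ioi, Measure.restrict_apply measurableSet_Ioi,
      Ioi_inter_Iic, mul_comm]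
  have hm : Measurable fun p : ℝ × ℝ => (Ioi p.1).indicator (fun _ => h p.1) p.2 := by
    have : (fun p : ℝ × ℝ => (Ioi p.1).indicator (fun _ => h p.1) p.2) =
        {p : ℝ × ℝ | p.1 < p.2}.indicator fun p => h p.1 := by
      funext p; simp [indicator_apply]
    rw [this]
    exact (hh.comp measurable_fst).indicator (measurableSet_lt measurable_fst measurable_snd)
  simp only [h1]
  rw [lintegral_lintegral_swap hm.aemeasurable]
  refine setLIntegral_congr_fun (measurableSet_Iic (a := y)) fun s hs => ?_
  have h2 : Ioo 0 s = Iio s ∩ Ioc 0 y := by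
    ext x
    simp only [mem_Ioo, mem_inter_iff, mem_Iio, mem_Ioc]
    exact ⟨fun hx => ⟨hx.2, hx.1, hx.2.le.trans (show s ≤ y from hs)⟩, fun hx => ⟨hx.2.1, hx.1⟩⟩
  rw [h2, ← Measure.restrict_restrict measurableSet_Iio, ← lintegral_indicator measurableSet_Iio]
  refine lintegral_congr fun x => ?_
  simp [indicator_apply]

/-- The measure with density `ν (x, y]` is invariant, up to the factor `ν (-∞, y]`, for the
reflected walk whose increments are at most `y`. -/
theorem setLIntegral_measure_Ioc_mul_lintegral (h0 : ∀ᵐ t ∂ν, 0 ≤ t) (y : ℝ) {g : ℝ → ℝ≥0∞}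
    (hg : Measurable g) :
    ∫⁻ x in Ioc 0 y, ν (Ioc x y) * ∫⁻ t in Iic y, g |x - t| ∂ν =
      ν (Iic y) * ∫⁻ x in Ioc 0 y, ν (Ioc x y) * g x := by
  have hm : Measurable fun p : ℝ × ℝ => g |p.1 - p.2| := hg.comp (by fun_prop)
  rw [setLIntegral_measure_Ioc_mul ν y hm.lintegral_prod_right',
    setLIntegral_measure_Ioc_mul ν y hg]
  set κ := ν.restrict (Iic y)
  have hκ : ∀ᵐ t ∂κ, 0 ≤ t := ae_restrict_of_ae h0
  set F : ℝ → ℝ≥0∞ := fun s => ∫⁻ x in Ioo 0 s, g x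
  set H : ℝ → ℝ → ℝ≥0∞ := fun s t => ∫⁻ x in Ioo 0 s, g |x - t|
  have hH : Measurable (Function.uncurry H) := by
    have h1 : Function.uncurry H = fun p : ℝ × ℝ =>
        ∫⁻ x, ({q : (ℝ × ℝ) × ℝ | 0 < q.2 ∧ q.2 < q.1.1}.indicator
          (fun q => g |q.2 - q.1.2|)) (p, x) := by
      funext p
      show ∫⁻ x in Ioo 0 p.1, g |x - p.2| = _
      rw [← lintegral_indicator measurableSet_Ioo]
      refine lintegral_congr fun x => ?_
      simp [indicator_apply]
    rw [h1]
    refine Measurable.lintegral_prod_right' (Measurable.indicator (hg.comp (by fun_prop)) ?_)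
    exact (measurableSet_lt measurable_const measurable_snd).inter
      (measurableSet_lt measurable_snd (by fun_prop))
  have hF : Measurable F := by
    have h1 : F = fun s : ℝ =>
        ∫⁻ x, ({q : ℝ × ℝ | 0 < q.2 ∧ q.2 < q.1}.indicator (fun q => g q.2)) (s, x) := by
      funext s
      show ∫⁻ x in Ioo 0 s, g x = _
      rw [← lintegral_indicator measurableSet_Ioo]
      refine lintegral_congr fun x => ?_
      simp [indicator_apply]
    rw [h1]
    refine Measurable.lintegral_prod_right' (Measurable.indicator (hg.comp (by fun_prop)) ?_)
    exact (measurableSet_lt measurable_const measurable_snd).inter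
      (measurableSet_lt measurable_snd measurable_fst)
  have h1 : ∀ s, ∫⁻ x in Ioo 0 s, ∫⁻ t, g |x - t| ∂κ = ∫⁻ t, H s t ∂κ := fun s =>
    lintegral_lintegral_swap hm.aemeasurable
  refine (lintegral_congr h1).trans ?_
  change ∫⁻ s, ∫⁻ t, H s t ∂κ ∂κ = ν (Iic y) * ∫⁻ s, F s ∂κ
  have hHs : ∀ s, Measurable (H s) := fun s => hH.of_uncurry_left
  -- The folding identity holds only after symmetrisation in `s` and `t`, so twice the integral is
  -- computed and the factor two cancelled.
  have h2 : ∫⁻ s, ∫⁻ t, H s t ∂κ ∂κ + ∫⁻ s, ∫⁻ t, H s t ∂κ ∂κ =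
      κ univ * ∫⁻ s, F s ∂κ + κ univ * ∫⁻ s, F s ∂κ := by
    calc ∫⁻ s, ∫⁻ t, H s t ∂κ ∂κ + ∫⁻ s, ∫⁻ t, H s t ∂κ ∂κ
        = ∫⁻ s, ∫⁻ t, H s t ∂κ ∂κ + ∫⁻ s, ∫⁻ t, H t s ∂κ ∂κ := by
          congr 1
          exact lintegral_lintegral_swap hH.aemeasurable
      _ = ∫⁻ s, ∫⁻ t, (F s + F t) ∂κ ∂κ := by
          have hHi : Measurable fun s => ∫⁻ t, H s t ∂κ := hH.lintegral_prod_right'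
          rw [← lintegral_add_left hHi]
          refine lintegral_congr_ae ?_
          filter_upwards [hκ] with s hs
          rw [← lintegral_add_left (hHs s)]
          refine lintegral_congr_ae ?_
          filter_upwards [hκ] with t ht
          exact setLIntegral_abs_sub_add g hs ht
      _ = _ := by
          have h3 : ∀ s, ∫⁻ t, (F s + F t) ∂κ = F s * κ univ + ∫⁻ t, F t ∂κ := by
            intro s
            rw [lintegral_add_left measurable_const, lintegral_const]
          simp only [h3]
          rw [lintegral_add_right _ measurable_const, lintegral_mul_const _ hF, lintegral_const]
          ring
  have h4 : κ univ = ν (Iic y) := by simp [κ]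
  rw [h4, ← two_mul, ← two_mul] at h2
  exact (ENNReal.mul_right_inj (by simp) (by simp)).1 h2

/-- A function which exceeds its mean under the transition operator by at least the indicator of a
neighbourhood of the origin is unbounded. -/
theorem exists_lt_of_superharmonic (h0 : ∀ᵐ t ∂ν, 0 ≤ t) (hpos : 0 < ν (Ioi 0))
    (hν : Tendsto (fun y : ℝ => ν (Ioi y) * ∫⁻ x in Ioc 0 y, ν (Ioc x y)) atTop (𝓝 0))
    {A : ℝ} (hA : 0 < A) {g : ℝ → ℝ≥0∞} (hg : Measurable g)
    (hgP : ∀ x, 0 ≤ x → (Iic A).indicator 1 x + ∫⁻ t, g |x - t| ∂ν ≤ g x)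
    {M : ℝ≥0∞} (hM : M ≠ ∞) : ∃ x, 0 ≤ x ∧ M < g x := by
  by_contra! hcon
  -- `δ` and `y₀` bound the density from below near the origin: for `x ≤ δ` and `y ≥ y₀`, `ν (Ioc x
  -- y)` is at least `ν (Ioc δ y₀) > 0`.
  obtain ⟨δ, hδ, hδA, hδν⟩ : ∃ δ : ℝ, 0 < δ ∧ δ ≤ A ∧ 0 < ν (Ioi δ) := by
    by_contra! hall
    refine hpos.ne' ?_
    have : Ioi (0 : ℝ) ⊆ ⋃ n : ℕ, Ioi (A / (n + 1)) := by
      intro x hx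
      obtain ⟨n, hn⟩ := exists_nat_gt (A / x)
      refine mem_iUnion.2 ⟨n, ?_⟩
      have hx' : 0 < x := hx
      rw [div_lt_iff₀ hx'] at hn
      rw [mem_Ioi, div_lt_iff₀ (by positivity)]
      nlinarith
    refine measure_mono_null this (measure_iUnion_null fun n => le_zero_iff.1 (hall _ ?_ ?_))
    · positivity
    · exact div_le_self hA.le (by linarith [(Nat.cast_nonneg n : (0 : ℝ) ≤ n)])
  obtain ⟨y₀, hy₀⟩ : ∃ y₀ : ℝ, 0 < ν (Ioc δ y₀) := by
    by_contra! hall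
    refine hδν.ne' ?_
    have : Ioi δ ⊆ ⋃ n : ℕ, Ioc δ n := by
      intro x hx
      obtain ⟨n, hn⟩ := exists_nat_ge x
      exact mem_iUnion.2 ⟨n, hx, hn⟩
    exact measure_mono_null this (measure_iUnion_null fun n => le_zero_iff.1 (hall _))
  -- The inequality for `g` is integrated against the density `ν (Ioc x y)`. By invariance the
  -- transition term returns `ν (Iic y) * W`, so only the deficit `ν (Ioi y) * W` pays for the mass
  -- near the origin. It tends to zero if `g ≤ M`.
  have key : ∀ y, max y₀ δ ≤ y → ENNReal.ofReal δ * ν (Ioc δ y₀) ≤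
      M * (ν (Ioi y) * ∫⁻ x in Ioc 0 y, ν (Ioc x y)) := by
    intro y hy
    have hmν : Measurable fun x : ℝ => ν (Ioc x y) :=
      Antitone.measurable fun a b hab => measure_mono (Ioc_subset_Ioc_left hab)
    set W := ∫⁻ x in Ioc 0 y, ν (Ioc x y) * g x
    have hW : W ≤ M * ∫⁻ x in Ioc 0 y, ν (Ioc x y) := by
      rw [← lintegral_const_mul _ hmν]
      refine setLIntegral_mono (hmν.const_mul _) fun x hx => ?_
      rw [mul_comm]
      gcongr
      exact hcon x hx.1.le
    have hmass : ∫⁻ x in Ioc 0 y, ν (Ioc x y) ≠ ∞ := by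
      refine ne_top_of_le_ne_top ?_ (lintegral_mono fun x => prob_le_one)
      simp
    have hWfin : W ≠ ∞ := ne_top_of_le_ne_top (ENNReal.mul_ne_top hM hmass) hW
    have h1 : ENNReal.ofReal δ * ν (Ioc δ y₀) + ν (Iic y) * W ≤ W := by
      calc ENNReal.ofReal δ * ν (Ioc δ y₀) + ν (Iic y) * W
          ≤ (∫⁻ x in Ioc 0 y, ν (Ioc x y) * (Iic A).indicator 1 x) +
              (∫⁻ x in Ioc 0 y, ν (Ioc x y) * ∫⁻ t in Iic y, g |x - t| ∂ν) := by
            rw [setLIntegral_measure_Ioc_mul_lintegral ν h0 y hg]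
            gcongr
            calc ENNReal.ofReal δ * ν (Ioc δ y₀) = ∫⁻ x in Ioc 0 δ, ν (Ioc δ y₀) := by
                  rw [setLIntegral_const, Real.volume_Ioc, sub_zero, mul_comm]
              _ ≤ ∫⁻ x in Ioc 0 δ, ν (Ioc x y) * (Iic A).indicator 1 x := by
                  refine setLIntegral_mono' measurableSet_Ioc fun x hx => ?_
                  rw [indicator_of_mem (show x ∈ Iic A from hx.2.trans hδA), Pi.one_apply, mul_one]
                  exact measure_mono (Ioc_subset_Ioc hx.2 ((le_max_left _ _).trans hy))
              _ ≤ _ := lintegral_mono_set (Ioc_subset_Ioc_right ((le_max_right _ _).trans hy))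
        _ = ∫⁻ x in Ioc 0 y, (ν (Ioc x y) * (Iic A).indicator 1 x +
              ν (Ioc x y) * ∫⁻ t in Iic y, g |x - t| ∂ν) := by
            rw [lintegral_add_left]
            exact hmν.mul (measurable_one.indicator measurableSet_Iic)
        _ ≤ W := by
            refine setLIntegral_mono' measurableSet_Ioc fun x hx => ?_
            rw [← mul_add]
            gcongr
            refine le_trans ?_ (hgP x hx.1.le)
            gcongr
            exact Measure.restrict_le_self
    have h2 : W = ν (Ioi y) * W + ν (Iic y) * W := by
      rw [← add_mul, ← compl_Iic, add_comm, measure_add_measure_compl measurableSet_Iic,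
        measure_univ, one_mul]
    have h3 : ENNReal.ofReal δ * ν (Ioc δ y₀) ≤ ν (Ioi y) * W := by
      rw [h2, ← h2] at h1
      nth_rewrite 2 [h2] at h1
      exact (ENNReal.add_le_add_iff_right (ENNReal.mul_ne_top (measure_ne_top _ _) hWfin)).1 h1
    calc _ ≤ ν (Ioi y) * W := h3
      _ ≤ ν (Ioi y) * (M * ∫⁻ x in Ioc 0 y, ν (Ioc x y)) := by gcongr
      _ = _ := by ring
  have hlim : Tendsto (fun y : ℝ => M * (ν (Ioi y) * ∫⁻ x in Ioc 0 y, ν (Ioc x y))) atTop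
      (𝓝 (M * 0)) := ENNReal.Tendsto.const_mul hν (Or.inr hM)
  rw [mul_zero] at hlim
  have hc : 0 < ENNReal.ofReal δ * ν (Ioc δ y₀) :=
    ENNReal.mul_pos (ENNReal.ofReal_pos.2 hδ).ne' hy₀.ne'
  have := ge_of_tendsto hlim ((eventually_ge_atTop (max y₀ δ)).mono fun y hy => key y hy)
  exact absurd this (not_le.2 hc)

theorem tendsto_measure_Ioi_atTop : Tendsto (fun y : ℝ => ν (Ioi y)) atTop (𝓝 0) := by
  have h1 : ⋂ y : ℝ, Ioi y = (∅ : Set ℝ) :=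
    eq_empty_iff_forall_notMem.2 fun x hx => lt_irrefl x (mem_iInter.1 hx x)
  rw [← measure_empty (μ := ν), ← h1]
  exact tendsto_measure_iInter_atTop (fun y => measurableSet_Ioi.nullMeasurableSet)
    (fun a b hab => Ioi_subset_Ioi hab) ⟨0, measure_ne_top _ _⟩

/-- The integral is split at a large `a`. The part up to `a` is at most `a * ν (Ioi y)`; beyond `a`,
`ν (Ioi y) ≤ ν (Ioi x)` gives a tail of the convergent integral. -/
theorem tendsto_of_setLIntegral_sq (h : ∫⁻ x in Ioi (0 : ℝ), ν (Ioi x) ^ 2 < ∞) :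
    Tendsto (fun y : ℝ => ν (Ioi y) * ∫⁻ x in Ioc 0 y, ν (Ioc x y)) atTop (𝓝 0) := by
  have htail : Tendsto (fun a : ℝ => ∫⁻ x in Ioi a ∩ Ioi 0, ν (Ioi x) ^ 2) atTop (𝓝 0) := by
    have h1 : Tendsto ((volume.withDensity fun x => (Ioi 0).indicator (fun x => ν (Ioi x) ^ 2) x) ∘
        fun a : ℝ => Ioi a) atTop (𝓝 0) := by
      have h2 : ⋂ y : ℝ, Ioi y = (∅ : Set ℝ) :=
        eq_empty_iff_forall_notMem.2 fun x hx => lt_irrefl x (mem_iInter.1 hx x)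
      rw [← measure_empty (μ := volume.withDensity fun x =>
        (Ioi (0 : ℝ)).indicator (fun x => ν (Ioi x) ^ 2) x), ← h2]
      refine tendsto_measure_iInter_atTop (fun y => measurableSet_Ioi.nullMeasurableSet)
        (fun a b hab => Ioi_subset_Ioi hab) ⟨0, ?_⟩
      rw [withDensity_apply _ measurableSet_Ioi, setLIntegral_indicator measurableSet_Ioi,
        inter_self]
      exact h.ne
    refine h1.congr fun a => ?_
    rw [Function.comp_apply, withDensity_apply _ measurableSet_Ioi,
      setLIntegral_indicator measurableSet_Ioi, inter_comm]
  rw [ENNReal.tendsto_nhds_zero]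
  intro ε hε
  have hε2 : 0 < ε / 2 := ENNReal.half_pos hε.ne'
  obtain ⟨a, ha, ha0⟩ := ((ENNReal.tendsto_nhds_zero.1 htail _ hε2).and
    (eventually_ge_atTop 0)).exists
  have h3 : Tendsto (fun y : ℝ => ENNReal.ofReal a * ν (Ioi y)) atTop (𝓝 (ENNReal.ofReal a * 0)) :=
    ENNReal.Tendsto.const_mul (tendsto_measure_Ioi_atTop ν) (Or.inr ENNReal.ofReal_ne_top)
  rw [mul_zero] at h3
  filter_upwards [ENNReal.tendsto_nhds_zero.1 h3 _ hε2, eventually_ge_atTop a] with y hy hay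
  calc ν (Ioi y) * ∫⁻ x in Ioc 0 y, ν (Ioc x y)
      ≤ ν (Ioi y) * ((∫⁻ x in Ioc 0 a, ν (Ioc x y)) + ∫⁻ x in Ioc a y, ν (Ioc x y)) := by
        gcongr
        rw [← Ioc_union_Ioc_eq_Ioc ha0 hay]
        exact lintegral_union_le _ _ _
    _ = ν (Ioi y) * (∫⁻ x in Ioc 0 a, ν (Ioc x y)) +
          ∫⁻ x in Ioc a y, ν (Ioi y) * ν (Ioc x y) := by
        rw [mul_add, lintegral_const_mul _
          (Antitone.measurable fun a b hab => measure_mono (Ioc_subset_Ioc_left hab))]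
    _ ≤ ε / 2 + ε / 2 := by
        gcongr
        · refine le_trans ?_ hy
          rw [mul_comm]
          gcongr
          refine (lintegral_mono fun x => prob_le_one).trans ?_
          simp
        · refine le_trans ?_ ha
          calc ∫⁻ x in Ioc a y, ν (Ioi y) * ν (Ioc x y)
              ≤ ∫⁻ x in Ioc a y, ν (Ioi x) ^ 2 := by
                refine setLIntegral_mono' measurableSet_Ioc fun x hx => ?_
                rw [sq]
                exact mul_le_mul' (measure_mono (Ioi_subset_Ioi hx.2))
                  (measure_mono Ioc_subset_Ioi_self)
            _ ≤ ∫⁻ x in Ioi a ∩ Ioi 0, ν (Ioi x) ^ 2 :=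
                lintegral_mono_set fun x hx => ⟨hx.1, ha0.trans_lt hx.1⟩
    _ = ε := ENNReal.add_halves ε

/-- Markov's inequality bounds `√x * ν (Ioi x)` by the moment; the remaining factor `ν (Ioi x) / √x`
is the layer-cake integrand of the same moment, up to a constant. -/
theorem setLIntegral_sq_lt_top (h : momentPos ν (1 / 2) < ∞) :
    ∫⁻ x in Ioi (0 : ℝ), ν (Ioi x) ^ 2 < ∞ := by
  have hcake := lintegral_rpow_eq_lintegral_meas_lt_mul ν (f := fun y : ℝ => max y 0)
    (.of_forall fun y => le_max_right _ _) (by fun_prop) (p := 1 / 2) (by norm_num)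
  change momentPos ν (1 / 2) = _ at hcake
  set I := ∫⁻ t in Ioi (0 : ℝ), ν {a : ℝ | t < max a 0} * ENNReal.ofReal (t ^ (1 / 2 - 1 : ℝ))
  have hI : I ≠ ∞ := by
    intro hI
    rw [hcake, hI, ENNReal.mul_top (by simp)] at h
    exact lt_irrefl _ h
  refine lt_of_le_of_lt ?_ (ENNReal.mul_lt_top h hI.lt_top)
  rw [← lintegral_const_mul' _ _ h.ne]
  refine setLIntegral_mono' measurableSet_Ioi fun x hx => ?_
  have hx0 : (0 : ℝ) < x := hx
  have hset : {a : ℝ | x < max a 0} = Ioi x := by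
    ext a
    simp [hx0.le]
  have h1 : ENNReal.ofReal (x ^ (1 / 2 : ℝ)) * ν (Ioi x) ≤ momentPos ν (1 / 2) := by
    refine le_trans ?_ (mul_meas_ge_le_lintegral
      (by fun_prop : Measurable fun y : ℝ => ENNReal.ofReal (max y 0 ^ (1 / 2 : ℝ)))
      (ENNReal.ofReal (x ^ (1 / 2 : ℝ))))
    gcongr
    intro a ha
    refine ENNReal.ofReal_le_ofReal (Real.rpow_le_rpow hx0.le ?_ (by norm_num))
    exact (le_of_lt ha).trans (le_max_left _ _)
  have h2 : ENNReal.ofReal (x ^ (1 / 2 : ℝ)) * ENNReal.ofReal (x ^ (1 / 2 - 1 : ℝ)) = 1 := by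
    rw [← ENNReal.ofReal_mul (by positivity), ← Real.rpow_add hx0]
    norm_num
  rw [hset]
  calc ν (Ioi x) ^ 2 = ν (Ioi x) ^ 2 * (ENNReal.ofReal (x ^ (1 / 2 : ℝ)) *
        ENNReal.ofReal (x ^ (1 / 2 - 1 : ℝ))) := by rw [h2, mul_one]
    _ = ENNReal.ofReal (x ^ (1 / 2 : ℝ)) * ν (Ioi x) *
        (ν (Ioi x) * ENNReal.ofReal (x ^ (1 / 2 - 1 : ℝ))) := by ring
    _ ≤ _ := by gcongr

variable {ν} in
theorem green_eq (A x : ℝ) :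
    green ν A x = (Iic A).indicator 1 x + ∫⁻ t, green ν A |x - t| ∂ν := by
  have hm : ∀ n, Measurable fun p : ℝ × (ℕ → ℝ) => absPath p.1 p.2 n := measurable_absPath
  have h1 : ∀ n, incrementLaw ν {ω | absPath x ω (n + 1) ≤ A} =
      ∫⁻ t, incrementLaw ν {ω | absPath |x - t| ω n ≤ A} ∂ν := by
    intro n
    have hms : MeasurableSet {p : ℝ × (ℕ → ℝ) | absPath |x - p.1| p.2 n ≤ A} :=
      measurableSet_le ((hm n).comp (by fun_prop : Measurable fun p : ℝ × (ℕ → ℝ) =>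
        (|x - p.1|, p.2))) measurable_const
    have h2 := lintegral_first ν (fun t η =>
      {p : ℝ × (ℕ → ℝ) | absPath |x - p.1| p.2 n ≤ A}.indicator
      (1 : ℝ × (ℕ → ℝ) → ℝ≥0∞) (t, η)) (measurable_one.indicator hms)
    rw [← lintegral_indicator_one (measurableSet_le (measurable_absPath_right x _)
      measurable_const)]
    refine Eq.trans (lintegral_congr fun ω => ?_) (h2.trans (lintegral_congr fun t => ?_))
    · have h3 : absPath x ω (n + 1) = absPath |x - ω 0| (fun k => ω (1 + k)) n := by
        rw [add_comm, absPath_add]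
        rfl
      simp only [indicator_apply, mem_ofPred_eq, h3, Pi.one_apply]
    · exact lintegral_indicator_one (measurable_prodMk_left (x := t) hms)
  unfold green
  rw [tsum_eq_zero_add' ENNReal.summable, lintegral_tsum]
  · congr 1
    · by_cases hx : x ≤ A
      · rw [indicator_of_mem (by exact hx)]
        simp [absPath, hx]
      · rw [indicator_of_notMem (by exact hx)]
        simp [absPath, hx]
    · simp only [h1]
  · intro n
    exact (measurable_measure_prodMk_left (ν := incrementLaw ν)
      (measurableSet_le (hm n) measurable_const)).comp (by fun_prop) |>.aemeasurable

theorem ae_nonneg_of_support (h : ν.support ⊆ Ici 0) : ∀ᵐ t ∂ν, 0 ≤ t := by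
  filter_upwards [ν.support_mem_ae] with t ht using h ht

theorem NonnegCriterion.ae_not_tendsto {ν : Measure ℝ} [IsProbabilityMeasure ν]
    (h : NonnegCriterion ν) (hpos : 0 < ν (Ioi 0)) :
    ∀ᵐ ω ∂(incrementLaw ν), ¬ Tendsto (absPath 0 ω) atTop atTop := by
  obtain ⟨hsupp, -, h⟩ := h
  have hν : Tendsto (fun y : ℝ => ν (Ioi y) * ∫⁻ x in Ioc 0 y, ν (Ioc x y)) atTop (𝓝 0) := by
    rcases h with h | h | h
    · exact tendsto_of_setLIntegral_sq ν (setLIntegral_sq_lt_top ν h)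
    · exact tendsto_of_setLIntegral_sq ν h
    · exact h
  exact ae_not_tendsto_of_green ν fun M hM => exists_lt_of_superharmonic ν
    (ae_nonneg_of_support ν hsupp) hpos hν one_pos (measurable_green ν 1)
    (fun x _ => (green_eq 1 x).ge) hM

end Nonneg

end ReflectedWalk

namespace ReflectedWalk

/-! ### Ordinary random walk -/

section Sums

/-- The partial sums of a sequence. -/
def partialSum (ω : ℕ → ℝ) (n : ℕ) : ℝ := ∑ k ∈ Finset.range n, ω k

@[simp] theorem partialSum_zero (ω : ℕ → ℝ) : partialSum ω 0 = 0 := by simp [partialSum]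

theorem partialSum_succ (ω : ℕ → ℝ) (n : ℕ) : partialSum ω (n + 1) = partialSum ω n + ω n :=
  Finset.sum_range_succ _ _

theorem partialSum_shift (ω : ℕ → ℝ) (n m : ℕ) :
    partialSum ω (n + m) = partialSum ω n + partialSum (fun k => ω (n + k)) m := by
  rw [partialSum, Finset.sum_range_add]
  rfl

theorem partialSum_splice_of_le {n m : ℕ} (ω η : ℕ → ℝ) (h : m ≤ n) :
    partialSum (splice n ω η) m = partialSum ω m :=
  Finset.sum_congr rfl fun _ hk => splice_of_lt _ _ ((Finset.mem_range.1 hk).trans_le h)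

@[fun_prop]
theorem measurable_partialSum (n : ℕ) : Measurable fun ω => partialSum ω n :=
  Finset.measurable_sum _ fun k _ => measurable_pi_apply k

variable (ν : Measure ℝ) [IsProbabilityMeasure ν]

/-- The strong law of large numbers for centred increments. -/
theorem ae_abs_partialSum_le (hint : Integrable (fun y : ℝ => y) ν) (hmean : ∫ y, y ∂ν = 0) :
    ∀ᵐ ω ∂(incrementLaw ν), ∀ ε : ℝ, 0 < ε → ∃ C : ℝ, ∀ n : ℕ, |partialSum ω n| ≤ C + ε * n := by
  have hmp : ∀ n, MeasurePreserving (fun ω : ℕ → ℝ => ω n) (incrementLaw ν) ν := fun n =>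
    measurePreserving_eval_infinitePi (fun _ : ℕ => ν) n
  have hind : ProbabilityTheory.iIndepFun (fun n (ω : ℕ → ℝ) => ω n) (incrementLaw ν) :=
    ProbabilityTheory.iIndepFun_infinitePi (P := fun _ : ℕ => ν) (X := fun _ (y : ℝ) => y)
      fun _ => measurable_id
  have hslln := ProbabilityTheory.strong_law_ae_real (μ := incrementLaw ν)
    (fun n (ω : ℕ → ℝ) => ω n) ((hmp 0).integrable_comp_of_integrable hint)
    (fun i j hij => hind.indepFun hij)
    (fun n => ⟨(hmp n).measurable.aemeasurable, (hmp 0).measurable.aemeasurable,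
      (hmp n).map_eq.trans (hmp 0).map_eq.symm⟩)
  have h0 : ∫ ω, (ω 0 : ℝ) ∂(incrementLaw ν) = 0 := by
    have h1 : ∫ y, y ∂((incrementLaw ν).map fun ω => ω 0) = ∫ ω, (ω 0 : ℝ) ∂(incrementLaw ν) :=
      integral_map (hmp 0).measurable.aemeasurable aestronglyMeasurable_id
    rw [← h1, (hmp 0).map_eq, hmean]
  filter_upwards [hslln] with ω hω ε hε
  rw [h0] at hω
  obtain ⟨N, hN⟩ := Metric.tendsto_atTop.1 hω ε hε
  refine ⟨∑ i ∈ Finset.range (N + 1), |partialSum ω i|, fun n => ?_⟩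
  have hC : 0 ≤ ∑ i ∈ Finset.range (N + 1), |partialSum ω i| :=
    Finset.sum_nonneg fun _ _ => abs_nonneg _
  have hεn : 0 ≤ ε * n := by positivity
  rcases le_total n N with hn | hn
  · have := Finset.single_le_sum (f := fun i => |partialSum ω i|) (fun i _ => abs_nonneg _)
      (Finset.mem_range.2 (Nat.lt_succ_of_le hn))
    linarith
  · have h1 := hN n hn
    rcases Nat.eq_zero_or_pos n with rfl | hn0
    · simpa using hC
    · have hn0' : (0 : ℝ) < n := by exact_mod_cast hn0
      rw [Real.dist_eq, sub_zero, abs_div, abs_of_pos hn0', div_lt_iff₀ hn0'] at h1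
      change |partialSum ω n| < _ at h1
      linarith

/-- An event that almost surely occurs with frequency zero along a progression of shifts is a null
event. -/
theorem measure_eq_zero_of_frequency {B : Set (ℕ → ℝ)} (hB : MeasurableSet B) (N : ℕ)
    (h : ∀ᵐ ω ∂(incrementLaw ν), ∀ ε : ℝ, 0 < ε → ∃ C : ℝ, ∀ J : ℕ,
      ∑ j ∈ Finset.range J, B.indicator (fun _ => (1 : ℝ)) (fun k => ω (j * N + k)) ≤
        C + ε * J) : incrementLaw ν B = 0 := by
  set c : ℕ → (ℕ → ℝ) → ℝ := fun J ω =>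
    (∑ j ∈ Finset.range J, B.indicator (fun _ => (1 : ℝ)) (fun k => ω (j * N + k))) / J
  have hterm : ∀ j, Measurable fun ω : ℕ → ℝ =>
      B.indicator (fun _ => (1 : ℝ)) (fun k => ω (j * N + k)) := fun j =>
    (measurable_const.indicator hB).comp (measurable_shift _)
  have hind : ∀ ω : ℕ → ℝ, 0 ≤ B.indicator (fun _ => (1 : ℝ)) ω ∧
      B.indicator (fun _ => (1 : ℝ)) ω ≤ 1 := fun ω => by
    by_cases hω : ω ∈ B <;> simp [hω]
  have hc0 : ∀ J ω, 0 ≤ c J ω := fun J ω =>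
    div_nonneg (Finset.sum_nonneg fun _ _ => (hind _).1) (Nat.cast_nonneg J)
  have hc1 : ∀ J ω, c J ω ≤ 1 := by
    intro J ω
    refine div_le_one_of_le₀ ((Finset.sum_le_card_nsmul _ _ 1 fun _ _ => (hind _).2).trans ?_)
      (Nat.cast_nonneg J)
    simp
  -- By stationarity the mean frequency is the probability of `B` for every `J > 0`, while dominated
  -- convergence gives the limit zero.
  have hlim : Tendsto (fun J => ∫ ω, c J ω ∂(incrementLaw ν)) atTop
      (𝓝 (∫ _, (0 : ℝ) ∂(incrementLaw ν))) := by
    refine tendsto_integral_of_dominated_convergence (fun _ => 1) (fun J => ?_)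
      (integrable_const 1) (fun J => .of_forall fun ω => ?_) ?_
    · exact ((Finset.measurable_sum _ fun j _ => hterm j).div_const _).aestronglyMeasurable
    · rw [Real.norm_of_nonneg (hc0 J ω)]
      exact hc1 J ω
    · filter_upwards [h] with ω hω
      rw [Metric.tendsto_atTop]
      intro ε hε
      obtain ⟨C, hC⟩ := hω (ε / 2) (half_pos hε)
      obtain ⟨J₀, hJ₀⟩ := exists_nat_gt (max (2 * C / ε) 0)
      refine ⟨J₀, fun J hJ => ?_⟩
      have hJJ : (J₀ : ℝ) ≤ J := by exact_mod_cast hJ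
      have hJ0 : (0 : ℝ) < J := ((le_max_right _ _).trans_lt hJ₀).trans_le hJJ
      rw [Real.dist_eq, sub_zero, abs_of_nonneg (hc0 J ω), div_lt_iff₀ hJ0]
      have h1 : 2 * C / ε < J := ((le_max_left _ _).trans_lt hJ₀).trans_le hJJ
      rw [div_lt_iff₀ hε] at h1
      have := hC J
      nlinarith
  have hval : ∀ J : ℕ, 0 < J → ∫ ω, c J ω ∂(incrementLaw ν) = (incrementLaw ν).real B := by
    intro J hJ
    have h1 : ∀ j, ∫ ω, B.indicator (fun _ => (1 : ℝ)) (fun k => ω (j * N + k)) ∂(incrementLaw ν) =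
        (incrementLaw ν).real B := by
      intro j
      have h2 : ∫ ω, B.indicator (fun _ => (1 : ℝ)) ω
          ∂((incrementLaw ν).map fun ω k => ω (j * N + k)) =
          ∫ ω, B.indicator (fun _ => (1 : ℝ)) (fun k => ω (j * N + k)) ∂(incrementLaw ν) :=
        integral_map (measurable_shift _).aemeasurable
          (measurable_const.indicator hB).aestronglyMeasurable
      rw [← h2, map_shift, integral_indicator_const _ hB, smul_eq_mul, mul_one]
    simp only [c]
    rw [integral_div, integral_finsetSum]
    · simp only [h1, Finset.sum_const, Finset.card_range, nsmul_eq_mul]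
      field_simp
    · intro j _
      exact Integrable.of_bound (hterm j).aestronglyMeasurable 1 (.of_forall fun ω => by
        rw [Real.norm_of_nonneg (hind _).1]; exact (hind _).2)
  rw [integral_zero] at hlim
  have h3 : Tendsto (fun J : ℕ => ∫ ω, c J ω ∂(incrementLaw ν)) atTop
      (𝓝 ((incrementLaw ν).real B)) :=
    tendsto_const_nhds.congr' ((eventually_gt_atTop 0).mono fun J hJ => (hval J hJ).symm)
  exact (measureReal_eq_zero_iff).1 (tendsto_nhds_unique h3 hlim)

/-! ### Symmetric increments -/

variable {ν} in
theorem measure_abs_sub_partialSum_neg (hsym : ν.map (fun y => -y) = ν) (A u : ℝ) (n : ℕ) :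
    incrementLaw ν {ω | |-u - partialSum ω n| ≤ A} =
      incrementLaw ν {ω | |u - partialSum ω n| ≤ A} := by
  have h1 := map_comp_incrementLaw ν measurable_neg
  rw [hsym] at h1
  conv_lhs => rw [← h1]
  rw [Measure.map_apply (by fun_prop)
    (measurableSet_le (by fun_prop) measurable_const)]
  congr 1
  ext ω
  have h2 : partialSum (fun k => -ω k) n = -partialSum ω n := by
    simp [partialSum]
  show |-u - partialSum (fun k => -ω k) n| ≤ A ↔ |u - partialSum ω n| ≤ A
  rw [h2, ← abs_neg]
  ring_nf

variable {ν} in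
/-- For symmetric increments, reflected random walk has the law of the absolute value of the
ordinary random walk. -/
theorem measure_absPath_le (hsym : ν.map (fun y => -y) = ν) (A : ℝ) (n : ℕ) :
    ∀ x, 0 ≤ x → incrementLaw ν {ω | absPath x ω n ≤ A} =
      incrementLaw ν {ω | |x - partialSum ω n| ≤ A} := by
  induction n with
  | zero =>
    intro x hx
    simp [absPath, abs_of_nonneg hx]
  | succ n ih =>
    intro x hx
    have hm1 : MeasurableSet {ω : ℕ → ℝ | absPath x ω (1 + n) ≤ A} :=
      measurableSet_le (measurable_absPath_right x _) measurable_const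
    have hm2 : MeasurableSet {ω : ℕ → ℝ | |x - partialSum ω (1 + n)| ≤ A} :=
      measurableSet_le (by fun_prop) measurable_const
    rw [add_comm n 1, measure_splice ν 1 hm1, measure_splice ν 1 hm2]
    refine lintegral_congr fun ω => ?_
    have h1 : ∀ η, absPath x (splice 1 ω η) (1 + n) = absPath |x - ω 0| η n := fun η => by
      rw [absPath_splice_add]; rfl
    have h2 : ∀ η, partialSum (splice 1 ω η) (1 + n) = ω 0 + partialSum η n := fun η => by
      rw [partialSum_shift]
      simp [partialSum, splice]
    simp only [mem_ofPred_eq, h1, h2]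
    rw [ih _ (abs_nonneg _)]
    simp only [← sub_sub]
    -- If the first step crosses the origin, symmetry of the later sums allows the starting point to
    -- be replaced by its absolute value.
    rcases le_total 0 (x - ω 0) with h | h
    · rw [abs_of_nonneg h]
    · rw [abs_of_nonpos h]
      exact measure_abs_sub_partialSum_neg hsym A (x - ω 0) n

theorem tsum_measure_abs_le_eq_top_of_recurrent (h : IsRecurrentSumWalk ν) :
    ∑' n, incrementLaw ν {ω | |partialSum ω n| ≤ 1} = ∞ := by
  by_contra hne
  have h1 := h (Ioo (-1) 1) isOpen_Ioo (by simp)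
  have h2 : ∀ᵐ ω ∂(incrementLaw ν), False := by
    filter_upwards [h1, ae_eventually_notMem hne] with ω hω hω'
    obtain ⟨n, hn, hn'⟩ := (hω.and_eventually hω').exists
    exact hn' (abs_le.2 ⟨hn.1.le, hn.2.le⟩)
  exact h2.exists.choose_spec

/-- If the series converged, Borel–Cantelli would give positive probability, for some `N`, to
staying outside `[-1, 1]` from time `N` on. At those multiples of `N` after which this occurs for
the shifted walk, the partial sums are pairwise more than `1` apart. The law of large numbers
confines them to an interval of sublinear length, so they have frequency zero and the event is null.
-/
theorem tsum_measure_abs_le_eq_top_of_integrable (hint : Integrable (fun y : ℝ => y) ν)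
    (hmean : ∫ y, y ∂ν = 0) : ∑' n, incrementLaw ν {ω | |partialSum ω n| ≤ 1} = ∞ := by
  by_contra hne
  have hBm : ∀ N, MeasurableSet {ω : ℕ → ℝ | ∀ m, N ≤ m → 1 < |partialSum ω m|} := by
    intro N
    simp only [ofPred_forall]
    exact .iInter fun m => .iInter fun _ => measurableSet_lt measurable_const (by fun_prop)
  have hnull : ∀ N, 0 < N →
      incrementLaw ν {ω : ℕ → ℝ | ∀ m, N ≤ m → 1 < |partialSum ω m|} = 0 := by
    intro N hN
    refine measure_eq_zero_of_frequency ν (hBm N) N ?_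
    filter_upwards [ae_abs_partialSum_le ν hint hmean] with ω hω ε hε
    have hN0 : (0 : ℝ) < N := by exact_mod_cast hN
    -- Up to time `J * N` the sums stay in an interval of length `2 * C + ε * J`; the constant `3`
    -- below absorbs the rounding in counting by integer parts.
    obtain ⟨C, hC⟩ := hω (ε / (2 * N)) (by positivity)
    refine ⟨2 * C + 3, fun J => ?_⟩
    classical
    set F := (Finset.range J).filter fun j =>
      ∀ m, N ≤ m → 1 < |partialSum (fun k => ω (j * N + k)) m|
    have hsum : ∑ j ∈ Finset.range J, ({ω : ℕ → ℝ | ∀ m, N ≤ m → 1 < |partialSum ω m|}).indicator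
        (fun _ => (1 : ℝ)) (fun k => ω (j * N + k)) = F.card := by
      simp only [indicator_apply, mem_ofPred_eq]
      rw [Finset.sum_boole]
    rw [hsum]
    have hsep : ∀ i ∈ F, ∀ j ∈ F, i < j →
        1 < |partialSum ω (j * N) - partialSum ω (i * N)| := by
      intro i hi j _ hij
      have h1 := (Finset.mem_filter.1 hi).2 ((j - i) * N)
        (Nat.le_mul_of_pos_left N (Nat.sub_pos_of_lt hij))
      have h2 : j * N = i * N + (j - i) * N := by
        rw [← add_mul, Nat.add_sub_cancel' hij.le]
      rwa [h2, partialSum_shift, add_sub_cancel_left]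
    set L : ℝ := C + ε / 2 * J
    have hL : ∀ j ∈ F, |partialSum ω (j * N)| ≤ L := by
      intro j hj
      refine (hC _).trans ?_
      have hjJ : (j : ℝ) ≤ J := by
        exact_mod_cast (Finset.mem_range.1 (Finset.mem_filter.1 hj).1).le
      have h3 : ε / (2 * N) * ((j * N : ℕ) : ℝ) = ε / 2 * j := by
        push_cast
        field_simp
      rw [h3]
      simp only [L]
      gcongr
    have hcard : F.card ≤ (Finset.Icc ⌊-L⌋ ⌊L⌋).card := by
      refine Finset.card_le_card_of_injOn (fun j => ⌊partialSum ω (j * N)⌋) (fun j hj => ?_) ?_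
      · have := abs_le.1 (hL j hj)
        exact Finset.mem_coe.2
          (Finset.mem_Icc.2 ⟨Int.floor_le_floor this.1, Int.floor_le_floor this.2⟩)
      · intro i hi j hj hij
        by_contra hne'
        have habs := Int.abs_sub_lt_one_of_floor_eq_floor hij
        rcases lt_or_gt_of_ne hne' with hlt | hlt
        · have := hsep i hi j hj hlt
          rw [abs_sub_comm] at this
          linarith
        · linarith [hsep j hj i hi hlt]
    have h4 : (F.card : ℝ) ≤ ((Finset.Icc ⌊-L⌋ ⌊L⌋).card : ℝ) := by exact_mod_cast hcard
    refine h4.trans ?_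
    rw [Int.card_Icc]
    have hL0 : 0 ≤ L := by
      have := (abs_nonneg _).trans (hC 0)
      simp only [Nat.cast_zero, mul_zero, add_zero] at this
      simp only [L]
      positivity
    have h5 : ((⌊L⌋ + 1 - ⌊-L⌋).toNat : ℝ) = ((⌊L⌋ + 1 - ⌊-L⌋ : ℤ) : ℝ) := by
      have : 0 ≤ ⌊L⌋ + 1 - ⌊-L⌋ := by
        have := Int.floor_le_floor (show -L ≤ L by linarith)
        omega
      exact_mod_cast congrArg (Int.cast (R := ℝ)) (Int.toNat_of_nonneg this)
    rw [h5]
    push_cast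
    have h6 := Int.floor_le L
    have h7 := Int.lt_floor_add_one (-L)
    have h8 : 2 * L = 2 * C + ε * J := by simp only [L]; ring
    linarith
  have hBC := ae_eventually_notMem hne
  have h2 : ∀ᵐ ω ∂(incrementLaw ν), False := by
    filter_upwards [hBC, ae_all_iff.2 fun N : ℕ =>
      measure_eq_zero_iff_ae_notMem.1 (hnull (N + 1) N.succ_pos)] with ω hω hω'
    obtain ⟨N, hN⟩ := eventually_atTop.1 hω
    refine hω' N fun m hm => not_le.1 (hN m (by omega))
  exact h2.exists.choose_spec

variable {ν} in
theorem SymmetricCriterion.ae_not_tendsto (h : SymmetricCriterion ν) :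
    ∀ᵐ ω ∂(incrementLaw ν), ¬ Tendsto (absPath 0 ω) atTop atTop := by
  obtain ⟨hsym, h⟩ := h
  have htop : ∑' n, incrementLaw ν {ω | |partialSum ω n| ≤ 1} = ∞ := by
    rcases h with h | h
    · exact tsum_measure_abs_le_eq_top_of_recurrent ν h
    · refine tsum_measure_abs_le_eq_top_of_integrable ν h ?_
      have h1 : ∫ y, y ∂(ν.map fun y => -y) = ∫ y, -y ∂ν :=
        integral_map measurable_neg.aemeasurable aestronglyMeasurable_id
      rw [hsym, integral_neg] at h1
      linarith
  refine ae_not_tendsto_of_green ν (A := 1) fun M hM => ⟨0, le_rfl, ?_⟩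
  have h2 : green ν 1 0 = ∞ := by
    rw [green, ← htop]
    congr 1
    funext n
    rw [measure_absPath_le hsym 1 n 0 le_rfl]
    simp
  rw [h2]
  exact hM.lt_top

end Sums

end ReflectedWalk

namespace ReflectedWalk

/-! ### Ascending ladder heights -/

section Ladder

/-- The partial sums are non-positive up to time `n`. -/
def below (n : ℕ) : Set (ℕ → ℝ) := {ω | ∀ m ≤ n, partialSum ω m ≤ 0}

/-- The first positive partial sum is the one with index `n + 1`. -/
def ladder (n : ℕ) : Set (ℕ → ℝ) := {ω | ω ∈ below n ∧ 0 < partialSum ω (n + 1)}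

theorem measurableSet_below (n : ℕ) : MeasurableSet (below n) := by
  unfold below
  simp only [ofPred_forall]
  exact .iInter fun m => .iInter fun _ =>
    measurableSet_le (measurable_partialSum m) measurable_const

theorem measurableSet_ladder (n : ℕ) : MeasurableSet (ladder n) :=
  (measurableSet_below n).inter (measurableSet_lt measurable_const (measurable_partialSum _))

theorem splice_mem_below {m n : ℕ} (h : m ≤ n) (ω η : ℕ → ℝ) :
    splice n ω η ∈ below m ↔ ω ∈ below m :=
  forall_congr' fun k => forall_congr' fun hk => by
    rw [partialSum_splice_of_le _ _ (hk.trans h)]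

theorem splice_mem_ladder (n : ℕ) (ω η : ℕ → ℝ) :
    splice (n + 1) ω η ∈ ladder n ↔ ω ∈ ladder n := by
  show _ ∧ _ ↔ _ ∧ _
  rw [splice_mem_below n.le_succ, partialSum_splice_of_le _ _ le_rfl]

theorem below_anti : Antitone below := fun _ _ hij _ hω m hm => hω m (hm.trans hij)

theorem pairwise_disjoint_ladder : Pairwise (Function.onFun Disjoint ladder) := by
  intro i j hij
  rw [Function.onFun, Set.disjoint_left]
  rintro ω ⟨hi, hi'⟩ ⟨hj, hj'⟩
  rcases lt_or_gt_of_ne hij with h | h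
  · exact absurd (hj (i + 1) h) (not_le.2 hi')
  · exact absurd (hi (j + 1) h) (not_le.2 hj')

theorem iUnion_ladder : ⋃ n, ladder n = (⋂ n, below n)ᶜ := by
  classical
  ext ω
  simp only [mem_iUnion, mem_compl_iff, mem_iInter]
  constructor
  · rintro ⟨n, -, hn⟩ h
    exact absurd (h (n + 1) (n + 1) le_rfl) (not_le.2 hn)
  · intro h
    have h1 : ∃ n, 0 < partialSum ω n := by
      by_contra! hcon
      exact h fun n m _ => hcon m
    have hspec := Nat.find_spec h1
    have hmin := fun m => Nat.find_min h1 (m := m)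
    obtain ⟨n, hn⟩ : ∃ n, Nat.find h1 = n + 1 := by
      refine Nat.exists_eq_succ_of_ne_zero fun h0 => ?_
      rw [h0, partialSum_zero] at hspec
      exact lt_irrefl _ hspec
    rw [hn] at hspec hmin
    exact ⟨n, fun m hm => not_lt.1 (hmin m (Nat.lt_succ_of_le hm)), hspec⟩

theorem absPath_eq_of_mem_below {x : ℝ} (hx : 0 ≤ x) {ω : ℕ → ℝ} {n : ℕ} (h : ω ∈ below n) :
    absPath x ω n = x - partialSum ω n := by
  induction n with
  | zero => simp [absPath]
  | succ n ih =>
    rw [absPath, ih (below_anti n.le_succ h), partialSum_succ, sub_sub, ← partialSum_succ,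
      abs_of_nonneg]
    linarith [h (n + 1) le_rfl]

/-- No reflection takes place while the partial sums are non-positive. Seen at ladder times, the
walk is thus a reflected walk with positive increments. -/
theorem absPath_eq_of_mem_ladder {x : ℝ} (hx : 0 ≤ x) {ω : ℕ → ℝ} {n : ℕ} (h : ω ∈ ladder n) :
    absPath x ω (n + 1) = |x - partialSum ω (n + 1)| := by
  rw [absPath, absPath_eq_of_mem_below hx h.1, partialSum_succ, sub_sub]

variable (ν : Measure ℝ) [IsProbabilityMeasure ν]

/-- The law of the first positive partial sum. -/
noncomputable def ladderLaw : Measure ℝ :=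
  Measure.sum fun n => ((incrementLaw ν).restrict (ladder n)).map fun ω => partialSum ω (n + 1)

theorem lintegral_ladderLaw {f : ℝ → ℝ≥0∞} (hf : Measurable f) :
    ∫⁻ t, f t ∂(ladderLaw ν) =
      ∑' n, ∫⁻ ω in ladder n, f (partialSum ω (n + 1)) ∂(incrementLaw ν) := by
  rw [ladderLaw, lintegral_sum_measure]
  congr 1
  funext n
  exact lintegral_map hf (measurable_partialSum _)

variable {ν} in
theorem isProbabilityMeasure_ladderLaw (h : incrementLaw ν (⋂ n, below n) = 0) :
    IsProbabilityMeasure (ladderLaw ν) := by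
  constructor
  have h1 := lintegral_ladderLaw ν (measurable_const (a := (1 : ℝ≥0∞)))
  simp only [lintegral_const, one_mul, Measure.restrict_apply_univ] at h1
  rw [h1, ← measure_iUnion pairwise_disjoint_ladder measurableSet_ladder, iUnion_ladder,
    prob_compl_eq_one_iff (.iInter measurableSet_below), h]

theorem ae_ladderLaw_pos : ∀ᵐ t ∂(ladderLaw ν), 0 < t := by
  have h : ladderLaw ν (Iic 0) = 0 := by
    rw [← lintegral_indicator_one measurableSet_Iic,
      lintegral_ladderLaw ν (measurable_one.indicator measurableSet_Iic), ENNReal.tsum_eq_zero]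
    intro n
    rw [setLIntegral_congr_fun (g := fun _ => 0) (measurableSet_ladder n), lintegral_zero]
    intro ω hω
    have h1 : partialSum ω (n + 1) ∉ Iic (0 : ℝ) := not_le.2 hω.2
    exact indicator_of_notMem h1 (1 : ℝ → ℝ≥0∞)
  filter_upwards [measure_eq_zero_iff_ae_notMem.1 h] with t ht
  exact not_le.1 ht

/-- The left side counts the visit at time zero and the visits from the first ladder time on. The
visits strictly between are lost, so the Green function is only superharmonic for the ladder walk,
which is all that is needed. -/
theorem green_ladder_le (A : ℝ) {x : ℝ} (hx : 0 ≤ x) :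
    (Iic A).indicator 1 x + ∫⁻ t, green ν A |x - t| ∂(ladderLaw ν) ≤ green ν A x := by
  have hgm : Measurable fun t => green ν A |x - t| := (measurable_green ν A).comp (by fun_prop)
  set V : ℕ → Set (ℕ → ℝ) := fun j => {ω | absPath x ω j ≤ A}
  have hV : ∀ j, MeasurableSet (V j) := fun j =>
    measurableSet_le (measurable_absPath_right x j) measurable_const
  have h1 : ∀ n, ∫⁻ ω in ladder n, green ν A |x - partialSum ω (n + 1)| ∂(incrementLaw ν) =
      ∑' m, incrementLaw ν (ladder n ∩ V (n + 1 + m)) := by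
    intro n
    have h2 : ∀ m, incrementLaw ν (ladder n ∩ V (n + 1 + m)) =
        ∫⁻ ω in ladder n, incrementLaw ν {η | absPath |x - partialSum ω (n + 1)| η m ≤ A}
          ∂(incrementLaw ν) := by
      intro m
      rw [measure_splice ν (n + 1) ((measurableSet_ladder n).inter (hV _)),
        ← lintegral_indicator (measurableSet_ladder n)]
      refine lintegral_congr fun ω => ?_
      by_cases hω : ω ∈ ladder n
      · rw [indicator_of_mem hω]
        congr 1
        ext η
        show splice (n + 1) ω η ∈ ladder n ∧ absPath x (splice (n + 1) ω η) (n + 1 + m) ≤ A ↔ _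
        rw [splice_mem_ladder, absPath_splice_add, absPath_eq_of_mem_ladder hx hω]
        exact and_iff_right hω
      · rw [indicator_of_notMem hω, ← measure_empty (μ := incrementLaw ν)]
        congr 1
        refine eq_empty_iff_forall_notMem.2 fun η hη => hω ?_
        exact (splice_mem_ladder n ω η).1 hη.1
    simp only [h2, green]
    refine lintegral_tsum fun m => ?_
    exact ((measurable_measure_prodMk_left (ν := incrementLaw ν)
      (measurableSet_le (measurable_absPath m) measurable_const)).comp
        (by fun_prop : Measurable fun ω : ℕ → ℝ => |x - partialSum ω (n + 1)|)).aemeasurable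
  rw [lintegral_ladderLaw ν hgm]
  simp only [h1]
  calc (Iic A).indicator 1 x + ∑' n, ∑' m, incrementLaw ν (ladder n ∩ V (n + 1 + m))
      ≤ (Iic A).indicator 1 x + ∑' n, ∑' j, incrementLaw ν (ladder n ∩ V (j + 1)) := by
        refine add_le_add_right (ENNReal.tsum_le_tsum fun n => ?_) _
        have h3 := ENNReal.tsum_comp_le_tsum_of_injective (f := fun m => n + m)
          (add_right_injective n) (fun j => incrementLaw ν (ladder n ∩ V (j + 1)))
        simpa only [add_right_comm] using h3
    _ = (Iic A).indicator 1 x + ∑' j, ∑' n, incrementLaw ν (ladder n ∩ V (j + 1)) := by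
        rw [ENNReal.tsum_comm]
    _ ≤ incrementLaw ν (V 0) + ∑' j, incrementLaw ν (V (j + 1)) := by
        gcongr with j
        · by_cases hxA : x ≤ A
          · simp [V, absPath, hxA]
          · rw [indicator_of_notMem (by exact hxA)]
            exact zero_le
        · rw [← measure_iUnion]
          · exact measure_mono (iUnion_subset fun n => inter_subset_right)
          · exact fun i j hij => (pairwise_disjoint_ladder hij).mono inter_subset_left
              inter_subset_left
          · exact fun n => (measurableSet_ladder n).inter (hV _)
    _ = green ν A x :=
        (tsum_eq_zero_add' (f := fun j => incrementLaw ν (V j)) ENNReal.summable).symm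

/-- A ladder height is `S n + ω n` with `S n ≤ 0 < S n + ω n`, hence at most `ω n`, and it requires
`-S n < ω n`. As `ω n` is independent of the past, summing over `n` gives the weight `V` at `ω n`.
-/
theorem momentPos_ladderLaw_le {V : ℝ → ℝ≥0∞}
    (hV : ∀ t, 0 < t → ∑' n, incrementLaw ν {ω | ω ∈ below n ∧ -partialSum ω n < t} ≤ V t) :
    momentPos (ladderLaw ν) (1 / 2) ≤
      ∫⁻ t, ENNReal.ofReal (max t 0 ^ (1 / 2 : ℝ)) * V t ∂ν := by
  set φ : ℝ → ℝ≥0∞ := fun t => ENNReal.ofReal (max t 0 ^ (1 / 2 : ℝ))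
  have hφ : Measurable φ := by fun_prop
  have hφmono : Monotone φ := fun a b hab =>
    ENNReal.ofReal_le_ofReal (Real.rpow_le_rpow (le_max_right _ _) (max_le_max_right 0 hab)
      (by norm_num))
  set D : ℕ → ℝ → Set (ℕ → ℝ) := fun n t => {ω | ω ∈ below n ∧ -partialSum ω n < t}
  have hD : ∀ n, MeasurableSet {p : (ℕ → ℝ) × ℝ | p.1 ∈ D n p.2} := fun n =>
    (measurable_fst (measurableSet_below n)).inter
      (measurableSet_lt (by fun_prop) measurable_snd)
  have hDn : ∀ n, Measurable fun t => incrementLaw ν (D n t) := fun n =>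
    measurable_measure_prodMk_right (μ := incrementLaw ν) (hD n)
  have h1 : ∀ n, ∫⁻ ω in ladder n, φ (partialSum ω (n + 1)) ∂(incrementLaw ν) ≤
      ∫⁻ t, φ t * incrementLaw ν (D n t) ∂ν := by
    intro n
    set G : (ℕ → ℝ) × ℝ → ℝ≥0∞ := {p : (ℕ → ℝ) × ℝ | p.1 ∈ D n p.2}.indicator fun p => φ p.2
    have hG : Measurable G := (hφ.comp measurable_snd).indicator (hD n)
    calc ∫⁻ ω in ladder n, φ (partialSum ω (n + 1)) ∂(incrementLaw ν)
        ≤ ∫⁻ ω, G (ω, ω n) ∂(incrementLaw ν) := by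
          rw [← lintegral_indicator (measurableSet_ladder n)]
          refine lintegral_mono fun ω => ?_
          by_cases hω : ω ∈ ladder n
          · have h2 : partialSum ω n ≤ 0 := hω.1 n le_rfl
            have h3 := hω.2
            rw [partialSum_succ] at h3
            rw [indicator_of_mem hω, partialSum_succ]
            simp only [G]
            rw [indicator_of_mem (show (ω, ω n) ∈ {p : (ℕ → ℝ) × ℝ | p.1 ∈ D n p.2} from
              ⟨hω.1, by linarith⟩)]
            exact hφmono (by linarith)
          · rw [indicator_of_notMem hω]
            exact zero_le
      _ = ∫⁻ ω, ∫⁻ η, G (ω, η 0) ∂(incrementLaw ν) ∂(incrementLaw ν) := by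
          have hGn : Measurable fun ω : ℕ → ℝ => G (ω, ω n) :=
            hG.comp (by fun_prop : Measurable fun ω : ℕ → ℝ => (ω, ω n))
          rw [lintegral_splice ν n hGn]
          refine lintegral_congr fun ω => lintegral_congr fun η => ?_
          have h2 : splice n ω η n = η 0 := splice_add n ω η 0
          rw [h2]
          have h3 : splice n ω η ∈ D n (η 0) ↔ ω ∈ D n (η 0) := by
            show _ ∧ _ ↔ _ ∧ _
            rw [splice_mem_below le_rfl, partialSum_splice_of_le _ _ le_rfl]
          simp only [G]
          by_cases hω : ω ∈ D n (η 0)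
          · rw [indicator_of_mem (by exact h3.2 hω), indicator_of_mem (by exact hω)]
          · rw [indicator_of_notMem (by exact mt h3.1 hω), indicator_of_notMem (by exact hω)]
      _ = ∫⁻ ω, ∫⁻ t, G (ω, t) ∂ν ∂(incrementLaw ν) :=
          lintegral_congr fun ω => lintegral_apply ν 0 (hG.comp measurable_prodMk_left)
      _ = ∫⁻ t, ∫⁻ ω, G (ω, t) ∂(incrementLaw ν) ∂ν :=
          lintegral_lintegral_swap hG.aemeasurable
      _ = ∫⁻ t, φ t * incrementLaw ν (D n t) ∂ν := by
          refine lintegral_congr fun t => ?_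
          have hDt : MeasurableSet (D n t) := measurable_prodMk_right (y := t) (hD n)
          rw [← lintegral_indicator_const hDt]
          rfl
  change ∫⁻ t, φ t ∂(ladderLaw ν) ≤ _
  rw [lintegral_ladderLaw ν hφ]
  refine (ENNReal.tsum_le_tsum h1).trans ?_
  have hφD : ∀ n, Measurable fun t => φ t * incrementLaw ν (D n t) := fun n => hφ.mul (hDn n)
  rw [← lintegral_tsum fun n => (hφD n).aemeasurable]
  refine lintegral_mono fun t => ?_
  rw [ENNReal.tsum_mul_left]
  rcases lt_or_ge 0 t with ht | ht
  · exact mul_le_mul_right (hV t ht) _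
  · have : φ t = 0 := by
      simp only [φ, max_eq_right ht]
      rw [Real.zero_rpow (by norm_num), ENNReal.ofReal_zero]
    simp [this]

/-- Recurrence by means of ladder heights. -/
theorem ae_not_tendsto_of_ladder (h : incrementLaw ν (⋂ n, below n) = 0) {V : ℝ → ℝ≥0∞}
    (hV : ∀ t, 0 < t → ∑' n, incrementLaw ν {ω | ω ∈ below n ∧ -partialSum ω n < t} ≤ V t)
    (hint : ∫⁻ t, ENNReal.ofReal (max t 0 ^ (1 / 2 : ℝ)) * V t ∂ν < ∞) :
    ∀ᵐ ω ∂(incrementLaw ν), ¬ Tendsto (absPath 0 ω) atTop atTop := by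
  have := isProbabilityMeasure_ladderLaw h
  have hmom := (momentPos_ladderLaw_le ν hV).trans_lt hint
  have hpos : 0 < ladderLaw ν (Ioi 0) := by
    have : ladderLaw ν (Ioi 0) = 1 :=
      (prob_compl_eq_zero_iff measurableSet_Ioi).1 (ae_ladderLaw_pos ν)
    rw [this]
    exact one_pos
  exact ae_not_tendsto_of_green ν fun M hM => exists_lt_of_superharmonic (ladderLaw ν)
    ((ae_ladderLaw_pos ν).mono fun t ht => ht.le) hpos
    (tendsto_of_setLIntegral_sq _ (setLIntegral_sq_lt_top _ hmom)) one_pos (measurable_green ν 1)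
    (fun x hx => green_ladder_le ν 1 hx) hM

/-! ### Drift to plus infinity -/

/-- Before the first positive sum, the positive parts do not outweigh the negative ones; only the
increment that makes the sum positive does, and its truncation is at most `K`. -/
theorem sum_indicator_below_le (K : ℝ) (hK : 0 ≤ K) (ω : ℕ → ℝ) (N : ℕ) :
    ∑ n ∈ Finset.range N, (below n).indicator 1 ω * min (max (ω n) 0) K ≤
      K + ∑ n ∈ Finset.range N, (below n).indicator 1 ω * max (-ω n) 0 := by
  induction N with
  | zero => simpa using hK
  | succ N ih =>
    rw [Finset.sum_range_succ, Finset.sum_range_succ]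
    by_cases hN : ω ∈ below N
    · have h1 : ∀ n ∈ Finset.range N, (below n).indicator (1 : (ℕ → ℝ) → ℝ) ω = 1 := fun n hn => by
        rw [indicator_of_mem (below_anti (Finset.mem_range.1 hn).le hN), Pi.one_apply]
      have h2 : ∑ n ∈ Finset.range N,
          (below n).indicator (1 : (ℕ → ℝ) → ℝ) ω * min (max (ω n) 0) K ≤
          ∑ n ∈ Finset.range N, (below n).indicator (1 : (ℕ → ℝ) → ℝ) ω * max (-ω n) 0 +
            partialSum ω N := by
        rw [partialSum, ← Finset.sum_add_distrib]
        refine Finset.sum_le_sum fun n hn => ?_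
        rw [h1 n hn, one_mul, one_mul]
        refine (min_le_left _ _).trans (max_le ?_ ?_)
        · linarith [le_max_right (-ω n) 0]
        · linarith [le_max_left (-ω n) 0]
      rw [indicator_of_mem hN, Pi.one_apply, one_mul, one_mul]
      linarith [hN N le_rfl, min_le_right (max (ω N) 0) K, le_max_right (-ω N) 0]
    · rw [indicator_of_notMem hN, zero_mul, zero_mul]
      linarith

/-- The series is the mean of the first ladder time. `K` is chosen so that the truncated positive
mean `a` still exceeds `meanNeg ν`, and Wald's identity bounds the series by `K / (a - meanNeg ν)`.
-/
theorem tsum_measure_below_lt_top (h : meanNeg ν < meanPos ν) :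
    ∑' n, incrementLaw ν (below n) < ∞ := by
  set f : ℕ → ℝ → ℝ≥0∞ := fun K t => ENNReal.ofReal (min (max t 0) K)
  have hf : ∀ K, Measurable (f K) := fun K => by fun_prop
  have hm' : Measurable fun t : ℝ => ENNReal.ofReal (max (-t) 0) := by fun_prop
  have hsup : ∫⁻ t, ⨆ K, f K t ∂ν = ⨆ K, ∫⁻ t, f K t ∂ν :=
    lintegral_iSup hf fun K L hKL t =>
      ENNReal.ofReal_le_ofReal (min_le_min_left _ (by exact_mod_cast hKL))
  have hsup' : ∫⁻ t, ⨆ K, f K t ∂ν = meanPos ν := by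
    refine lintegral_congr fun t => le_antisymm
      (iSup_le fun K => ENNReal.ofReal_le_ofReal (min_le_left _ _)) ?_
    obtain ⟨K, hK⟩ := exists_nat_ge (max t 0)
    refine le_iSup_of_le K ?_
    simp only [f, min_eq_left hK, le_refl]
  rw [← hsup', hsup] at h
  obtain ⟨K, hK⟩ := lt_iSup_iff.1 h
  set a := ∫⁻ t, f K t ∂ν
  have ha : a ≠ ∞ := by
    refine ne_top_of_le_ne_top (ENNReal.natCast_ne_top K) ?_
    refine (lintegral_mono (g := fun _ => (K : ℝ≥0∞)) fun t => ?_).trans (by simp)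
    rw [← ENNReal.ofReal_natCast]
    exact ENNReal.ofReal_le_ofReal (min_le_right _ _)
  have hbm : ∀ n, Measurable ((below n).indicator (1 : (ℕ → ℝ) → ℝ≥0∞)) := fun n =>
    measurable_one.indicator (measurableSet_below n)
  have hwald : ∀ {g : ℝ → ℝ≥0∞}, Measurable g → ∀ N,
      ∫⁻ ω, ∑ n ∈ Finset.range N, (below n).indicator 1 ω * g (ω n) ∂(incrementLaw ν) =
        (∑ n ∈ Finset.range N, incrementLaw ν (below n)) * ∫⁻ t, g t ∂ν := by
    intro g hg N
    have hgm : ∀ n, Measurable fun ω : ℕ → ℝ =>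
        (below n).indicator (1 : (ℕ → ℝ) → ℝ≥0∞) ω * g (ω n) := fun n =>
      (hbm n).mul (hg.comp (measurable_pi_apply n))
    rw [lintegral_finsetSum _ fun n _ => hgm n, Finset.sum_mul]
    refine Finset.sum_congr rfl fun n _ => ?_
    rw [lintegral_mul_apply ν n (hbm n) (fun ω η => ?_) hg,
      lintegral_indicator_one (measurableSet_below n)]
    by_cases hω : ω ∈ below n
    · rw [indicator_of_mem hω, indicator_of_mem ((splice_mem_below le_rfl ω η).2 hω)]
      rfl
    · rw [indicator_of_notMem hω, indicator_of_notMem (mt (splice_mem_below le_rfl ω η).1 hω)]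
  have key : ∀ N, ∑ n ∈ Finset.range N, incrementLaw ν (below n) ≤ K / (a - meanNeg ν) := by
    intro N
    set p := ∑ n ∈ Finset.range N, incrementLaw ν (below n)
    have hp : p ≠ ∞ := ENNReal.sum_ne_top.2 fun n _ => measure_ne_top _ _
    have h1 : p * a ≤ K + p * meanNeg ν := by
      rw [← hwald (hf K), meanNeg, ← hwald hm']
      calc ∫⁻ ω, ∑ n ∈ Finset.range N, (below n).indicator 1 ω * f K (ω n) ∂(incrementLaw ν)
          ≤ ∫⁻ ω, (K + ∑ n ∈ Finset.range N, (below n).indicator 1 ω *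
              ENNReal.ofReal (max (-ω n) 0)) ∂(incrementLaw ν) := by
            refine lintegral_mono fun ω => ?_
            have h2 := ENNReal.ofReal_le_ofReal (sum_indicator_below_le K (Nat.cast_nonneg K) ω N)
            have h3 : ∀ {b : ℕ → ℝ} (_ : ∀ n, 0 ≤ b n) (n : ℕ),
                ENNReal.ofReal ((below n).indicator 1 ω * b n) =
                  (below n).indicator 1 ω * ENNReal.ofReal (b n) := by
              intro b _ n
              by_cases hn : ω ∈ below n <;> simp [hn]
            have h4 : ∀ {b : ℕ → ℝ} (_ : ∀ n, 0 ≤ b n) (n : ℕ),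
                0 ≤ (below n).indicator 1 ω * b n := by
              intro b hb n
              by_cases hn : ω ∈ below n <;> simp [hn, hb]
            have h5 : ∀ n, 0 ≤ min (max (ω n) 0) (K : ℝ) := fun n =>
              le_min (le_max_right _ _) (Nat.cast_nonneg K)
            have h6 : ∀ n, 0 ≤ max (-ω n) 0 := fun n => le_max_right _ _
            rw [ENNReal.ofReal_add (Nat.cast_nonneg K) (Finset.sum_nonneg fun n _ => h4 h6 n),
              ENNReal.ofReal_sum_of_nonneg fun n _ => h4 h5 n,
              ENNReal.ofReal_sum_of_nonneg fun n _ => h4 h6 n, ENNReal.ofReal_natCast] at h2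
            simpa only [h3 h5, h3 h6] using h2
        _ = _ := by
            rw [lintegral_add_left measurable_const, lintegral_const, measure_univ, mul_one]
    rw [ENNReal.le_div_iff_mul_le (Or.inl (tsub_pos_of_lt hK).ne')
      (Or.inl (ENNReal.sub_ne_top ha)), ENNReal.mul_sub fun _ _ => hp]
    exact tsub_le_iff_right.2 h1
  refine (ENNReal.tsum_le_of_sum_range_le key).trans_lt ?_
  exact ENNReal.div_lt_top (ENNReal.natCast_ne_top K) (tsub_pos_of_lt hK).ne'

-- The bound `V` may be taken constant, the mean ladder time, so the moment of order `1/2` of `ν`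
-- suffices.
variable {ν} in
theorem DriftCriterion.ae_not_tendsto (h : DriftCriterion ν) :
    ∀ᵐ ω ∂(incrementLaw ν), ¬ Tendsto (absPath 0 ω) atTop atTop := by
  obtain ⟨hlt, -, hmom⟩ := h
  have hfin := tsum_measure_below_lt_top ν hlt
  refine ae_not_tendsto_of_ladder ν ?_ (V := fun _ => ∑' n, incrementLaw ν (below n))
    (fun t _ => ENNReal.tsum_le_tsum fun n => measure_mono fun ω hω => hω.1) ?_
  · by_contra hne
    refine hfin.ne (top_unique ?_)
    rw [← ENNReal.tsum_const_eq_top_of_ne_zero (α := ℕ) hne]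
    exact ENNReal.tsum_le_tsum fun j => measure_mono (iInter_subset _ j)
  · rw [lintegral_mul_const _ (by fun_prop)]
    exact ENNReal.mul_lt_top hmom hfin

end Ladder

end ReflectedWalk

namespace ReflectedWalk

/-! ### Centred increments -/

section Centred

variable (ν : Measure ℝ) [IsProbabilityMeasure ν]

/-- Let `B` be the event that the first step is at most `-a` and the walk never rises above its new
level afterwards. Each occurrence of `B` along the walk lowers it by `a` for good, so a positive
frequency would contradict the law of large numbers. Hence `B` is null, and by independence its
probability is `ν (Iic (-a))` times the one in question. -/
theorem measure_iInter_below_eq_zero (hint : Integrable (fun y : ℝ => y) ν)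
    (hmean : ∫ y, y ∂ν = 0) {a : ℝ} (ha : 0 < a) (hνa : 0 < ν (Iic (-a))) :
    incrementLaw ν (⋂ n, below n) = 0 := by
  set B : Set (ℕ → ℝ) := {ω | ω 0 ≤ -a ∧ (fun k => ω (1 + k)) ∈ ⋂ n, below n}
  have hbm : MeasurableSet (⋂ n, below n) := .iInter measurableSet_below
  have hBm : MeasurableSet B :=
    (measurableSet_le (measurable_pi_apply 0) measurable_const).inter (measurable_shift 1 hbm)
  have hB0 : incrementLaw ν B = 0 := by
    refine measure_eq_zero_of_frequency ν hBm 1 ?_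
    filter_upwards [ae_abs_partialSum_le ν hint hmean] with ω hω ε hε
    obtain ⟨C, hC⟩ := hω (ε * a) (by positivity)
    have hstep : ∀ j, (fun k => ω (j * 1 + k)) ∈ B → ∀ m, j + 1 ≤ m →
        partialSum ω m ≤ partialSum ω j - a := by
      intro j hj m hm
      obtain ⟨k, rfl⟩ : ∃ k, m = (j + 1) + k := ⟨m - (j + 1), by omega⟩
      have h1 : ω j ≤ -a := by simpa using hj.1
      have h2 : partialSum (fun k => ω (j + 1 + k)) k ≤ 0 := by
        have h3 := mem_iInter.1 hj.2 k k le_rfl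
        simpa only [mul_one, ← add_assoc] using h3
      rw [partialSum_shift, partialSum_succ]
      linarith
    by_cases hex : ∃ j, (fun k => ω (j * 1 + k)) ∈ B
    · obtain ⟨j₀, hj₀⟩ := hex
      set D := ∑ i ∈ Finset.range (j₀ + 1), |partialSum ω i|
      have hle : ∀ i ≤ j₀, partialSum ω i ≤ D := fun i hi => (le_abs_self _).trans
        (Finset.single_le_sum (f := fun i => |partialSum ω i|) (fun i _ => abs_nonneg _)
          (Finset.mem_range.2 (Nat.lt_succ_of_le hi)))
      have hD : ∀ m, partialSum ω m ≤ D := by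
        intro m
        rcases le_or_gt m j₀ with hm | hm
        · exact hle m hm
        · linarith [hstep j₀ hj₀ m hm, hle j₀ le_rfl]
      -- Starting from the upper bound `D`, every occurrence before time `J` costs at least `a`.
      have hcount : ∀ J m : ℕ, J ≤ m → (∑ j ∈ Finset.range J,
          B.indicator (fun _ => (1 : ℝ)) (fun k => ω (j * 1 + k))) * a ≤ D - partialSum ω m := by
        intro J
        induction J with
        | zero =>
          intro m _
          simpa using hD m
        | succ J ih =>
          intro m hm
          rw [Finset.sum_range_succ]
          by_cases hJ : (fun k => ω (J * 1 + k)) ∈ B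
          · rw [indicator_of_mem hJ]
            linarith [ih J le_rfl, hstep J hJ m hm]
          · rw [indicator_of_notMem hJ, add_zero]
            exact ih m (by omega)
      refine ⟨(D + C) / a, fun J => ?_⟩
      have h1 := hcount J J le_rfl
      have h2 := (abs_le.1 (hC J)).1
      rw [← mul_le_mul_iff_left₀ ha]
      have h3 : ((D + C) / a + ε * J) * a = D + C + ε * a * J := by field_simp
      rw [h3]
      linarith
    · push Not at hex
      refine ⟨0, fun J => ?_⟩
      rw [Finset.sum_eq_zero fun j _ => indicator_of_notMem (hex j) _]
      positivity
  rw [measure_splice ν 1 hBm] at hB0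
  have h1 : ∀ ω : ℕ → ℝ, incrementLaw ν {η | splice 1 ω η ∈ B} =
      (Iic (-a)).indicator (fun _ => incrementLaw ν (⋂ n, below n)) (ω 0) := by
    intro ω
    have h2 : ∀ η, splice 1 ω η ∈ B ↔ ω 0 ≤ -a ∧ η ∈ ⋂ n, below n := by
      intro η
      have h3 : (fun k => splice 1 ω η (1 + k)) = η := funext fun k => splice_add 1 ω η k
      show splice 1 ω η 0 ≤ -a ∧ (fun k => splice 1 ω η (1 + k)) ∈ _ ↔ _
      rw [h3, splice_of_lt _ _ one_pos]
    simp only [h2]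
    by_cases hω : ω 0 ≤ -a
    · rw [indicator_of_mem (by exact hω)]
      simp only [hω, true_and]
      rfl
    · rw [indicator_of_notMem (by exact hω)]
      simp [hω]
  simp only [h1] at hB0
  rw [lintegral_apply ν 0 (measurable_const.indicator measurableSet_Iic),
    lintegral_indicator_const measurableSet_Iic] at hB0
  exact (mul_eq_zero.1 hB0).resolve_right hνa.ne'

/-- Reversal of the first `n` entries of a sequence. -/
def reverse (n : ℕ) (ω : ℕ → ℝ) : ℕ → ℝ := fun k => ω (if k < n then n - 1 - k else k)

theorem map_reverse (n : ℕ) : (incrementLaw ν).map (reverse n) = incrementLaw ν := by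
  refine Measure.map_infinitePi_infinitePi_of_inj (P := fun _ : ℕ => ν)
    (f := fun k => if k < n then n - 1 - k else k) fun i j hij => ?_
  simp only at hij
  split_ifs at hij <;> omega

theorem partialSum_reverse (n : ℕ) (ω : ℕ → ℝ) {m : ℕ} (hm : m ≤ n) :
    partialSum (reverse n ω) m = partialSum ω n - partialSum ω (n - m) := by
  induction m with
  | zero => simp
  | succ m ih =>
    have h1 : n - m = (n - (m + 1)) + 1 := by omega
    have h2 : reverse n ω m = ω (n - (m + 1)) := by
      rw [reverse, if_pos (by omega)]
      congr 1
      omega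
    rw [partialSum_succ, ih (by omega), h1, partialSum_succ, h2]
    ring

/-- The partial sums have a running minimum, of modulus less than `t`, at time `n`. -/
def runningMin (t : ℝ) (n : ℕ) : Set (ℕ → ℝ) :=
  {ω | (∀ m ≤ n, partialSum ω n ≤ partialSum ω m) ∧ -partialSum ω n < t}

theorem measurableSet_runningMin (t : ℝ) (n : ℕ) : MeasurableSet (runningMin t n) := by
  refine MeasurableSet.inter (s₁ := {ω | ∀ m ≤ n, partialSum ω n ≤ partialSum ω m}) ?_
    (measurableSet_lt (measurable_partialSum n).neg measurable_const)
  simp only [ofPred_forall]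
  exact .iInter fun m => .iInter fun _ =>
    measurableSet_le (measurable_partialSum n) (measurable_partialSum m)

theorem splice_mem_runningMin (t : ℝ) (n : ℕ) (ω η : ℕ → ℝ) :
    splice n ω η ∈ runningMin t n ↔ ω ∈ runningMin t n := by
  refine and_congr (forall_congr' fun m => forall_congr' fun hm => ?_) ?_
  · rw [partialSum_splice_of_le _ _ le_rfl, partialSum_splice_of_le _ _ hm]
  · rw [partialSum_splice_of_le _ _ le_rfl]

/-- Reversing the first `n` increments preserves the law and turns non-positive partial sums into a
running minimum at time `n`. -/
theorem measure_below_eq_measure_runningMin (t : ℝ) (n : ℕ) :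
    incrementLaw ν {ω | ω ∈ below n ∧ -partialSum ω n < t} = incrementLaw ν (runningMin t n) := by
  have hm : Measurable (reverse n) := measurable_pi_lambda _ fun k => measurable_pi_apply _
  have hD : MeasurableSet {ω : ℕ → ℝ | ω ∈ below n ∧ -partialSum ω n < t} :=
    (measurableSet_below n).inter
      (measurableSet_lt (measurable_partialSum n).neg measurable_const)
  conv_lhs => rw [← map_reverse ν n]
  rw [Measure.map_apply hm hD]
  congr 1
  ext ω
  refine and_congr ⟨fun h m hm => ?_, fun h m hm => ?_⟩ ?_
  · have h1 := h (n - m) (Nat.sub_le n m)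
    rw [partialSum_reverse n ω (Nat.sub_le n m), Nat.sub_sub_self hm] at h1
    linarith
  · rw [partialSum_reverse n ω hm]
    linarith [h (n - m) (Nat.sub_le n m)]
  · rw [partialSum_reverse n ω le_rfl, Nat.sub_self, partialSum_zero, sub_zero]

/-- A running minimum followed by a step of at most `-a` creates a level lower by `a`. The counted
minima lie above `-t`, and the summand `a` accounts for the last such step. -/
theorem sum_runningMin_le {a t : ℝ} (ha : 0 < a) (ht : 0 < t) (ω : ℕ → ℝ) (N : ℕ) :
    (∑ n ∈ Finset.range N, (runningMin t n).indicator 1 ω * (Iic (-a)).indicator 1 (ω n)) * a ≤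
      t + a := by
  -- The induction also carries a time `j` at which the walk has already descended by the counted
  -- amount.
  suffices h : (∃ j ≤ N, (∑ n ∈ Finset.range N, (runningMin t n).indicator 1 ω *
      (Iic (-a)).indicator 1 (ω n)) * a ≤ -partialSum ω j) ∧
      (∑ n ∈ Finset.range N, (runningMin t n).indicator 1 ω *
        (Iic (-a)).indicator 1 (ω n)) * a ≤ t + a from h.2
  induction N with
  | zero => exact ⟨⟨0, le_rfl, by simp⟩, by simpa using (add_pos ht ha).le⟩
  | succ N ih =>
    obtain ⟨⟨j, hj, h1⟩, h2⟩ := ih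
    rw [Finset.sum_range_succ]
    by_cases hN : ω ∈ runningMin t N ∧ ω N ≤ -a
    · have h3 := hN.1.1 j hj
      have h4 := hN.1.2
      rw [indicator_of_mem hN.1, indicator_of_mem (show ω N ∈ Iic (-a) from hN.2), Pi.one_apply,
        Pi.one_apply, mul_one]
      refine ⟨⟨N + 1, le_rfl, ?_⟩, by linarith⟩
      rw [partialSum_succ]
      linarith [hN.2]
    · have h3 : (runningMin t N).indicator (1 : (ℕ → ℝ) → ℝ) ω *
          (Iic (-a)).indicator (1 : ℝ → ℝ) (ω N) = 0 := by
        by_cases h4 : ω ∈ runningMin t N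
        · rw [indicator_of_notMem (show ω N ∉ Iic (-a) from fun h5 => hN ⟨h4, h5⟩), mul_zero]
        · rw [indicator_of_notMem h4, zero_mul]
      rw [h3, add_zero]
      exact ⟨⟨j, hj.trans N.le_succ, h1⟩, h2⟩

/-- The step after a running minimum is independent of it, so the mean of the preceding count is the
series times `ν (Iic (-a))`. The bound is linear in `t`; multiplied by `√t` it leads to the moment
of order `3/2`. -/
theorem tsum_measure_below_le {a t : ℝ} (ha : 0 < a) (hνa : 0 < ν (Iic (-a))) (ht : 0 < t) :
    ∑' n, incrementLaw ν {ω | ω ∈ below n ∧ -partialSum ω n < t} ≤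
      ENNReal.ofReal ((max t 0 + a) / a) / ν (Iic (-a)) := by
  simp only [measure_below_eq_measure_runningMin]
  refine ENNReal.tsum_le_of_sum_range_le fun N => ?_
  rw [ENNReal.le_div_iff_mul_le (Or.inl hνa.ne') (Or.inl (measure_ne_top _ _)), Finset.sum_mul]
  have hrm : ∀ n, Measurable ((runningMin t n).indicator (1 : (ℕ → ℝ) → ℝ≥0∞)) := fun n =>
    measurable_one.indicator (measurableSet_runningMin t n)
  have hIm : Measurable ((Iic (-a)).indicator (1 : ℝ → ℝ≥0∞)) :=
    measurable_one.indicator measurableSet_Iic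
  have hgm : ∀ n, Measurable fun ω : ℕ → ℝ => (runningMin t n).indicator (1 : (ℕ → ℝ) → ℝ≥0∞) ω *
      (Iic (-a)).indicator (1 : ℝ → ℝ≥0∞) (ω n) := fun n =>
    (hrm n).mul (hIm.comp (measurable_pi_apply n))
  have h1 : ∀ n, incrementLaw ν (runningMin t n) * ν (Iic (-a)) =
      ∫⁻ ω, (runningMin t n).indicator 1 ω * (Iic (-a)).indicator 1 (ω n) ∂(incrementLaw ν) := by
    intro n
    rw [lintegral_mul_apply ν n (hrm n) (fun ω η => ?_) hIm,
      lintegral_indicator_one (measurableSet_runningMin t n),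
      lintegral_indicator_one measurableSet_Iic]
    by_cases hω : ω ∈ runningMin t n
    · rw [indicator_of_mem hω, indicator_of_mem ((splice_mem_runningMin t n ω η).2 hω)]
      rfl
    · rw [indicator_of_notMem hω, indicator_of_notMem (mt (splice_mem_runningMin t n ω η).1 hω)]
  simp only [h1]
  rw [← lintegral_finsetSum _ fun n _ => hgm n]
  refine (lintegral_mono (g := fun _ => ENNReal.ofReal ((max t 0 + a) / a)) fun ω => ?_).trans
    (by simp)
  have h2 : ∀ n, (runningMin t n).indicator (1 : (ℕ → ℝ) → ℝ≥0∞) ω *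
      (Iic (-a)).indicator (1 : ℝ → ℝ≥0∞) (ω n) =
      ENNReal.ofReal ((runningMin t n).indicator (1 : (ℕ → ℝ) → ℝ) ω *
        (Iic (-a)).indicator (1 : ℝ → ℝ) (ω n)) := by
    intro n
    by_cases h3 : ω ∈ runningMin t n <;> by_cases h4 : ω n ∈ Iic (-a) <;>
      simp only [indicator_of_mem, indicator_of_notMem, h3, h4, not_false_iff, Pi.one_apply,
        mul_one, mul_zero, ENNReal.ofReal_one, ENNReal.ofReal_zero]
  simp only [h2]
  have h5 : ∀ n ∈ Finset.range N, 0 ≤ (runningMin t n).indicator (1 : (ℕ → ℝ) → ℝ) ω *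
      (Iic (-a)).indicator (1 : ℝ → ℝ) (ω n) := fun n _ => mul_nonneg
    (indicator_nonneg (fun _ _ => zero_le_one) _) (indicator_nonneg (fun _ _ => zero_le_one) _)
  rw [← ENNReal.ofReal_sum_of_nonneg h5]
  refine ENNReal.ofReal_le_ofReal ?_
  rw [le_div_iff₀ ha, max_eq_left ht.le]
  exact sum_runningMin_le ha ht ω N

variable {ν}

theorem CentredCriterion.meanPos_ne_top (h : CentredCriterion ν) : meanPos ν ≠ ∞ := by
  have h1 : meanPos ν ≤ ∫⁻ t, (1 + ENNReal.ofReal (max t 0 ^ (3 / 2 : ℝ))) ∂ν := by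
    refine lintegral_mono fun t => ?_
    rw [← ENNReal.ofReal_one, ← ENNReal.ofReal_add zero_le_one (by positivity)]
    refine ENNReal.ofReal_le_ofReal ?_
    set u := max t 0
    have hu : 0 ≤ u := le_max_right _ _
    rcases le_total u 1 with h1 | h1
    · have : 0 ≤ u ^ (3 / 2 : ℝ) := by positivity
      linarith
    · have := Real.rpow_le_rpow_of_exponent_le h1 (by norm_num : (1 : ℝ) ≤ 3 / 2)
      rw [Real.rpow_one] at this
      linarith
  rw [lintegral_add_left measurable_const, lintegral_const, measure_univ, mul_one] at h1
  exact ne_top_of_le_ne_top (ENNReal.add_ne_top.2 ⟨by simp, h.2.2.ne⟩) h1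

theorem integrable_of_mean_ne_top (h1 : meanPos ν ≠ ∞) (h2 : meanNeg ν ≠ ∞) :
    Integrable (fun y : ℝ => y) ν := by
  refine ⟨aestronglyMeasurable_id, ?_⟩
  have h3 : ∀ y : ℝ, ‖y‖ₑ = ENNReal.ofReal (max y 0) + ENNReal.ofReal (max (-y) 0) := by
    intro y
    rw [← ofReal_norm, ← ENNReal.ofReal_add (le_max_right _ _) (le_max_right _ _),
      Real.norm_eq_abs]
    congr 1
    rcases le_total 0 y with h | h
    · rw [abs_of_nonneg h, max_eq_left h, max_eq_right (by linarith), add_zero]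
    · rw [abs_of_nonpos h, max_eq_right h, max_eq_left (by linarith), zero_add]
  rw [HasFiniteIntegral]
  simp only [h3]
  rw [lintegral_add_left (by fun_prop)]
  exact ENNReal.add_lt_top.2 ⟨h1.lt_top, h2.lt_top⟩

theorem integral_eq_zero_of_mean_eq (hint : Integrable (fun y : ℝ => y) ν)
    (h : meanNeg ν = meanPos ν) : ∫ y, y ∂ν = 0 := by
  rw [integral_eq_lintegral_pos_part_sub_lintegral_neg_part hint, sub_eq_zero]
  congr 1
  have h1 : ∀ y : ℝ, ENNReal.ofReal (max y 0) = ENNReal.ofReal y := fun y => by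
    rcases le_total 0 y with h | h
    · rw [max_eq_left h]
    · rw [max_eq_right h, ENNReal.ofReal_zero, ENNReal.ofReal_of_nonpos h]
  have h2 := h.symm
  simp only [meanPos, meanNeg, h1] at h2
  exact h2

theorem exists_measure_Iic_pos (h : 0 < meanNeg ν) : ∃ a : ℝ, 0 < a ∧ 0 < ν (Iic (-a)) := by
  by_contra! hcon
  refine h.ne' ?_
  rw [meanNeg, lintegral_eq_zero_iff (by fun_prop)]
  have h1 : ∀ n : ℕ, ∀ᵐ t ∂ν, t ∉ Iic (-(1 / (n + 1 : ℝ))) := fun n =>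
    measure_eq_zero_iff_ae_notMem.1 (le_zero_iff.1 (hcon _ (by positivity)))
  filter_upwards [ae_all_iff.2 h1] with t ht
  have h2 : 0 ≤ t := by
    by_contra! hneg
    obtain ⟨n, hn⟩ := exists_nat_one_div_lt (neg_pos.2 hneg)
    exact ht n (by rw [mem_Iic]; linarith)
  simp [h2]

theorem CentredCriterion.ae_not_tendsto (h : CentredCriterion ν) :
    ∀ᵐ ω ∂(incrementLaw ν), ¬ Tendsto (absPath 0 ω) atTop atTop := by
  have hfin := h.meanPos_ne_top
  have hint := integrable_of_mean_ne_top hfin (by rw [h.2.1]; exact hfin)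
  obtain ⟨a, ha, hνa⟩ := exists_measure_Iic_pos h.1
  refine ae_not_tendsto_of_ladder ν
    (measure_iInter_below_eq_zero ν hint (integral_eq_zero_of_mean_eq hint h.2.1) ha hνa)
    (fun t ht => tsum_measure_below_le ν ha hνa ht) ?_
  have h1 : ∀ t : ℝ, ENNReal.ofReal (max t 0 ^ (1 / 2 : ℝ)) *
      (ENNReal.ofReal ((max t 0 + a) / a) / ν (Iic (-a))) ≤
      (1 + ENNReal.ofReal (1 + 1 / a) * ENNReal.ofReal (max t 0 ^ (3 / 2 : ℝ))) *
        (ν (Iic (-a)))⁻¹ := by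
    intro t
    rw [ENNReal.div_eq_inv_mul, mul_comm (ν (Iic (-a)))⁻¹, ← mul_assoc,
      ← ENNReal.ofReal_mul (by positivity),
      ← ENNReal.ofReal_mul (by positivity), ← ENNReal.ofReal_one,
      ← ENNReal.ofReal_add zero_le_one (by positivity)]
    gcongr
    set u := max t 0
    have hu : 0 ≤ u := le_max_right _ _
    have h2 : u ^ (3 / 2 : ℝ) = u ^ (1 / 2 : ℝ) * u := by
      rw [show (3 / 2 : ℝ) = 1 / 2 + 1 by norm_num, Real.rpow_add_one' hu (by norm_num)]
    have h3 : u ^ (1 / 2 : ℝ) ≤ 1 + u ^ (3 / 2 : ℝ) := by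
      have h5 : 0 ≤ u ^ (3 / 2 : ℝ) := by positivity
      rcases le_total u 1 with h4 | h4
      · linarith [Real.rpow_le_one hu h4 (by norm_num : (0 : ℝ) ≤ 1 / 2)]
      · linarith [Real.rpow_le_rpow_of_exponent_le h4 (by norm_num : (1 / 2 : ℝ) ≤ 3 / 2)]
    have h4 : u ^ (1 / 2 : ℝ) * ((u + a) / a) = u ^ (3 / 2 : ℝ) / a + u ^ (1 / 2 : ℝ) := by
      rw [h2]
      field_simp
    have h5 : (1 + 1 / a) * u ^ (3 / 2 : ℝ) = u ^ (3 / 2 : ℝ) + u ^ (3 / 2 : ℝ) / a := by ring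
    rw [h4, h5]
    linarith
  refine (lintegral_mono h1).trans_lt ?_
  rw [lintegral_mul_const _ (by fun_prop), lintegral_add_left measurable_const, lintegral_const,
    measure_univ, mul_one, lintegral_const_mul _ (by fun_prop)]
  refine ENNReal.mul_lt_top (ENNReal.add_lt_top.2 ⟨by simp, ENNReal.mul_lt_top (by simp) h.2.2⟩) ?_
  exact ENNReal.inv_lt_top.2 hνa

end Centred

/-! ### Null recurrence in dimension one -/

/-- Each of the criteria implies null recurrence in dimension one. -/
theorem NullRecurrenceCriterion.isNullRecurrent {μ : Measure (Fin 1 → ℝ)} [IsProbabilityMeasure μ]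
    (hpos : ∀ i, 0 < coordMarginal μ i (Ioi 0))
    (hlat : ∀ i, IsLattice (coordMarginal μ i) → IsNormalizedLattice (coordMarginal μ i))
    (h : NullRecurrenceCriterion (coordMarginal μ 0)) : IsNullRecurrent μ := by
  have hne : 0 < meanPos (coordMarginal μ 0) := by
    rw [pos_iff_ne_zero]
    intro h0
    rw [meanPos, lintegral_eq_zero_iff (by fun_prop)] at h0
    refine (hpos 0).ne' (measure_eq_zero_iff_ae_notMem.2 ?_)
    filter_upwards [h0] with t ht ht0
    have h1 : (0 : ℝ) < t := ht0
    simp only [Pi.zero_apply, ENNReal.ofReal_eq_zero] at ht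
    exact absurd (le_max_left t 0 |>.trans ht) (not_le.2 h1)
  have hcentred : meanNeg (coordMarginal μ 0) = meanPos (coordMarginal μ 0) →
      meanPos (coordMarginal μ 0) ≠ ∞ →
      ∃ r : ℝ, 0 < r ∧ ∑' j, incrementLaw (coordMarginal μ 0) (stay r j) = ∞ := by
    intro heq hfin
    -- Any radius in `(0, 2 * meanPos)` would do.
    refine ⟨(meanPos (coordMarginal μ 0)).toReal, ENNReal.toReal_pos hne.ne' hfin,
      tsum_stay_eq_top_of_mean_eq _ heq hfin ?_⟩
    rw [ENNReal.ofReal_toReal hfin, two_mul]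
    exact ENNReal.lt_add_right hfin hne.ne'
  -- Under each criterion the positive part has infinite mean, or both parts have the same finite
  -- mean.
  have hreturn : ∃ r : ℝ, 0 < r ∧ ∑' j, incrementLaw (coordMarginal μ 0) (stay r j) = ∞ := by
    by_cases htop : meanPos (coordMarginal μ 0) = ∞
    · exact ⟨1, one_pos, tsum_stay_eq_top_of_meanPos _ htop⟩
    · rcases h with h | h | h | h
      · exact absurd h.2.1 htop
      · exact absurd h.2.1 htop
      · exact hcentred h.2.1 htop
      · refine hcentred ?_ htop
        conv_rhs => rw [← h.1]
        rw [meanPos, lintegral_map (by fun_prop) measurable_neg]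
        rfl
  have hnt : ∀ᵐ ω ∂(incrementLaw (coordMarginal μ 0)), ¬ Tendsto (absPath 0 ω) atTop atTop := by
    rcases h with h | h | h | h
    · exact h.ae_not_tendsto (hpos 0)
    · exact h.ae_not_tendsto
    · exact h.ae_not_tendsto
    · exact h.ae_not_tendsto
  intro x _
  have h0 := zero_mem_attractor hpos hlat hnt x
  obtain ⟨r, hr, hstay⟩ := hreturn
  exact ⟨⟨0, h0⟩, not_finiteMeanReturn h0 hr hstay⟩

end ReflectedWalk

theorem mainTheorem8 (r₁ r₂ : ℕ) (μ : MeasureTheory.Measure (Fin (r₁ + r₂) → ℝ))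
    [MeasureTheory.IsProbabilityMeasure μ]
    (hpos : ∀ i, 0 < ReflectedWalk.coordMarginal μ i (Set.Ioi 0))
    (hlat : ∀ i, ReflectedWalk.IsLattice (ReflectedWalk.coordMarginal μ i) →
      ReflectedWalk.IsNormalizedLattice (ReflectedWalk.coordMarginal μ i))
    (hprod : μ = ReflectedWalk.productLaw
      (ReflectedWalk.firstMarginal μ) (ReflectedWalk.lastMarginal μ))
    (hfirst : ReflectedWalk.IsPositiveRecurrent (ReflectedWalk.firstMarginal μ)) :
    (ReflectedWalk.IsNullRecurrent (ReflectedWalk.lastMarginal μ) →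
      ReflectedWalk.IsNullRecurrent μ) ∧
    (r₂ = 1 →
      (∀ i : Fin r₂, ReflectedWalk.NullRecurrenceCriterion
        (ReflectedWalk.coordMarginal μ (Fin.natAdd r₁ i))) →
      ReflectedWalk.IsNullRecurrent μ) := by
  have hparts := ReflectedWalk.isNullRecurrent_of_parts hprod hpos hlat hfirst
  refine ⟨hparts, ?_⟩
  rintro rfl h
  refine hparts (ReflectedWalk.NullRecurrenceCriterion.isNullRecurrent (fun i => ?_)
    (fun i => ?_) ?_)
  · rw [ReflectedWalk.coordMarginal_lastMarginal]
    exact hpos _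
  · rw [ReflectedWalk.coordMarginal_lastMarginal]
    exact hlat _
  · rw [ReflectedWalk.coordMarginal_lastMarginal]
    exact h 0
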